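/- **Setting.** For $j\in\mathbb N$ let $P_{0,j},P_{1,j}$ be probability distributions on a measurable space $\mathcal X_j$ with densities $f_{0,j},f_{1,j}$ with respect to a common dominating measure $\mu_j$, and let $\ell_j=\log(f_{0,j}/f_{1,j})$. Let $K_n\ge 1$ be integers with $K_n\to\infty$ and $K_n/n\to0$. For each $n$ we observe an array $\mathbf X=(X_{i,j})_{i\le n,\,j\le K_n}$ (the dependence on $n$ is suppressed) of independent random variables with $X_{i,j}\sim P_{0,j}$ for $i\le \xi_{j,n}$ and $X_{i,j}\sim P_{1,j}$ for $i>\xi_{j,n}$. The changepoint vector $\boldsymbol\xi_n=(\xi_{j,n})_{j\le K_n}$ belongs to a known constraint set $\mathcal R_n\subseteq\{1,\dots,n\}^{K_n}$ and has a unique minimizer $k_\star=k_{\star,n}=\arg\min_{j}\xi_{j,n}$, the root-cause index. **Procedure.** For one stream $x=(x_1,\dots,x_n)$ let $L_k(x,t)=\prod_{i\le t}f_{0,k}(x_i)\prod_{i>t}f_{1,k}(x_i)$ and $\hat\xi_k(x)\in\arg\max_{1\le t\le n}L_k(x,t)$. The oracle log-likelihood ratio score of an array $\mathbf x$, with $k$-th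 stream $\mathbf x_k$, and of $\mathbf t\in\mathcal R_n$ is $$S(\mathbf x,\mathbf t)=\sum_{k=1}^{K_n}\log\frac{L_k(\mathbf x_k,t_k)}{L_k(\mathbf x_k,\hat\xi_k(\mathbf x_k))}.$$ Let $\Pi_{\mathbf t}$ be the set of tuples $\pi=(\pi_1,\dots,\pi_{K_n})$ of permutations of $\{1,\dots,n\}$ such that each $\pi_k$ maps $\{1,\dots,t_k\}$ to itself and $\{t_k+1,\dots,n\}$ to itself, acting by $\pi(\mathbf x)_{i,k}=x_{\pi_k(i),k}$. Put $$p_{\mathbf t,n}=\frac1{|\Pi_{\mathbf t}|}\sum_{\pi\in\Pi_{\mathbf t}}\mathbf 1\{S(\pi(\mathbf X),\mathbf t)\le S(\mathbf X,\mathbf t)\},\qquad p_{(k),n}=\max\{p_{\mathbf t,n}:\mathbf t\in\mathcal R_n,\ t_k<t_j\ \text{for all } j\ne k\}$$ (with $\max\emptyset=0$), and $\mathcal K^{\mathrm{CROC}}_{n,1-\alpha}=\{k\le K_n: p_{(k),n}>\alpha\}$. **Theorem.** Assume that 1. (interior changepoints) for some $\tau\in(0,1/2)$, $\min_j\min(\xi_{j,n},n-\xi_{j,n})/n\ge\tau$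 for all sufficiently large $n$; 2. (distinguishability) $\mathrm{KL}(P_{0,j}\|P_{1,j})$ and $\mathrm{KL}(P_{1,j}\|P_{0,j})$ are finite for every $j$, and $\inf_j\{\mathrm{KL}(P_{0,j}\|P_{1,j})+\mathrm{KL}(P_{1,j}\|P_{0,j})\}>0$; 3. (bounded variances) $\sup_j\max\{\mathrm{Var}_{P_{0,j}}(\ell_j),\mathrm{Var}_{P_{1,j}}(\ell_j)\}<\infty$; 4. (root separation) $\min_{j\ne k_\star}(\xi_{j,n}-\xi_{k_\star,n})/(K_n\log K_n)\to\infty$ as $n\to\infty$. Then $\max_{k\ne k_\star}p_{(k),n}\to0$ in probability, and for every $\alpha\in(0,1)$ $$\mathbb P\bigl(\mathcal K^{\mathrm{CROC}}_{n,1-\alpha}=\{k_\star\}\bigr)\ge 1-\alpha-o(1)\qquad(n\to\infty).$$ -/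

import Mathlib

open MeasureTheory ProbabilityTheory Filter Topology InformationTheory
open scoped ENNReal

noncomputable section

namespace CROC

/-! Streams are indexed by `Fin K`, observation times by `Fin n`; the element `i : Fin n` is the
time `i + 1`, so "time at most `t`" reads `(i : ℕ) < t`. A data array is
`x : (k : Fin K) → Fin n → 𝒳 k`, and a changepoint configuration is `t : Fin K → ℕ`. -/

section Procedure

variable {K n : ℕ} {𝒳 : Fin K → Type*}

/-- The split-permutation group of a configuration `t`: in each stream `k`, the times up to `t k`
and the times after `t k` are permuted separately. -/
def splitPerms (n : ℕ) (t : Fin K → ℕ) : Set (Fin K → Equiv.Perm (Fin n)) :=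
  {π | ∀ (k : Fin K) (i : Fin n), ((i : ℕ) < t k → (π k i : ℕ) < t k) ∧ (t k ≤ (i : ℕ) → t k ≤ (π k i : ℕ))}

/-- The permuted array `π(x)`, with entries `x_{π_k(i), k}`. -/
def permute (π : Fin K → Equiv.Perm (Fin n)) (x : (k : Fin K) → Fin n → 𝒳 k) :
    (k : Fin K) → Fin n → 𝒳 k :=
  fun k i => x k (π k i)

/-- The conformal p-value of a configuration `t`, for a score `S`: the proportion of split
permutations `π` with `S(π(x), t) ≤ S(x, t)`. -/
def configPValue (S : ((k : Fin K) → Fin n → 𝒳 k) → (Fin K → ℕ) → ℝ)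
    (x : (k : Fin K) → Fin n → 𝒳 k) (t : Fin K → ℕ) : ℝ :=
  (({π ∈ splitPerms n t | S (permute π x) t ≤ S x t}.ncard : ℕ) : ℝ) / ((splitPerms n t).ncard : ℝ)

/-- `k` is the (unique) root-cause index of the configuration `t`. -/
def IsRoot (t : Fin K → ℕ) (k : Fin K) : Prop :=
  ∀ j, j ≠ k → t k < t j

/-- The candidate configurations in the constraint set `R` whose root-cause index is `k`. -/
def rootConfigs (R : Set (Fin K → ℕ)) (k : Fin K) : Set (Fin K → ℕ) :=
  {t ∈ R | IsRoot t k}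

/-- The p-value of stream `k`: the maximum of the p-values of the configurations in `R` with root
`k`. It is `0` if there are none. -/
def rootPValue (R : Set (Fin K → ℕ)) (S : ((k : Fin K) → Fin n → 𝒳 k) → (Fin K → ℕ) → ℝ)
    (x : (k : Fin K) → Fin n → 𝒳 k) (k : Fin K) : ℝ :=
  ⨆ t : rootConfigs R k, configPValue S x t

/-- The CROC confidence set at level `1 - α`. -/
def confidenceSet (R : Set (Fin K → ℕ)) (S : ((k : Fin K) → Fin n → 𝒳 k) → (Fin K → ℕ) → ℝ)
    (α : ℝ) (x : (k : Fin K) → Fin n → 𝒳 k) : Set (Fin K) :=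
  {k | α < rootPValue R S x k}

end Procedure

section OracleScore

/-- The likelihood of a changepoint at `t` in one stream:
`∏_{i ≤ t} f₀(x_i) · ∏_{i > t} f₁(x_i)`. -/
def likelihood {n : ℕ} {A : Type*} (f₀ f₁ : A → ℝ) (x : Fin n → A) (t : ℕ) : ℝ :=
  ∏ i : Fin n, if (i : ℕ) < t then f₀ (x i) else f₁ (x i)

/-- The maximum likelihood estimate of the changepoint over `{1, …, n}` (the smallest maximizer;
the value of the likelihood there does not depend on how ties are broken). -/
def mle {n : ℕ} {A : Type*} (f₀ f₁ : A → ℝ) (x : Fin n → A) : ℕ :=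
  sInf {t ∈ Set.Icc 1 n | ∀ s ∈ Set.Icc 1 n, likelihood f₀ f₁ x s ≤ likelihood f₀ f₁ x t}

/-- The oracle log-likelihood ratio score of a configuration `t`, relative to the maximum
likelihood estimates computed from the same array with the true densities. -/
def oracleScore {K n : ℕ} {𝒳 : Fin K → Type*} (f₀ f₁ : (k : Fin K) → 𝒳 k → ℝ)
    (x : (k : Fin K) → Fin n → 𝒳 k) (t : Fin K → ℕ) : ℝ :=
  ∑ k, Real.log (likelihood (f₀ k) (f₁ k) (x k) (t k) /
    likelihood (f₀ k) (f₁ k) (x k) (mle (f₀ k) (f₁ k) (x k)))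

end OracleScore

section Model

/-- The i.i.d. changepoint model: all observations are independent (within and across streams),
those of stream `k` up to time `ξ k` have law `P₀ k`, and the later ones have law `P₁ k`. -/
structure IsIIDChangepointModel {K n : ℕ} {𝒳 : Fin K → Type*} [∀ k, MeasurableSpace (𝒳 k)]
    {Ω : Type*} [MeasurableSpace Ω] (Pr : Measure Ω) (X : (k : Fin K) → Fin n → Ω → 𝒳 k)
    (P₀ P₁ : (k : Fin K) → Measure (𝒳 k)) (ξ : Fin K → ℕ) : Prop where
  measurable : ∀ k i, Measurable (X k i)
  indep : iIndepFun (fun (p : Fin K × Fin n) => X p.1 p.2) Pr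
  law : ∀ k i, Pr.map (X k i) = if (i : ℕ) < ξ k then P₀ k else P₁ k

/-- `f` is a density of `P` with respect to `μ`. -/
structure IsDensity {A : Type*} [MeasurableSpace A] (P μ : Measure A) (f : A → ℝ) : Prop where
  measurable : Measurable f
  nonneg : ∀ x, 0 ≤ f x
  eq_withDensity : P = μ.withDensity (fun x => ENNReal.ofReal (f x))

/-- The log-likelihood ratio `log (f₀ / f₁)`. -/
def logLR {A : Type*} (f₀ f₁ : A → ℝ) (x : A) : ℝ :=
  Real.log (f₀ x / f₁ x)

end Model

end CROC

end

/-! Let `t` be a constraint configuration with root `k ≠ k⋆`, and let `D` be the separation of the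
true root. Since `t k < t k⋆` while `ξ k - ξ k⋆ ≥ D`, the total displacement `∑ |t j - ξ j|` is at
least `D`. A split permutation for `t` leaves every likelihood at `t` unchanged, so `S(π(x), t) ≤
S(x, t)` forces `∑ F j ≥ 0`, where `F j` is the maximal log-likelihood of the permuted stream `j`
minus the log-likelihood of the original stream at `ξ j`. If `t j ≠ ξ j`, the permutation mixes
observations of both laws inside one block and no single changepoint fits: `F j` has a drift below
`-κ |t j - ξ j|`. The p-value is therefore at most the proportion of permutations whose fluctuations
beat a total drift of at least `κ D`.

Only second moments are available. The supremum of a random walk with negative drift then has a tail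
of order `1 / x`, and its mean truncated at `T = 2 ^ p` is of order `p`. Truncating each stream's
excess `F j + κ |t j - ξ j|` at `T ≤ κ D` loses nothing, because the truncated excesses of a bad
permutation still add up to at least `T`. Markov's inequality over the permutations gives
`configPValue_le`: the p-value is at most `∑ streamBound / T`. As `streamBound` depends on the data
but not on `t`, this is uniform over all configurations without a union bound. Its expectation is
`O(p)` per stream (`IsNoise.integral_streamBound_le`), so the largest wrong p-value is bounded by a
variable with mean of order `K p / 2 ^ p`, which vanishes when `D ≫ K log K`
(`exists_truncation_levels`).

Inside one stream, averaging over permutations is sampling without replacement. `Exch.sum_runMax_sq`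
is its maximal inequality, `levelSum` turns maximal inequalities into truncated-excess bounds by
dyadic blocking, and `sum_tpos_excess_le` and `sum_tpos_stream_le` assemble the pieces. The drift
needs each of the two divergences bounded below, whereas only their sum is assumed to be;
`jeffreys_le_integral` bridges this using the bounded variances.

For coverage, the split permutations of the true `ξ` preserve the law of the data, so the p-value at
`ξ` is super-uniform (`measure_configPValue_le`). Hence `k⋆` is lost with probability at most `α`,
and all other streams are rejected with probability tending to one. -/

namespace CROC

/-! ### Deterministic form of Doob's inequality. -/

section PathwiseMaximal

/-- The running maximum of a real sequence. -/
def runMax (s : ℕ → ℝ) : ℕ → ℝ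
  | 0 => s 0
  | r + 1 => max (runMax s r) (s (r + 1))

theorem le_runMax (s : ℕ → ℝ) {i r : ℕ} (h : i ≤ r) : s i ≤ runMax s r := by
  induction r with
  | zero => obtain rfl : i = 0 := by omega
            exact le_rfl
  | succ r ih =>
    rcases Nat.lt_or_ge i (r + 1) with h' | h'
    · exact (ih (by omega)).trans (le_max_left _ _)
    · obtain rfl : i = r + 1 := by omega
      exact le_max_right _ _

theorem runMax_le {s : ℕ → ℝ} {r : ℕ} {B : ℝ} (h : ∀ i ≤ r, s i ≤ B) : runMax s r ≤ B := by
  induction r with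
  | zero => exact h 0 le_rfl
  | succ r ih => exact max_le (ih fun i hi => h i (by omega)) (h _ le_rfl)

theorem runMax_congr {s s' : ℕ → ℝ} {r : ℕ} (h : ∀ i ≤ r, s i = s' i) :
    runMax s r = runMax s' r := by
  induction r with
  | zero => exact h 0 le_rfl
  | succ r ih =>
    simp only [runMax]
    rw [ih fun i hi => h i (by omega), h _ le_rfl]

theorem runMax_nonneg {s : ℕ → ℝ} (h0 : s 0 = 0) (r : ℕ) : 0 ≤ runMax s r :=
  h0 ▸ le_runMax s (Nat.zero_le r)

/-- Pathwise form of Doob's `L²` maximal inequality. -/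
theorem runMax_sq_le {s : ℕ → ℝ} (h0 : s 0 = 0) (r : ℕ) :
    runMax s r ^ 2 ≤ 4 * s r ^ 2 - 4 * ∑ i ∈ Finset.range r, runMax s i * (s (i + 1) - s i) := by
  -- This form telescopes under induction: the running maximum changes only at times when it equals
  -- the walk. The claim follows by completing the square in `runMax s r - 2 * s r`.
  have key : runMax s r ^ 2 / 2 ≤
      runMax s r * s r - ∑ i ∈ Finset.range r, runMax s i * (s (i + 1) - s i) := by
    induction r with
    | zero => simp [runMax, h0]
    | succ r ih =>
      rw [Finset.sum_range_succ]
      simp only [runMax]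
      rcases le_total (runMax s r) (s (r + 1)) with h | h
      · rw [max_eq_right h]
        nlinarith [sq_nonneg (s (r + 1) - runMax s r)]
      · rw [max_eq_left h]
        nlinarith
  nlinarith [sq_nonneg (runMax s r - 2 * s r)]

/-- Partial sums. -/
def psum (z : ℕ → ℝ) (r : ℕ) : ℝ := ∑ i ∈ Finset.range r, z i

@[simp] theorem psum_zero (z : ℕ → ℝ) : psum z 0 = 0 := by simp [psum]

theorem psum_succ (z : ℕ → ℝ) (r : ℕ) : psum z (r + 1) = psum z r + z r := by
  simp [psum, Finset.sum_range_succ]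

theorem psum_congr {z z' : ℕ → ℝ} {r : ℕ} (h : ∀ i < r, z i = z' i) : psum z r = psum z' r :=
  Finset.sum_congr rfl fun i hi => h i (Finset.mem_range.1 hi)

end PathwiseMaximal

/-! ### Maximal inequalities for sampling without replacement. -/

section Exchangeable

variable {γ ι : Type*}

/-- Under the uniform distribution on the finite set `G`, the first `N` terms of the random
sequence `Z` are exchangeable. -/
def Exch (G : Finset γ) (N : ℕ) (Z : γ → ℕ → ι) : Prop :=
  ∀ i j, i < N → j < N → ∀ F : (ℕ → ι) → ℝ,
    ∑ g ∈ G, F (Z g) = ∑ g ∈ G, F (fun l => Z g (Equiv.swap i j l))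

theorem Exch.comp {G : Finset γ} {N : ℕ} {Z : γ → ℕ → ι} (h : Exch G N Z) {κ : Type*}
    (φ : ι → κ) : Exch G N (fun g i => φ (Z g i)) :=
  fun i j hi hj F => h i j hi hj fun z => F fun l => φ (z l)

/-- The reflection of `{0, …, N - 1}`, extended by the identity. -/
def reflect (N l : ℕ) : ℕ := if l < N then N - 1 - l else l

theorem reflect_of_lt {N l : ℕ} (h : l < N) : reflect N l = N - 1 - l := if_pos h

theorem Exch.rev {G : Finset γ} {N : ℕ} {Z : γ → ℕ → ι} (h : Exch G N Z) :
    Exch G N (fun g i => Z g (reflect N i)) := by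
  intro i j hi hj F
  rw [h (N - 1 - i) (N - 1 - j) (by omega) (by omega) fun z => F fun l => z (reflect N l)]
  refine Finset.sum_congr rfl fun g _ => ?_
  congr 1
  funext l
  change Z g (Equiv.swap (N - 1 - i) (N - 1 - j) (reflect N l)) =
    Z g (reflect N (Equiv.swap i j l))
  congr 1
  by_cases hl : l < N
  · by_cases h1 : l = i
    · subst h1
      simp [reflect_of_lt hi, reflect_of_lt hj]
    · by_cases h2 : l = j
      · subst h2
        simp [reflect_of_lt hi, reflect_of_lt hj]
      · rw [Equiv.swap_apply_of_ne_of_ne h1 h2, reflect_of_lt hl,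
          Equiv.swap_apply_of_ne_of_ne (by omega) (by omega)]
  · have h1 : l ≠ i := by omega
    have h2 : l ≠ j := by omega
    rw [Equiv.swap_apply_of_ne_of_ne h1 h2, reflect, if_neg hl,
      Equiv.swap_apply_of_ne_of_ne (by omega) (by omega)]

variable {G : Finset γ} {N : ℕ} {z : γ → ℕ → ℝ}

/-- Given the first `r` terms, the remaining `N - r` terms are interchangeable and add up to `-psum
(z g) r`, so each has conditional mean `-psum (z g) r / (N - r)`. -/
theorem Exch.sum_mul_next (h : Exch G N z) (hsum : ∀ g ∈ G, psum (z g) N = 0)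
    {r : ℕ} (hr : r < N) (f : (ℕ → ℝ) → ℝ)
    (hf : ∀ u u' : ℕ → ℝ, (∀ i < r, u i = u' i) → f u = f u') :
    ((N : ℝ) - r) * ∑ g ∈ G, f (z g) * z g r = - ∑ g ∈ G, f (z g) * psum (z g) r := by
  have e1 : ∀ i ∈ Finset.Ico r N, ∑ g ∈ G, f (z g) * z g i = ∑ g ∈ G, f (z g) * z g r := by
    intro i hi
    rw [Finset.mem_Ico] at hi
    rw [h r i hr hi.2 fun u => f u * u i]
    refine Finset.sum_congr rfl fun g _ => ?_
    simp only [Equiv.swap_apply_right]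
    congr 1
    refine hf _ _ fun l hl => ?_
    rw [Equiv.swap_apply_of_ne_of_ne (by omega) (by omega)]
  have e2 := Finset.sum_congr rfl e1
  rw [Finset.sum_const, Nat.card_Ico, nsmul_eq_mul, Nat.cast_sub hr.le] at e2
  rw [← e2, Finset.sum_comm, ← Finset.sum_neg_distrib]
  refine Finset.sum_congr rfl fun g hg => ?_
  have := hsum g hg
  rw [psum, ← Finset.sum_range_add_sum_Ico _ hr.le] at this
  rw [← Finset.mul_sum, psum]
  linear_combination f (z g) * this

theorem Exch.sum_sq (h : Exch G N z) {Q : ℝ}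
    (hQ : ∀ g ∈ G, ∑ i ∈ Finset.range N, z g i ^ 2 ≤ Q) {r : ℕ} (hr : r < N) :
    ∑ g ∈ G, z g r ^ 2 ≤ G.card * Q / N := by
  have e1 : ∀ i ∈ Finset.range N, ∑ g ∈ G, z g i ^ 2 = ∑ g ∈ G, z g r ^ 2 := by
    intro i hi
    rw [h i r (Finset.mem_range.1 hi) hr fun u => u i ^ 2]
    simp
  have e2 := Finset.sum_congr rfl e1
  rw [Finset.sum_const, Finset.card_range, nsmul_eq_mul, Finset.sum_comm] at e2
  have hN : (0 : ℝ) < N := by exact_mod_cast (by omega : 0 < N)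
  rw [le_div_iff₀ hN, mul_comm, ← e2]
  refine (Finset.sum_le_sum hQ).trans ?_
  simp

/-- By `Exch.sum_mul_next` the cross term between a partial sum and the next draw is nonpositive, so
the variance is at most that of sampling with replacement. -/
theorem Exch.sum_psum_sq (h : Exch G N z) (hsum : ∀ g ∈ G, psum (z g) N = 0) {Q : ℝ}
    (hQ : ∀ g ∈ G, ∑ i ∈ Finset.range N, z g i ^ 2 ≤ Q) {r : ℕ} (hr : r ≤ N) :
    ∑ g ∈ G, psum (z g) r ^ 2 ≤ r * (G.card * Q / N) := by
  induction r with
  | zero => simp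
  | succ r ih =>
    have ih := ih (by omega)
    have e := h.sum_mul_next hsum (r := r) (by omega) (fun u => psum u r)
      (fun u u' huu => psum_congr huu)
    have e' := h.sum_sq hQ (r := r) (by omega)
    have hpos : (0 : ℝ) < (N : ℝ) - r := by
      have : ((r + 1 : ℕ) : ℝ) ≤ N := by exact_mod_cast hr
      push_cast at this; linarith
    have hneg : ∑ g ∈ G, psum (z g) r * z g r ≤ 0 := by
      have : 0 ≤ ∑ g ∈ G, psum (z g) r * psum (z g) r :=
        Finset.sum_nonneg fun g _ => mul_self_nonneg _
      by_contra hc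
      push Not at hc
      nlinarith [mul_pos hpos hc]
    have e3 : ∑ g ∈ G, psum (z g) (r + 1) ^ 2 = ∑ g ∈ G, psum (z g) r ^ 2
        + 2 * ∑ g ∈ G, psum (z g) r * z g r + ∑ g ∈ G, z g r ^ 2 := by
      rw [Finset.mul_sum, ← Finset.sum_add_distrib, ← Finset.sum_add_distrib]
      refine Finset.sum_congr rfl fun g _ => ?_
      rw [psum_succ]; ring
    rw [e3]
    push_cast
    linarith

theorem Exch.sum_runMax_sq_half (h : Exch G N z) (hsum : ∀ g ∈ G, psum (z g) N = 0) {Q : ℝ}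
    (hQ : ∀ g ∈ G, ∑ i ∈ Finset.range N, z g i ^ 2 ≤ Q) {R : ℕ} (hR : 2 * R ≤ N) :
    ∑ g ∈ G, runMax (psum (z g)) R ^ 2 ≤ 16 * (R * (G.card * Q / N)) := by
  rcases Nat.eq_zero_or_pos R with rfl | hRpos
  · simp [runMax]
  have hN : (0 : ℝ) < N := by exact_mod_cast (by omega : 0 < N)
  have hNr : ∀ r ≤ R, (N : ℝ) / 2 ≤ (N : ℝ) - r := by
    intro r hr
    have h1 : ((2 * R : ℕ) : ℝ) ≤ N := by exact_mod_cast hR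
    have h2 : (r : ℝ) ≤ R := by exact_mod_cast hr
    push_cast at h1; linarith
  set x : (ℕ → ℝ) → ℕ → ℝ := fun u r => psum u r / ((N : ℝ) - r) with hx
  have hx0 : ∀ u, x u 0 = 0 := fun u => by simp [hx]
  have horth : ∀ r < R, ∑ g ∈ G, runMax (x (z g)) r * (x (z g) (r + 1) - x (z g) r) = 0 := by
    intro r hr
    have e := h.sum_mul_next hsum (r := r) (by omega) (fun u => runMax (x u) r) (by
      intro u u' huu
      refine runMax_congr fun i hi => ?_
      simp only [hx]
      rw [psum_congr fun l hl => huu l (by omega)])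
    have p1 := hNr r hr.le
    have p2 := hNr (r + 1) hr
    push_cast at p2
    have q1 : (N : ℝ) - r ≠ 0 := by linarith
    have q2 : (N : ℝ) - (r + 1) ≠ 0 := by linarith
    have e2 : ∀ g ∈ G, runMax (x (z g)) r * (x (z g) (r + 1) - x (z g) r) =
        (((N : ℝ) - r) * (runMax (x (z g)) r * z g r) + runMax (x (z g)) r * psum (z g) r) /
          (((N : ℝ) - r) * ((N : ℝ) - (r + 1))) := by
      intro g _
      rw [eq_div_iff (mul_ne_zero q1 q2)]
      simp only [hx, psum_succ]
      push_cast
      field_simp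
      ring
    rw [Finset.sum_congr rfl e2, ← Finset.sum_div, Finset.sum_add_distrib, ← Finset.mul_sum, e]
    simp
  have hle : ∀ g ∈ G, runMax (psum (z g)) R ^ 2 ≤ (N : ℝ) ^ 2 * runMax (x (z g)) R ^ 2 := by
    intro g _
    rw [← mul_pow]
    refine pow_le_pow_left₀ (runMax_nonneg (psum_zero _) R) (runMax_le fun i hi => ?_) 2
    have p := hNr i hi
    have hpos : 0 < (N : ℝ) - i := by linarith
    have e : psum (z g) i = ((N : ℝ) - i) * x (z g) i := by simp only [hx]; field_simp
    rw [e]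
    have h0 := runMax_nonneg (hx0 (z g)) R
    calc ((N : ℝ) - i) * x (z g) i ≤ ((N : ℝ) - i) * runMax (x (z g)) R :=
          mul_le_mul_of_nonneg_left (le_runMax _ hi) hpos.le
      _ ≤ N * runMax (x (z g)) R := by
          refine mul_le_mul_of_nonneg_right ?_ h0
          have : (0 : ℝ) ≤ i := by positivity
          linarith
  calc ∑ g ∈ G, runMax (psum (z g)) R ^ 2
      ≤ ∑ g ∈ G, (N : ℝ) ^ 2 * (4 * x (z g) R ^ 2 -
          4 * ∑ i ∈ Finset.range R, runMax (x (z g)) i * (x (z g) (i + 1) - x (z g) i)) := by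
        refine Finset.sum_le_sum fun g hg => (hle g hg).trans ?_
        exact mul_le_mul_of_nonneg_left (runMax_sq_le (hx0 _) R) (by positivity)
    _ = (N : ℝ) ^ 2 * (4 * ∑ g ∈ G, x (z g) R ^ 2) := by
        rw [← Finset.mul_sum, Finset.sum_sub_distrib, ← Finset.mul_sum, ← Finset.mul_sum,
          Finset.sum_comm, Finset.sum_eq_zero fun i hi => horth i (Finset.mem_range.1 hi)]
        ring
    -- For `R ≤ N / 2` the normalisation satisfies `N - R ≥ N / 2`; the restriction to half the
    -- sample serves only to keep this denominator comparable to `N`.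
    _ ≤ (N : ℝ) ^ 2 * (4 * ∑ g ∈ G, psum (z g) R ^ 2 * (4 / (N : ℝ) ^ 2)) := by
        gcongr with g hg
        simp only [hx]
        rw [div_pow, div_eq_mul_inv]
        refine mul_le_mul_of_nonneg_left ?_ (sq_nonneg _)
        have p := hNr R le_rfl
        rw [inv_le_comm₀ (by nlinarith) (by positivity), inv_div]
        nlinarith
    _ = 16 * ∑ g ∈ G, psum (z g) R ^ 2 := by
        rw [← Finset.sum_mul]
        field_simp
        ring
    _ ≤ _ := by
        have := h.sum_psum_sq hsum hQ (r := R) (by omega)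
        linarith

theorem psum_reflect (u : ℕ → ℝ) {N r : ℕ} (hr : r ≤ N) :
    psum (fun i => u (reflect N i)) (N - r) = psum u N - psum u r := by
  have e1 : psum (fun i => u (reflect N i)) (N - r) = ∑ i ∈ Finset.Ico r N, u i := by
    rw [psum, Finset.range_eq_Ico]
    refine Finset.sum_nbij' (fun i => N - 1 - i) (fun i => N - 1 - i) ?_ ?_ ?_ ?_ ?_ <;>
      intro i hi <;> simp only [Finset.mem_Ico] at * <;> first | omega | rw [reflect_of_lt (by omega)]
  rw [e1, psum, psum, ← Finset.sum_range_add_sum_Ico _ hr]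
  ring

theorem psum_rev_neg {u : ℕ → ℝ} {N : ℕ} (hu : psum u N = 0) {r : ℕ} (hr : r ≤ N) :
    psum (fun i => - u (reflect N i)) (N - r) = psum u r := by
  rw [psum_reflect (fun i => - u i) hr]
  simp only [psum, Finset.sum_neg_distrib] at hu ⊢
  rw [hu]; ring

/-- Maximal inequality for sampling without replacement. -/
theorem Exch.sum_runMax_sq (h : Exch G N z) (hsum : ∀ g ∈ G, psum (z g) N = 0) {Q : ℝ}
    (hQ : ∀ g ∈ G, ∑ i ∈ Finset.range N, z g i ^ 2 ≤ Q) {R : ℕ} (hR : R ≤ N) :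
    ∑ g ∈ G, runMax (psum (z g)) R ^ 2 ≤ 32 * (R * (G.card * Q / N)) := by
  rcases G.eq_empty_or_nonempty with rfl | ⟨g₀, hg₀⟩
  · simp
  have hQ0 : 0 ≤ Q := (Finset.sum_nonneg fun i _ => sq_nonneg _).trans (hQ g₀ hg₀)
  have hB : 0 ≤ (G.card : ℝ) * Q / N := by positivity
  rcases Nat.lt_or_ge N (2 * R) with h2 | h2
  swap
  · refine (h.sum_runMax_sq_half hsum hQ h2).trans ?_
    have : 0 ≤ (R : ℝ) * (G.card * Q / N) := by positivity
    linarith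
  -- Since the total is zero, a prefix sum equals minus the complementary suffix sum. Prefixes
  -- longer than `N / 2` are thus short prefixes of the reversed, negated sample, which is again
  -- exchangeable; this doubles the constant.
  set z' : γ → ℕ → ℝ := fun g i => - z g (reflect N i) with hz'
  have hz'ex : Exch G N z' := (h.comp fun a => - a).rev
  have hz'sum : ∀ g ∈ G, psum (z' g) N = 0 := by
    intro g hg
    have := psum_rev_neg (hsum g hg) (Nat.zero_le N)
    simpa using this
  have hz'Q : ∀ g ∈ G, ∑ i ∈ Finset.range N, z' g i ^ 2 ≤ Q := by
    intro g hg
    refine le_trans (le_of_eq ?_) (hQ g hg)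
    rw [← Finset.sum_range_reflect]
    refine Finset.sum_congr rfl fun i hi => ?_
    have := Finset.mem_range.1 hi
    simp only [hz', reflect_of_lt (show N - 1 - i < N by omega), neg_sq]
    congr 2
    omega
  have b1 := h.sum_runMax_sq_half hsum hQ (R := N / 2) (by omega)
  have b2 := hz'ex.sum_runMax_sq_half hz'sum hz'Q (R := N / 2) (by omega)
  have hle : ∀ g ∈ G, runMax (psum (z g)) R ^ 2 ≤
      runMax (psum (z g)) (N / 2) ^ 2 + runMax (psum (z' g)) (N / 2) ^ 2 := by
    intro g hg
    have n1 := runMax_nonneg (psum_zero (z g)) (N / 2)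
    have n2 := runMax_nonneg (psum_zero (z' g)) (N / 2)
    have : runMax (psum (z g)) R ≤
        max (runMax (psum (z g)) (N / 2)) (runMax (psum (z' g)) (N / 2)) := by
      refine runMax_le fun i hi => ?_
      rcases Nat.lt_or_ge (N / 2) i with hi2 | hi2
      · rw [← psum_rev_neg (hsum g hg) (hi.trans hR)]
        exact (le_runMax _ (by omega)).trans (le_max_right _ _)
      · exact (le_runMax _ hi2).trans (le_max_left _ _)
    refine (pow_le_pow_left₀ (runMax_nonneg (psum_zero _) R) this 2).trans ?_
    rcases max_choice (runMax (psum (z g)) (N / 2)) (runMax (psum (z' g)) (N / 2)) with e | e <;>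
      rw [e] <;> nlinarith
  refine (Finset.sum_le_sum hle).trans ?_
  rw [Finset.sum_add_distrib]
  have hNR : ((N / 2 : ℕ) : ℝ) ≤ R := by exact_mod_cast (by omega : N / 2 ≤ R)
  nlinarith [mul_le_mul_of_nonneg_right hNR hB]

end Exchangeable

/-! ### Truncated excesses and dyadic levels. -/

section Truncation

/-- The positive part of `x`, truncated at `T`. -/
noncomputable def tpos (T x : ℝ) : ℝ := min T (max x 0)

theorem tpos_nonneg {T : ℝ} (hT : 0 ≤ T) (x : ℝ) : 0 ≤ tpos T x :=
  le_min hT (le_max_right _ _)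

theorem tpos_mono {T x y : ℝ} (h : x ≤ y) : tpos T x ≤ tpos T y :=
  min_le_min le_rfl (max_le_max h le_rfl)

theorem tpos_of_nonpos {T x : ℝ} (hT : 0 ≤ T) (h : x ≤ 0) : tpos T x = 0 := by
  rw [tpos, max_eq_right h, min_eq_right hT]

theorem tpos_posPart (T x : ℝ) : tpos T (max x 0) = tpos T x := by simp [tpos]

theorem tpos_add_le {T : ℝ} (hT : 0 ≤ T) (x y : ℝ) : tpos T (x + y) ≤ tpos T x + tpos T y := by
  simp only [tpos, min_def, max_def]
  split_ifs <;> linarith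

/-- Both bounds come from `z / a ≥ 1` whenever the excess is positive: `z ≤ z² / a` and `T ≤ T (z /
a)²`. The second gains decay in `a` from a second moment alone. -/
theorem tpos_sub_le {T z a : ℝ} (hT : 0 ≤ T) (hz : 0 ≤ z) (ha : 0 < a) :
    tpos T (z - a) ≤ z ^ 2 / a * min 1 (T / a) := by
  rcases le_total z a with h | h
  · rw [tpos_of_nonpos hT (by linarith)]
    have : 0 ≤ T / a := by positivity
    positivity
  · have hza : 1 ≤ z / a := by rwa [le_div_iff₀ ha, one_mul]
    rw [mul_min_of_nonneg _ _ (by positivity), tpos, max_eq_left (by linarith), min_comm]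
    refine min_le_min ?_ ?_
    · have : z ^ 2 / a = z * (z / a) := by ring
      rw [this]
      nlinarith
    · have : z ^ 2 / a * (T / a) = T * (z / a) ^ 2 := by ring
      rw [this]
      exact le_mul_of_one_le_right hT (one_le_pow₀ hza)

/-- The truncation weight of the dyadic level `j` when the truncation point is `2 ^ p`. -/
noncomputable def lvl (p j : ℕ) : ℝ := min 1 (2 ^ p / 2 ^ j)

theorem lvl_nonneg (p j : ℕ) : 0 ≤ lvl p j := by unfold lvl; positivity

theorem lvl_le_one (p j : ℕ) : lvl p j ≤ 1 := min_le_left _ _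

/-- Levels below `p` count one each and those above form a geometric series. This is the source of
the logarithmic factor. -/
theorem sum_lvl_le (p J : ℕ) : ∑ j ∈ Finset.range J, lvl p j ≤ p + 2 := by
  rcases le_total J p with h | h
  · calc ∑ j ∈ Finset.range J, lvl p j ≤ ∑ j ∈ Finset.range J, (1 : ℝ) :=
          Finset.sum_le_sum fun j _ => lvl_le_one p j
      _ = J := by simp
      _ ≤ p + 2 := by
          have : (J : ℝ) ≤ p := by exact_mod_cast h
          linarith
  · have key : ∑ j ∈ Finset.range J, lvl p j ≤ p + 2 - 2 * (2 ^ p / 2 ^ J) := by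
      induction J, h using Nat.le_induction with
      | base =>
        rw [div_self (by positivity)]
        calc ∑ j ∈ Finset.range p, lvl p j ≤ ∑ j ∈ Finset.range p, (1 : ℝ) :=
              Finset.sum_le_sum fun j _ => lvl_le_one p j
          _ = p + 2 - 2 * 1 := by simp
      | succ J _ ih =>
        rw [Finset.sum_range_succ]
        have : lvl p J ≤ 2 ^ p / 2 ^ J := min_le_right _ _
        have e : 2 * ((2 : ℝ) ^ p / 2 ^ (J + 1)) = 2 ^ p / 2 ^ J := by
          rw [pow_succ]; field_simp
        rw [e]
        linarith
    have : (0 : ℝ) ≤ 2 * (2 ^ p / 2 ^ J) := by positivity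
    linarith

theorem min_one_div_le {p j : ℕ} {κ a : ℝ} (hκ : 0 < κ) (hκ1 : κ ≤ 1) (ha : κ * 2 ^ j ≤ a) :
    min 1 ((2 : ℝ) ^ p / a) ≤ lvl p j / κ := by
  have ha0 : 0 < a := lt_of_lt_of_le (by positivity) ha
  rw [lvl, ← min_div_div_right hκ.le]
  refine min_le_min ?_ ?_
  · rwa [le_div_iff₀ hκ, one_mul]
  · rw [div_div]
    refine div_le_div_of_nonneg_left (by positivity) (by positivity) ?_
    linarith

/-- Dyadic upper bound for `min (2 ^ p) (sup_r (d r - κ (r + m))⁺)`. -/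
noncomputable def levelSum (p : ℕ) (κ m : ℝ) (N : ℕ) (d : ℕ → ℝ) : ℝ :=
  ∑ j ∈ Finset.range N, runMax d (min (2 ^ (j + 1)) N) ^ 2 * (lvl p j / (κ * (κ * (2 ^ j + m))))

theorem levelSum_nonneg {p : ℕ} {κ m : ℝ} (hm : 0 ≤ m) (N : ℕ) (d : ℕ → ℝ) :
    0 ≤ levelSum p κ m N d := by
  refine Finset.sum_nonneg fun j _ => mul_nonneg (sq_nonneg _) (div_nonneg (lvl_nonneg _ _) ?_)
  rw [← mul_assoc]
  exact mul_nonneg (mul_self_nonneg _) (by positivity)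

/-- On the dyadic block `2 ^ j ≤ r < 2 ^ (j + 1)` the walk is replaced by its running maximum and
the drift by its value at the left end; the block containing `r` is then one nonnegative term of the
sum. -/
theorem tpos_le_levelSum {p : ℕ} {κ m : ℝ} (hκ : 0 < κ) (hκ1 : κ ≤ 1) (hm : 0 ≤ m) {N : ℕ}
    {d : ℕ → ℝ} (hd : d 0 = 0) {r : ℕ} (hr : r ≤ N) :
    tpos (2 ^ p) (d r - κ * (r + m)) ≤ levelSum p κ m N d := by
  rcases Nat.eq_zero_or_pos r with rfl | hr0
  · rw [tpos_of_nonpos (by positivity)]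
    · exact levelSum_nonneg hm N d
    · rw [hd]
      have : 0 ≤ κ * (((0 : ℕ) : ℝ) + m) := by positivity
      linarith
  set j := Nat.log 2 r with hj
  have h1 : 2 ^ j ≤ r := Nat.pow_log_le_self 2 hr0.ne'
  have h2 : r < 2 ^ (j + 1) := Nat.lt_pow_succ_log_self (by norm_num) r
  have hjN : j ∈ Finset.range N := by
    rw [Finset.mem_range]
    exact (Nat.lt_two_pow_self).trans_le (h1.trans hr)
  set z := runMax d (min (2 ^ (j + 1)) N) with hz
  have hz0 : 0 ≤ z := runMax_nonneg hd _
  have hdz : d r ≤ z := le_runMax d (le_min h2.le hr)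
  have h1' : (2 : ℝ) ^ j ≤ r := by exact_mod_cast h1
  set a := κ * ((2 : ℝ) ^ j + m) with ha
  have ha0 : 0 < a := by positivity
  have hle : d r - κ * (r + m) ≤ z - a := by
    have : a ≤ κ * (r + m) := mul_le_mul_of_nonneg_left (by linarith) hκ.le
    linarith
  calc tpos (2 ^ p) (d r - κ * (r + m)) ≤ tpos (2 ^ p) (z - a) := tpos_mono hle
    _ ≤ z ^ 2 / a * min 1 (2 ^ p / a) := tpos_sub_le (by positivity) hz0 ha0
    _ ≤ z ^ 2 / a * (lvl p j / κ) := by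
        refine mul_le_mul_of_nonneg_left (min_one_div_le hκ hκ1 ?_) (by positivity)
        exact mul_le_mul_of_nonneg_left (by linarith) hκ.le
    _ = z ^ 2 * (lvl p j / (κ * a)) := by field_simp
    _ ≤ levelSum p κ m N d := by
        rw [levelSum]
        refine Finset.single_le_sum (f := fun j => runMax d (min (2 ^ (j + 1)) N) ^ 2 *
          (lvl p j / (κ * (κ * (2 ^ j + m))))) (fun i _ => ?_) hjN
        have := lvl_nonneg p i
        positivity

end Truncation

/-! ### Truncated excesses averaged over permutations. -/

section Exchangeable

variable {γ ι : Type*} {G : Finset γ} {N : ℕ} {z : γ → ℕ → ℝ}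

/-- The offset `m` in the drift improves the denominator from `N` to `N + m`. This is what keeps the
bound useful when the block of length `N` is very short. -/
theorem Exch.sum_levelSum_le (h : Exch G N z) (hsum : ∀ g ∈ G, psum (z g) N = 0) {Q : ℝ}
    (hQ0 : 0 ≤ Q) (hQ : ∀ g ∈ G, ∑ i ∈ Finset.range N, z g i ^ 2 ≤ Q) (p : ℕ) {κ m : ℝ}
    (hκ : 0 < κ) (hm : 0 ≤ m) :
    ∑ g ∈ G, levelSum p κ m N (psum (z g)) ≤ G.card * (64 * Q / (κ ^ 2 * (N + m)) * (p + 2)) := by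
  simp only [levelSum]
  rw [Finset.sum_comm]
  have hlev : ∀ j ∈ Finset.range N,
      ∑ g ∈ G, runMax (psum (z g)) (min (2 ^ (j + 1)) N) ^ 2 * (lvl p j / (κ * (κ * (2 ^ j + m))))
        ≤ G.card * (64 * Q / (κ ^ 2 * (N + m))) * lvl p j := by
    intro j hj
    have hN : (0 : ℝ) < N := by exact_mod_cast (Nat.zero_le j).trans_lt (Finset.mem_range.1 hj)
    set R : ℕ := min (2 ^ (j + 1)) N
    have hR1 : (R : ℝ) ≤ 2 * 2 ^ j := by
      have : R ≤ 2 ^ (j + 1) := min_le_left _ _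
      calc (R : ℝ) ≤ ((2 ^ (j + 1) : ℕ) : ℝ) := by exact_mod_cast this
        _ = 2 * 2 ^ j := by push_cast; ring
    have hRN : R ≤ N := min_le_right _ _
    have hR2 : (R : ℝ) ≤ N := by exact_mod_cast hRN
    have hl := lvl_nonneg p j
    rw [← Finset.sum_mul]
    have hb := h.sum_runMax_sq hsum hQ hRN
    have hratio : (R : ℝ) / (N * (2 ^ j + m)) ≤ 2 / (N + m) := by
      rw [div_le_div_iff₀ (by positivity) (by positivity)]
      nlinarith [mul_le_mul_of_nonneg_right hR1 hN.le, mul_le_mul_of_nonneg_right hR2 hm,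
        mul_nonneg hN.le hm]
    calc (∑ g ∈ G, runMax (psum (z g)) R ^ 2) * (lvl p j / (κ * (κ * (2 ^ j + m))))
        ≤ 32 * (R * (G.card * Q / N)) * (lvl p j / (κ * (κ * (2 ^ j + m)))) := by
          gcongr
      _ = 32 * (G.card * Q / κ ^ 2) * lvl p j * (R / (N * (2 ^ j + m))) := by
          field_simp
      _ ≤ 32 * (G.card * Q / κ ^ 2) * lvl p j * (2 / (N + m)) := by gcongr
      _ = G.card * (64 * Q / (κ ^ 2 * (N + m))) * lvl p j := by field_simp; ring
  refine (Finset.sum_le_sum hlev).trans ?_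
  rw [← Finset.mul_sum, mul_assoc]
  gcongr
  exact sum_lvl_le p N

/-- The drift here does not grow along the walk, so a single maximum over the whole block suffices.
In the case `m = 0` the factor `1 / m` is `0` by convention, and the hypothesis `Q = 0` makes the
left side vanish too. -/
theorem Exch.sum_tpos_runMax_le (h : Exch G N z) (hsum : ∀ g ∈ G, psum (z g) N = 0) {Q : ℝ}
    (hQ : ∀ g ∈ G, ∑ i ∈ Finset.range N, z g i ^ 2 ≤ Q) {T κ : ℝ} (hT : 0 ≤ T)
    (hκ : 0 < κ) (hκ1 : κ ≤ 1) {m : ℕ} (hm : m = 0 → Q = 0) :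
    ∑ g ∈ G, tpos T (runMax (psum (z g)) N - κ * m) ≤
      G.card * (32 * Q / κ ^ 2 * (1 / (m : ℝ) * min (1 : ℝ) (T / (m : ℝ)))) := by
  rcases G.eq_empty_or_nonempty with rfl | ⟨g₀, hg₀⟩
  · simp
  have hQ0 : 0 ≤ Q := (Finset.sum_nonneg fun i _ => sq_nonneg _).trans (hQ g₀ hg₀)
  have hb := h.sum_runMax_sq hsum hQ le_rfl
  have hb' : ∑ g ∈ G, runMax (psum (z g)) N ^ 2 ≤ 32 * (G.card * Q) := by
    refine hb.trans ?_
    rcases Nat.eq_zero_or_pos N with rfl | hN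
    · simp; positivity
    · have : (N : ℝ) ≠ 0 := by positivity
      field_simp; exact le_rfl
  rcases Nat.eq_zero_or_pos m with rfl | hm0
  · rw [hm rfl] at hb'
    simp only [mul_zero] at hb'
    have hz := (Finset.sum_eq_zero_iff_of_nonneg fun g _ => sq_nonneg _).1
      (le_antisymm hb' (Finset.sum_nonneg fun g _ => sq_nonneg _))
    rw [Finset.sum_eq_zero]
    · simp
    · intro g hg
      refine tpos_of_nonpos hT ?_
      have := pow_eq_zero_iff (two_ne_zero) |>.1 (hz g hg)
      rw [this]; simp
  · have hm' : (0 : ℝ) < m := by exact_mod_cast hm0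
    have hmin : min 1 (T / (κ * m)) ≤ min 1 (T / m) / κ := by
      rw [← min_div_div_right hκ.le]
      refine min_le_min ?_ ?_
      · rwa [le_div_iff₀ hκ, one_mul]
      · rw [div_div, mul_comm]
    calc ∑ g ∈ G, tpos T (runMax (psum (z g)) N - κ * m)
        ≤ ∑ g ∈ G, runMax (psum (z g)) N ^ 2 / (κ * m) * min 1 (T / (κ * m)) :=
          Finset.sum_le_sum fun g _ =>
            tpos_sub_le hT (runMax_nonneg (psum_zero _) N) (by positivity)
      _ = (∑ g ∈ G, runMax (psum (z g)) N ^ 2) / (κ * m) * min 1 (T / (κ * m)) := by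
          rw [Finset.sum_div, Finset.sum_mul]
      _ ≤ 32 * (G.card * Q) / (κ * m) * (min 1 (T / m) / κ) := by
          have : 0 ≤ T / (κ * m) := by positivity
          gcongr
      _ = _ := by field_simp

theorem psum_sub_const (u : ℕ → ℝ) (e : ℝ) (r : ℕ) :
    psum (fun i => u i - e) r = psum u r - r * e := by
  simp [psum, Finset.sum_sub_distrib]

theorem sum_sub_mean_sq_le {u : ℕ → ℝ} {N : ℕ} {A Q : ℝ} (hA : psum u N = A)
    (hQ : ∑ i ∈ Finset.range N, u i ^ 2 ≤ Q) :
    ∑ i ∈ Finset.range N, (u i - A / N) ^ 2 ≤ Q := by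
  have e : ∑ i ∈ Finset.range N, (u i - A / N) ^ 2 =
      ∑ i ∈ Finset.range N, u i ^ 2 - 2 * (A / N) * psum u N + N * (A / N) ^ 2 := by
    simp only [psum, sub_sq, Finset.sum_add_distrib, Finset.sum_sub_distrib, Finset.sum_const,
      Finset.card_range, nsmul_eq_mul, Finset.mul_sum]
    congr 2
    exact Finset.sum_congr rfl fun i _ => by ring
  rw [e, hA]
  rcases Nat.eq_zero_or_pos N with rfl | hN
  · simpa using hQ
  · have hN : (N : ℝ) ≠ 0 := by positivity
    have : -(2 * (A / N) * A) + N * (A / N) ^ 2 = -(A ^ 2 / N) := by field_simp; ring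
    have : 0 ≤ A ^ 2 / (N : ℝ) := by positivity
    linarith

theorem psum_sub_mean {u : ℕ → ℝ} {N : ℕ} {A : ℝ} (hA : psum u N = A) :
    psum (fun i => u i - A / N) N = 0 := by
  rw [psum_sub_const, hA]
  rcases Nat.eq_zero_or_pos N with rfl | hN
  · simp [← hA]
  · have hN : (N : ℝ) ≠ 0 := by positivity
    field_simp; simp

/-- Half of the drift absorbs the fluctuation `H` at full weight, while the other half is kept in
proportion to `u`. -/
theorem mul_sub_le_posPart (H c m : ℝ) {u : ℝ} (hu0 : 0 ≤ u) (hu1 : u ≤ 1) :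
    u * (H - c * m) ≤ max (H - c / 2 * m) 0 - u * (c / 2 * m) := by
  have h : u * (H - c / 2 * m) ≤ max (H - c / 2 * m) 0 :=
    (mul_le_mul_of_nonneg_left (le_max_left _ 0) hu0).trans
      (mul_le_of_le_one_left (le_max_right _ _) hu1)
  linarith

/-- A changepoint estimate at fraction `u` of a mixed block misfits about `u m` observations of one
kind and `(1 - u) M` of the other. Because `M` is a fixed proportion of the block, the resulting
drift dominates both `m` and the distance `(1 - u) N` to the end of the block. -/
theorem mixed_drift_le {c τ u m M N : ℝ} (hc : 0 ≤ c) (hτ1 : τ ≤ 1) (hu0 : 0 ≤ u)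
    (hu1 : u ≤ 1) (hm : 0 ≤ m) (hM1 : τ * N ≤ M) (hM2 : τ * m ≤ M) :
    2 * (c * τ / 8) * m + 2 * (c * τ / 8) * ((1 - u) * N) ≤
      u * (c / 2 * m) + (1 - u) * (c / 2 * M) := by
  have w1 : (1 - u) * (τ * N) ≤ (1 - u) * M := mul_le_mul_of_nonneg_left hM1 (by linarith)
  have w2 : (1 - u) * (τ * m) ≤ (1 - u) * M := mul_le_mul_of_nonneg_left hM2 (by linarith)
  have w3 : u * m * τ ≤ u * m * 2 := mul_le_mul_of_nonneg_left (by linarith) (by positivity)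
  have w : τ * m + (1 - u) * (τ * N) ≤ u * m * 2 + 2 * ((1 - u) * M) := by linarith
  have := mul_le_mul_of_nonneg_left w (by positivity : 0 ≤ c / 4)
  linarith

set_option maxHeartbeats 800000 in
/-- Averaged truncated excess of the permuted log-likelihood over the original one, for a stream
cut into a block containing both kinds of observations (`Z₁`, with `m` observations of the wrong
kind and `M` of the right kind) and a pure block (`Z₂`). -/
theorem sum_tpos_excess_le {N₁ N₂ m M : ℕ} {Z₁ Z₂ : γ → ℕ → ι} (h₁ : Exch G N₁ Z₁)
    (h₂ : Exch G N₂ Z₂) (a b d : ι → ℝ) {Ha Hb Hd Qa Qb Qd c τ : ℝ}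
    (hc : 0 < c) (hc1 : c ≤ 1) (hτ : 0 < τ) (hτ1 : τ ≤ 1)
    (hN : N₁ = m + M) (hM : τ * (N₁ + N₂) ≤ M) (hM0 : 0 < M)
    (ha : ∀ g ∈ G, psum (fun i => a (Z₁ g i)) N₁ = Ha - c * m)
    (hb : ∀ g ∈ G, psum (fun i => b (Z₁ g i)) N₁ = Hb - c * M)
    (hd : ∀ g ∈ G, psum (fun i => d (Z₂ g i)) N₂ = Hd - c * N₂)
    (hQa : ∀ g ∈ G, ∑ i ∈ Finset.range N₁, a (Z₁ g i) ^ 2 ≤ Qa)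
    (hQb : ∀ g ∈ G, ∑ i ∈ Finset.range N₁, b (Z₁ g i) ^ 2 ≤ Qb)
    (hQd : ∀ g ∈ G, ∑ i ∈ Finset.range N₂, d (Z₂ g i) ^ 2 ≤ Qd)
    (hQa0 : m = 0 → Qa = 0) (p : ℕ) (F : γ → ℝ)
    (hF : ∀ g ∈ G,
      (∃ s ≤ N₁, F g ≤ psum (fun i => a (Z₁ g i)) s +
        (psum (fun i => b (Z₁ g i)) N₁ - psum (fun i => b (Z₁ g i)) s)) ∨
      (∃ s ≤ N₂, F g ≤ Ha - c * m + psum (fun i => d (Z₂ g i)) s)) :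
    ∑ g ∈ G, tpos (2 ^ p) (F g + c * τ / 8 * m) ≤ G.card *
      (tpos (2 ^ p) (Ha - c / 2 * m) + tpos (2 ^ p) (Hb - c / 2 * M) +
        tpos (2 ^ p) (Hd - c / 2 * N₂) +
        32 * Qa / (c * τ / 8) ^ 2 * (1 / (m : ℝ) * min (1 : ℝ) (2 ^ p / (m : ℝ))) +
        64 * Qb / ((c * τ / 8) ^ 2 * N₁) * (p + 2) +
        64 * Qd / ((c * τ / 8) ^ 2 * (N₂ + m)) * (p + 2)) := by
  rcases G.eq_empty_or_nonempty with rfl | ⟨g₀, hg₀⟩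
  · simp
  have hQb0 : 0 ≤ Qb := (Finset.sum_nonneg fun i _ => sq_nonneg _).trans (hQb g₀ hg₀)
  have hQd0 : 0 ≤ Qd := (Finset.sum_nonneg fun i _ => sq_nonneg _).trans (hQd g₀ hg₀)
  set κ := c * τ / 8 with hκdef
  have hκ : 0 < κ := by positivity
  have hκ1 : κ ≤ 1 := by rw [hκdef]; nlinarith
  set T : ℝ := 2 ^ p with hTdef
  have hT : 0 ≤ T := by positivity
  have hN1 : (0 : ℝ) < N₁ := by exact_mod_cast (by omega : 0 < N₁)
  set zA : γ → ℕ → ℝ := fun g i => a (Z₁ g i) - (Ha - c * m) / N₁ with hzA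
  -- The `b`-sum runs over the end of the block, so it is read backwards, as a walk of length `N₁ -
  -- s` started at the end.
  set zB : γ → ℕ → ℝ := fun g i => b (Z₁ g (reflect N₁ i)) - (Hb - c * M) / N₁ with hzB
  set zD : γ → ℕ → ℝ := fun g i => d (Z₂ g i) - (Hd - c * N₂) / N₂ with hzD
  have eA : Exch G N₁ zA := h₁.comp fun x => a x - (Ha - c * m) / N₁
  have eB : Exch G N₁ zB := (h₁.comp fun x => b x - (Hb - c * M) / N₁).rev
  have eD : Exch G N₂ zD := h₂.comp fun x => d x - (Hd - c * N₂) / N₂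
  have hbr : ∀ g ∈ G, psum (fun i => b (Z₁ g (reflect N₁ i))) N₁ = Hb - c * M := by
    intro g hg
    have := psum_reflect (fun i => b (Z₁ g i)) (Nat.zero_le N₁)
    simpa [hb g hg] using this
  have hQbr : ∀ g ∈ G, ∑ i ∈ Finset.range N₁, b (Z₁ g (reflect N₁ i)) ^ 2 ≤ Qb := by
    intro g hg
    have := psum_reflect (fun i => b (Z₁ g i) ^ 2) (Nat.zero_le N₁)
    simp only [Nat.sub_zero, psum_zero, sub_zero] at this
    rw [psum, psum] at this
    rw [this]
    exact hQb g hg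
  have bA := eA.sum_tpos_runMax_le (fun g hg => psum_sub_mean (ha g hg))
    (fun g hg => sum_sub_mean_sq_le (ha g hg) (hQa g hg)) hT hκ hκ1 hQa0
  have bB := eB.sum_levelSum_le (fun g hg => psum_sub_mean (hbr g hg)) hQb0
    (fun g hg => sum_sub_mean_sq_le (hbr g hg) (hQbr g hg)) p hκ (le_refl (0 : ℝ))
  have bD := eD.sum_levelSum_le (fun g hg => psum_sub_mean (hd g hg)) hQd0
    (fun g hg => sum_sub_mean_sq_le (hd g hg) (hQd g hg)) p hκ (Nat.cast_nonneg m)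
  rw [add_zero] at bB
  set pA := tpos T (Ha - c / 2 * m)
  set pB := tpos T (Hb - c / 2 * M)
  set pD := tpos T (Hd - c / 2 * N₂)
  have hpA : 0 ≤ pA := tpos_nonneg hT _
  have hpB : 0 ≤ pB := tpos_nonneg hT _
  have hpD : 0 ≤ pD := tpos_nonneg hT _
  have key : ∀ g ∈ G, tpos T (F g + κ * m) ≤ (pA + pB + pD) +
      tpos T (runMax (psum (zA g)) N₁ - κ * m) + levelSum p κ 0 N₁ (psum (zB g)) +
      levelSum p κ m N₂ (psum (zD g)) := by
    intro g hg
    have n1 := tpos_nonneg hT (runMax (psum (zA g)) N₁ - κ * m)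
    have n2 := levelSum_nonneg (p := p) (κ := κ) (le_refl (0 : ℝ)) N₁ (psum (zB g))
    have n3 := levelSum_nonneg (p := p) (κ := κ) (Nat.cast_nonneg m) N₂ (psum (zD g))
    have hm0 : (0 : ℝ) ≤ m := Nat.cast_nonneg m
    have hA1 := le_max_left (Ha - c / 2 * m) 0
    have hA2 := le_max_right (Ha - c / 2 * m) 0
    rcases hF g hg with ⟨s, hs, hle⟩ | ⟨s, hs, hle⟩
    · have hB1 := le_max_left (Hb - c / 2 * M) 0
      have hB2 := le_max_right (Hb - c / 2 * M) 0
      set r := N₁ - s with hr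
      have hrs : (r : ℝ) = N₁ - s := by rw [hr, Nat.cast_sub hs]
      set u : ℝ := s / N₁ with hu
      have hu0 : 0 ≤ u := by positivity
      have hu1 : u ≤ 1 := by
        rw [hu, div_le_one hN1]; exact_mod_cast hs
      have eqA : psum (fun i => a (Z₁ g i)) s = psum (zA g) s + u * (Ha - c * m) := by
        rw [hzA, psum_sub_const, hu]; ring
      have eqB : psum (fun i => b (Z₁ g i)) N₁ - psum (fun i => b (Z₁ g i)) s =
          psum (zB g) r + (1 - u) * (Hb - c * M) := by
        rw [hzB, psum_sub_const, psum_reflect (fun i => b (Z₁ g i)) hs, hrs, hu]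
        field_simp
        ring
      have l1 : psum (zA g) s ≤ runMax (psum (zA g)) N₁ := le_runMax _ hs
      have l2 := mul_sub_le_posPart Ha c m hu0 hu1
      have l3 := mul_sub_le_posPart Hb c M (u := 1 - u) (by linarith) (by linarith)
      have hmN : (m : ℝ) ≤ N₁ := by exact_mod_cast (by omega : m ≤ N₁)
      have hM1 : τ * N₁ ≤ M := by
        have : (0 : ℝ) ≤ τ * N₂ := by positivity
        linarith
      have hM2 : τ * m ≤ M := (mul_le_mul_of_nonneg_left hmN hτ.le).trans hM1
      have l4 : 2 * κ * m + 2 * κ * r ≤ u * (c / 2 * m) + (1 - u) * (c / 2 * M) := by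
        have hrN : (r : ℝ) = (1 - u) * N₁ := by rw [hrs, hu]; field_simp
        rw [hrN]
        exact mixed_drift_le hc.le hτ1 hu0 hu1 hm0 hM1 hM2
      -- Of the drift `2κm + 2κr`, one `κm` is the term added to `F g`, the other penalises the
      -- `a`-walk, and `κr` penalises the `b`-walk.
      have tot : F g + κ * m ≤ max (Ha - c / 2 * m) 0 + max (Hb - c / 2 * M) 0 +
          (runMax (psum (zA g)) N₁ - κ * m) + (psum (zB g) r - κ * (r + 0)) := by
        rw [eqA, eqB] at hle
        have : 0 ≤ κ * r := by positivity
        linarith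
      have hlev := tpos_le_levelSum (p := p) hκ hκ1 (le_refl (0 : ℝ)) (psum_zero (zB g))
        (show r ≤ N₁ by omega)
      calc tpos T (F g + κ * m) ≤ _ := tpos_mono tot
        _ ≤ tpos T (max (Ha - c / 2 * m) 0) + tpos T (max (Hb - c / 2 * M) 0) +
            tpos T (runMax (psum (zA g)) N₁ - κ * m) + tpos T (psum (zB g) r - κ * (r + 0)) := by
            refine (tpos_add_le hT _ _).trans (add_le_add_left ?_ _)
            refine (tpos_add_le hT _ _).trans (add_le_add_left ?_ _)
            exact tpos_add_le hT _ _
        _ ≤ _ := by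
            rw [tpos_posPart, tpos_posPart]
            linarith
    · have hD1 := le_max_left (Hd - c / 2 * N₂) 0
      have hD2 := le_max_right (Hd - c / 2 * N₂) 0
      set u : ℝ := s / N₂ with hu
      have hsN : (s : ℝ) ≤ N₂ := by exact_mod_cast hs
      have hu0 : 0 ≤ u := by positivity
      have hu1 : u ≤ 1 := div_le_one_of_le₀ hsN (Nat.cast_nonneg _)
      have huN : u * N₂ = s := by
        rcases Nat.eq_zero_or_pos N₂ with h0 | h0
        · obtain rfl : s = 0 := by omega
          simp [hu]
        · have : (N₂ : ℝ) ≠ 0 := by positivity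
          rw [hu]; field_simp
      have eqD : psum (fun i => d (Z₂ g i)) s = psum (zD g) s + u * (Hd - c * N₂) := by
        rw [hzD, psum_sub_const, hu]; ring
      have l1 : u * (Hd - c * N₂) ≤ max (Hd - c / 2 * N₂) 0 - c / 2 * s := by
        rw [← huN]
        refine (mul_sub_le_posPart Hd c N₂ hu0 hu1).trans (le_of_eq ?_)
        ring
      have l2 : 2 * κ * m ≤ c / 2 * m := by
        refine mul_le_mul_of_nonneg_right ?_ hm0
        rw [hκdef]; nlinarith
      have l3 : κ * s ≤ c / 2 * s := by
        refine mul_le_mul_of_nonneg_right ?_ (Nat.cast_nonneg s)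
        rw [hκdef]; nlinarith
      -- In the pure block the whole mixed block is already misfitted, which leaves a spare `κm` to
      -- serve as the offset of the `d`-walk.
      have tot : F g + κ * m ≤ max (Ha - c / 2 * m) 0 + max (Hd - c / 2 * N₂) 0 +
          (psum (zD g) s - κ * (s + m)) := by
        rw [eqD] at hle
        linarith
      have hlev := tpos_le_levelSum (p := p) hκ hκ1 (Nat.cast_nonneg m) (psum_zero (zD g)) hs
      calc tpos T (F g + κ * m) ≤ _ := tpos_mono tot
        _ ≤ tpos T (max (Ha - c / 2 * m) 0) + tpos T (max (Hd - c / 2 * N₂) 0) +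
            tpos T (psum (zD g) s - κ * (s + m)) := by
            refine (tpos_add_le hT _ _).trans (add_le_add_left ?_ _)
            exact tpos_add_le hT _ _
        _ ≤ _ := by
            rw [tpos_posPart, tpos_posPart]
            linarith
  refine (Finset.sum_le_sum key).trans ?_
  rw [Finset.sum_add_distrib, Finset.sum_add_distrib, Finset.sum_add_distrib, Finset.sum_const,
    nsmul_eq_mul]
  refine (add_le_add (add_le_add (add_le_add le_rfl bA) bB) bD).trans (le_of_eq ?_)
  ring

end Exchangeable

/-! ### Bound for one stream, uniform in the candidate changepoint. -/

section StreamExcess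

/-- Dyadic upper bound for `sup_m (1 / m) min(1, 2 ^ p / m) ∑_{i < m} u_i²`. -/
noncomputable def sqSum (p N : ℕ) (u : ℕ → ℝ) : ℝ :=
  ∑ j ∈ Finset.range N, lvl p j / 2 ^ j * ∑ i ∈ Finset.range (min (2 ^ (j + 1)) N), u i ^ 2

theorem sqSum_nonneg (p N : ℕ) (u : ℕ → ℝ) : 0 ≤ sqSum p N u :=
  Finset.sum_nonneg fun j _ => mul_nonneg (div_nonneg (lvl_nonneg p j) (by positivity))
    (Finset.sum_nonneg fun i _ => sq_nonneg _)

/-- The squares of the `m` misplaced observations average to a constant only for each fixed `m`.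
Passing to the dyadic block of `m` gives one random variable valid for all `m`, hence for all
candidates `t`. -/
theorem mul_sum_sq_le_sqSum (p : ℕ) {N m : ℕ} (hm : m ≤ N) (u : ℕ → ℝ) :
    1 / (m : ℝ) * min (1 : ℝ) (2 ^ p / (m : ℝ)) * ∑ i ∈ Finset.range m, u i ^ 2 ≤ sqSum p N u := by
  rcases Nat.eq_zero_or_pos m with rfl | hm0
  · simpa using sqSum_nonneg p N u
  set j := Nat.log 2 m with hj
  have h1 : 2 ^ j ≤ m := Nat.pow_log_le_self 2 hm0.ne'
  have h2 : m < 2 ^ (j + 1) := Nat.lt_pow_succ_log_self (by norm_num) m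
  have hjN : j ∈ Finset.range N :=
    Finset.mem_range.2 (Nat.lt_two_pow_self.trans_le (h1.trans hm))
  have h1' : (2 : ℝ) ^ j ≤ m := by exact_mod_cast h1
  have hs : ∑ i ∈ Finset.range m, u i ^ 2 ≤
      ∑ i ∈ Finset.range (min (2 ^ (j + 1)) N), u i ^ 2 :=
    Finset.sum_le_sum_of_subset_of_nonneg (Finset.range_mono (le_min h2.le hm))
      fun _ _ _ => sq_nonneg _
  have hw : 1 / (m : ℝ) * min (1 : ℝ) (2 ^ p / (m : ℝ)) ≤ lvl p j / 2 ^ j := by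
    rw [div_eq_inv_mul (lvl p j), one_div]
    refine mul_le_mul (inv_anti₀ (by positivity) h1') ?_ (by positivity) (by positivity)
    exact min_le_min le_rfl (div_le_div_of_nonneg_left (by positivity) (by positivity) h1')
  refine le_trans ?_ (Finset.single_le_sum (f := fun j => lvl p j / 2 ^ j *
    ∑ i ∈ Finset.range (min (2 ^ (j + 1)) N), u i ^ 2) (fun j _ => ?_) hjN)
  · exact mul_le_mul hw hs (Finset.sum_nonneg fun _ _ => sq_nonneg _)
      (div_nonneg (lvl_nonneg p j) (by positivity))
  · exact mul_nonneg (div_nonneg (lvl_nonneg p j) (by positivity))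
      (Finset.sum_nonneg fun i _ => sq_nonneg _)

/-- The bound for the truncated excess of one stream, in terms of its centred and
sign-corrected log-likelihood ratios `y`. -/
noncomputable def streamBound (c τ : ℝ) (n ξ p : ℕ) (y : ℕ → ℝ) : ℝ :=
  levelSum p (c / 2) 0 (n - ξ) (psum fun i => y (ξ + i)) +
  levelSum p (c / 2) 0 ξ (psum fun i => y (ξ - 1 - i)) +
  levelSum p (c / 2) 0 ξ (psum fun i => y i) +
  levelSum p (c / 2) 0 (n - ξ) (psum fun i => y (n - 1 - i)) +
  64 / (c * τ / 8) ^ 2 *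
    (sqSum p (n - ξ) (fun i => y (ξ + i)) + sqSum p ξ (fun i => y (ξ - 1 - i)) + 1) +
  256 / ((c * τ / 8) ^ 2 * τ) * ((∑ i ∈ Finset.range n, y i ^ 2) / n + 1) * (p + 2)

theorem streamBound_nonneg {c τ : ℝ} (hc : 0 < c) (hτ : 0 < τ) (n ξ p : ℕ) (y : ℕ → ℝ) :
    0 ≤ streamBound c τ n ξ p y := by
  have h1 := levelSum_nonneg (p := p) (κ := c / 2) (le_refl (0 : ℝ)) (n - ξ)
    (psum fun i => y (ξ + i))
  have h2 := levelSum_nonneg (p := p) (κ := c / 2) (le_refl (0 : ℝ)) ξ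
    (psum fun i => y (ξ - 1 - i))
  have h3 := levelSum_nonneg (p := p) (κ := c / 2) (le_refl (0 : ℝ)) ξ (psum fun i => y i)
  have h4 := levelSum_nonneg (p := p) (κ := c / 2) (le_refl (0 : ℝ)) (n - ξ)
    (psum fun i => y (n - 1 - i))
  have h5 := sqSum_nonneg p (n - ξ) (fun i => y (ξ + i))
  have h6 := sqSum_nonneg p ξ (fun i => y (ξ - 1 - i))
  have h7 : 0 ≤ ∑ i ∈ Finset.range n, y i ^ 2 := Finset.sum_nonneg fun _ _ => sq_nonneg _
  unfold streamBound
  positivity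

theorem sum_comp_of_mapsTo {S : Finset ℕ} {ρ : ℕ → ℕ} (hρ : Function.Injective ρ)
    (hS : ∀ i ∈ S, ρ i ∈ S) (φ : ℕ → ℝ) : ∑ i ∈ S, φ (ρ i) = ∑ i ∈ S, φ i := by
  have : S.image ρ = S := Finset.eq_of_subset_of_card_le
    (Finset.image_subset_iff.2 hS) (by rw [Finset.card_image_of_injective S hρ])
  conv_rhs => rw [← this, Finset.sum_image hρ.injOn]

theorem sum_Ico_eq_psum (φ : ℕ → ℝ) {a b : ℕ} :
    ∑ i ∈ Finset.Ico a b, φ i = psum (fun i => φ (a + i)) (b - a) := by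
  rw [Finset.sum_Ico_eq_sum_range, psum]

theorem psum_reverse (y : ℕ → ℝ) {a b : ℕ} (hab : a ≤ b) :
    psum (fun i => y (b - 1 - i)) (b - a) = ∑ i ∈ Finset.Ico a b, y i := by
  rw [psum, Finset.range_eq_Ico]
  refine Finset.sum_nbij' (fun i => b - 1 - i) (fun i => b - 1 - i) ?_ ?_ ?_ ?_ ?_ <;>
    intro i hi <;> simp only [Finset.mem_Ico] at * <;> omega

theorem tpos_walk_le {c : ℝ} (hc : 0 < c) (hc1 : c ≤ 1) (p : ℕ) (u : ℕ → ℝ) {m N : ℕ}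
    (hm : m ≤ N) : tpos (2 ^ p) (psum u m - c / 2 * m) ≤ levelSum p (c / 2) 0 N (psum u) := by
  have := tpos_le_levelSum (p := p) (κ := c / 2) (by positivity) (by linarith) (le_refl (0 : ℝ))
    (psum_zero u) hm
  rwa [add_zero] at this

theorem sub_sq_le_of_le_one {c : ℝ} (hc : 0 < c) (hc1 : c ≤ 1) (x : ℝ) :
    (x - c) ^ 2 ≤ 2 * x ^ 2 + 2 := by nlinarith [sq_nonneg (x + c)]

theorem partial_sq_term_le {κ : ℝ} (hκ : 0 < κ) (p : ℕ) {m N : ℕ} (hm : m ≤ N) (u : ℕ → ℝ) :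
    32 * (2 * ∑ i ∈ Finset.range m, u i ^ 2 + 2 * m) / κ ^ 2 *
      (1 / (m : ℝ) * min (1 : ℝ) (2 ^ p / (m : ℝ))) ≤ 64 / κ ^ 2 * (sqSum p N u + 1) := by
  have h := mul_sum_sq_le_sqSum p hm u
  set q := 1 / (m : ℝ) * min (1 : ℝ) (2 ^ p / (m : ℝ)) with hq
  have hmq : (m : ℝ) * q ≤ 1 := by
    rcases Nat.eq_zero_or_pos m with rfl | hm0
    · simp
    · have : (m : ℝ) ≠ 0 := by positivity
      rw [hq, ← mul_assoc, mul_one_div_cancel this, one_mul]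
      exact min_le_left _ _
  have e : 32 * (2 * ∑ i ∈ Finset.range m, u i ^ 2 + 2 * m) / κ ^ 2 * q =
      64 / κ ^ 2 * (q * ∑ i ∈ Finset.range m, u i ^ 2 + m * q) := by ring
  rw [e]
  gcongr

theorem full_sq_term_le {κ τ V : ℝ} (hκ : 0 < κ) (hτ : 0 < τ) (hV : 0 ≤ V) {n : ℕ} (hn : 0 < n)
    (p : ℕ) {N : ℝ} (hN : τ * n ≤ N) :
    64 * (2 * V + 2 * n) / (κ ^ 2 * N) * (p + 2) ≤
      128 / (κ ^ 2 * τ) * (V / n + 1) * (p + 2) := by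
  have hn' : (0 : ℝ) < n := by exact_mod_cast hn
  gcongr
  calc 64 * (2 * V + 2 * n) / (κ ^ 2 * N) ≤ 64 * (2 * V + 2 * n) / (κ ^ 2 * (τ * n)) := by
        gcongr
    _ = 128 / (κ ^ 2 * τ) * (V / n + 1) := by field_simp; ring

variable {γ : Type*} {G : Finset γ}

set_option maxHeartbeats 1000000 in
/-- Averaged truncated excess of the permuted log-likelihood of one stream, when the permutations
preserve the blocks before and after `t`. -/
theorem sum_tpos_stream_le {n t ξ : ℕ} (hn : 0 < n) (ht : t ≤ n) {c τ : ℝ}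
    (hc : 0 < c) (hc1 : c ≤ 1) (hτ : 0 < τ) (hτ1 : τ ≤ 1) (hξ : τ * n ≤ ξ)
    (hξn : ξ ≤ n) (hξ' : τ * n ≤ (n : ℝ) - ξ) (ρ : γ → ℕ → ℕ)
    (hinj : ∀ g ∈ G, Function.Injective (ρ g))
    (hlow : ∀ g ∈ G, ∀ i, i < t → ρ g i < t)
    (hhigh : ∀ g ∈ G, ∀ i, t ≤ i → i < n → t ≤ ρ g i ∧ ρ g i < n)
    (hex₁ : Exch G t ρ) (hex₂ : Exch G (n - t) (fun g i => ρ g (t + i)))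
    (p : ℕ) (y : ℕ → ℝ) (F : γ → ℝ)
    (hF : ∀ g ∈ G, ∃ s ≤ n,
      F g ≤ ∑ i ∈ Finset.range s, (if ξ ≤ ρ g i then y (ρ g i) - c else 0) +
        ∑ i ∈ Finset.Ico s n, (if ρ g i < ξ then y (ρ g i) - c else 0)) :
    ∑ g ∈ G, tpos (2 ^ p) (F g + c * τ / 8 * |(t : ℝ) - ξ|) ≤
      G.card * streamBound c τ n ξ p y := by
  have hn' : (0 : ℝ) < n := by exact_mod_cast hn
  have hκ : 0 < c * τ / 8 := by positivity
  set a : ℕ → ℝ := fun j => if ξ ≤ j then y j - c else 0 with ha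
  set b : ℕ → ℝ := fun j => if j < ξ then y j - c else 0 with hb
  set d : ℕ → ℝ := fun j => y j - c with hd
  set V := ∑ i ∈ Finset.range n, y i ^ 2 with hV
  have hV0 : 0 ≤ V := Finset.sum_nonneg fun _ _ => sq_nonneg _
  have hsum₁ : ∀ g ∈ G, ∀ φ : ℕ → ℝ, psum (fun i => φ (ρ g i)) t = ∑ i ∈ Finset.range t, φ i :=
    fun g hg φ => sum_comp_of_mapsTo (hinj g hg)
      (fun i hi => Finset.mem_range.2 (hlow g hg i (Finset.mem_range.1 hi))) φ
  have hsum₂ : ∀ g ∈ G, ∀ φ : ℕ → ℝ,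
      psum (fun i => φ (ρ g (t + i))) (n - t) = ∑ i ∈ Finset.Ico t n, φ i := by
    intro g hg φ
    rw [← sum_Ico_eq_psum fun i => φ (ρ g i)]
    refine sum_comp_of_mapsTo (hinj g hg) (fun i hi => ?_) φ
    rw [Finset.mem_Ico] at hi ⊢
    exact hhigh g hg i hi.1 hi.2
  have hsqall : ∀ S : Finset ℕ, S ⊆ Finset.range n → ∀ φ : ℕ → ℝ,
      (∀ j, φ j ^ 2 ≤ (y j - c) ^ 2) → ∑ j ∈ S, φ j ^ 2 ≤ 2 * V + 2 * n := by
    intro S hS φ hφ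
    calc ∑ j ∈ S, φ j ^ 2 ≤ ∑ j ∈ S, (2 * y j ^ 2 + 2) :=
          Finset.sum_le_sum fun j _ => (hφ j).trans (sub_sq_le_of_le_one hc hc1 _)
      _ ≤ ∑ j ∈ Finset.range n, (2 * y j ^ 2 + 2) :=
          Finset.sum_le_sum_of_subset_of_nonneg hS fun j _ _ => by positivity
      _ = 2 * V + 2 * n := by
          rw [Finset.sum_add_distrib, ← Finset.mul_sum]; simp [hV, mul_comm]
  have ha2 : ∀ j, a j ^ 2 ≤ (y j - c) ^ 2 := by
    intro j; simp only [ha]; split_ifs <;> [exact le_rfl; simpa using sq_nonneg _]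
  have hb2 : ∀ j, b j ^ 2 ≤ (y j - c) ^ 2 := by
    intro j; simp only [hb]; split_ifs <;> [exact le_rfl; simpa using sq_nonneg _]
  have hrt : Finset.range t ⊆ Finset.range n := Finset.range_mono ht
  have hIt : Finset.Ico t n ⊆ Finset.range n := fun i hi =>
    Finset.mem_range.2 (Finset.mem_Ico.1 hi).2
  have hdsub : ∀ S : Finset ℕ, ∑ j ∈ S, (y j - c) = ∑ j ∈ S, y j - c * S.card := by
    intro S; rw [Finset.sum_sub_distrib]; simp [mul_comm]
  have hsqpart : ∀ S : Finset ℕ, ∑ j ∈ S, (y j - c) ^ 2 ≤ 2 * ∑ j ∈ S, y j ^ 2 + 2 * S.card := by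
    intro S
    calc ∑ j ∈ S, (y j - c) ^ 2 ≤ ∑ j ∈ S, (2 * y j ^ 2 + 2) :=
          Finset.sum_le_sum fun j _ => sub_sq_le_of_le_one hc hc1 _
      _ = _ := by rw [Finset.sum_add_distrib, ← Finset.mul_sum]; simp [mul_comm]
  have w1 := levelSum_nonneg (p := p) (κ := c / 2) (le_refl (0 : ℝ)) (n - ξ)
    (psum fun i => y (ξ + i))
  have w2 := levelSum_nonneg (p := p) (κ := c / 2) (le_refl (0 : ℝ)) ξ
    (psum fun i => y (ξ - 1 - i))
  have w3 := levelSum_nonneg (p := p) (κ := c / 2) (le_refl (0 : ℝ)) ξ (psum fun i => y i)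
  have w4 := levelSum_nonneg (p := p) (κ := c / 2) (le_refl (0 : ℝ)) (n - ξ)
    (psum fun i => y (n - 1 - i))
  have w5 := sqSum_nonneg p (n - ξ) (fun i => y (ξ + i))
  have w6 := sqSum_nonneg p ξ (fun i => y (ξ - 1 - i))
  have hξ0 : (0 : ℝ) < ξ := lt_of_lt_of_le (by positivity) hξ
  have hξpos : 0 < ξ := by exact_mod_cast hξ0
  have hnξ0 : (0 : ℝ) < (n : ℝ) - ξ := lt_of_lt_of_le (by positivity) hξ'
  have hξlt : ξ < n := by
    have : (ξ : ℝ) < n := by linarith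
    exact_mod_cast this
  rcases le_or_gt ξ t with htξ | htξ
  · have eabs : |(t : ℝ) - ξ| = ((t - ξ : ℕ) : ℝ) := by
      rw [Nat.cast_sub htξ, abs_of_nonneg]
      have : (ξ : ℝ) ≤ t := by exact_mod_cast htξ
      linarith
    have sa : ∀ ψ : ℕ → ℝ, ∑ i ∈ Finset.range t, (if ξ ≤ i then ψ i else 0) =
        ∑ i ∈ Finset.Ico ξ t, ψ i := by
      intro ψ
      rw [← Finset.sum_filter]
      congr 1; ext i; simp; omega
    have sb : ∀ ψ : ℕ → ℝ, ∑ i ∈ Finset.range t, (if i < ξ then ψ i else 0) =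
        ∑ i ∈ Finset.range ξ, ψ i := by
      intro ψ
      rw [← Finset.sum_filter]
      congr 1; ext i; simp; omega
    -- For `ξ ≤ t` the first `t` times form the mixed block, with `t - ξ` post-change observations,
    -- and the times after `t` are purely post-change. Here `a` and `b` are the costs of placing an
    -- observation before and after the estimated change, zero when the placement is right.
    have main := sum_tpos_excess_le (N₁ := t) (N₂ := n - t) (m := t - ξ) (M := ξ) hex₁ hex₂ a b d
      (Ha := psum (fun i => y (ξ + i)) (t - ξ)) (Hb := psum (fun i => y (ξ - 1 - i)) ξ)
      (Hd := psum (fun i => y (n - 1 - i)) (n - t))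
      (Qa := 2 * ∑ i ∈ Finset.range (t - ξ), y (ξ + i) ^ 2 + 2 * ((t - ξ : ℕ) : ℝ))
      (Qb := 2 * V + 2 * n) (Qd := 2 * V + 2 * n) hc hc1 hτ hτ1 (by omega)
      (by rw [Nat.cast_sub ht]; simpa using hξ) hξpos
      (by
        intro g hg
        rw [hsum₁ g hg a, sa, hdsub, sum_Ico_eq_psum, Nat.card_Ico])
      (by
        intro g hg
        rw [hsum₁ g hg b, sb, hdsub, Finset.card_range, ← Nat.Ico_zero_eq_range,
          ← psum_reverse y (Nat.zero_le ξ)]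
        rfl)
      (by
        intro g hg
        rw [hsum₂ g hg d, hdsub, psum_reverse y ht, Nat.card_Ico])
      (by
        intro g hg
        have e := hsum₁ g hg fun j => a j ^ 2
        rw [psum] at e
        rw [e]
        have e2 := sa fun j => (y j - c) ^ 2
        have e3 : ∑ i ∈ Finset.range t, a i ^ 2 =
            ∑ i ∈ Finset.range t, (if ξ ≤ i then (y i - c) ^ 2 else 0) := by
          refine Finset.sum_congr rfl fun i _ => ?_
          simp only [ha]; split_ifs <;> simp
        rw [e3, e2]
        refine (hsqpart _).trans (le_of_eq ?_)
        rw [sum_Ico_eq_psum (fun j => y j ^ 2), Nat.card_Ico, psum])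
      (by
        intro g hg
        have e := hsum₁ g hg fun j => b j ^ 2
        rw [psum] at e
        rw [e]
        exact hsqall _ hrt b hb2)
      (by
        intro g hg
        have e := hsum₂ g hg fun j => d j ^ 2
        rw [psum] at e
        rw [e]
        exact hsqall _ hIt d fun j => le_rfl)
      (by intro h; simp [h]) p F
      (by
        intro g hg
        obtain ⟨s, hs, hle⟩ := hF g hg
        -- The two alternatives correspond to an estimate `s` in the mixed block or in the pure
        -- block.
        rcases le_or_gt s t with hst | hst
        · refine Or.inl ⟨s, hst, hle.trans (le_of_eq ?_)⟩
          have e0 : ∑ i ∈ Finset.Ico t n, b (ρ g i) = 0 := by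
            refine Finset.sum_eq_zero fun i hi => ?_
            rw [Finset.mem_Ico] at hi
            have := hhigh g hg i hi.1 hi.2
            simp only [hb]
            rw [if_neg (by omega)]
          have e1 := Finset.sum_Ico_consecutive (fun i => b (ρ g i)) hst ht
          have e2 := Finset.sum_range_add_sum_Ico (fun i => b (ρ g i)) hst
          simp only [psum]
          change ∑ i ∈ Finset.range s, a (ρ g i) + ∑ i ∈ Finset.Ico s n, b (ρ g i) = _
          linarith
        · refine Or.inr ⟨s - t, by omega, hle.trans (le_of_eq ?_)⟩
          have e0 : ∑ i ∈ Finset.Ico s n, b (ρ g i) = 0 := by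
            refine Finset.sum_eq_zero fun i hi => ?_
            rw [Finset.mem_Ico] at hi
            have := hhigh g hg i (by omega) hi.2
            simp only [hb]
            rw [if_neg (by omega)]
          have e1 := Finset.sum_range_add_sum_Ico (fun i => a (ρ g i)) hst.le
          have e2 : ∑ i ∈ Finset.Ico t s, a (ρ g i) = ∑ i ∈ Finset.Ico t s, d (ρ g i) := by
            refine Finset.sum_congr rfl fun i hi => ?_
            rw [Finset.mem_Ico] at hi
            have := hhigh g hg i hi.1 (by omega)
            simp only [ha, hd]
            rw [if_pos (by omega)]
          have e3 := hsum₁ g hg a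
          rw [sa, hdsub, sum_Ico_eq_psum y, Nat.card_Ico] at e3
          rw [psum] at e3
          rw [← sum_Ico_eq_psum fun i => d (ρ g i)]
          change ∑ i ∈ Finset.range s, a (ρ g i) + ∑ i ∈ Finset.Ico s n, b (ρ g i) = _
          linarith)
    rw [eabs]
    refine main.trans (mul_le_mul_of_nonneg_left ?_ (Nat.cast_nonneg _))
    -- The totals of the original data over the blocks are values at particular times of walks
    -- starting at `ξ` or at an end of the stream. The level sums bound these walks at all times,
    -- which removes the dependence on `t`.
    have q1 := tpos_walk_le hc hc1 p (fun i => y (ξ + i)) (show t - ξ ≤ n - ξ by omega)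
    have q2 := tpos_walk_le hc hc1 p (fun i => y (ξ - 1 - i)) (le_refl ξ)
    have q3 := tpos_walk_le hc hc1 p (fun i => y (n - 1 - i)) (show n - t ≤ n - ξ by omega)
    have q4 := partial_sq_term_le hκ p (show t - ξ ≤ n - ξ by omega) (fun i => y (ξ + i))
    have q5 := full_sq_term_le hκ hτ hV0 hn p (N := (t : ℝ))
      (hξ.trans (by exact_mod_cast htξ))
    -- The pure block may be short or empty, but its length plus the offset is `n - ξ ≥ τ n`.
    have q6 := full_sq_term_le hκ hτ hV0 hn p (N := ((n - t : ℕ) : ℝ) + ((t - ξ : ℕ) : ℝ))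
      (by rw [Nat.cast_sub ht, Nat.cast_sub htξ]; linarith)
    have q7 : 64 / (c * τ / 8) ^ 2 * (sqSum p (n - ξ) (fun i => y (ξ + i)) + 1) ≤
        64 / (c * τ / 8) ^ 2 * (sqSum p (n - ξ) (fun i => y (ξ + i)) +
          sqSum p ξ (fun i => y (ξ - 1 - i)) + 1) := by
      gcongr; linarith
    have q8 : 256 / ((c * τ / 8) ^ 2 * τ) * (V / n + 1) * (p + 2) =
        128 / ((c * τ / 8) ^ 2 * τ) * (V / n + 1) * (p + 2) +
        128 / ((c * τ / 8) ^ 2 * τ) * (V / n + 1) * (p + 2) := by ring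
    unfold streamBound
    rw [q8]
    linarith
  · have eabs : |(t : ℝ) - ξ| = ((ξ - t : ℕ) : ℝ) := by
      rw [Nat.cast_sub htξ.le, abs_of_nonpos]
      · ring
      · have : (t : ℝ) ≤ ξ := by exact_mod_cast htξ.le
        linarith
    have sa : ∀ ψ : ℕ → ℝ, ∑ i ∈ Finset.Ico t n, (if ξ ≤ i then ψ i else 0) =
        ∑ i ∈ Finset.Ico ξ n, ψ i := by
      intro ψ
      rw [← Finset.sum_filter]
      congr 1; ext i; simp; omega
    have sb : ∀ ψ : ℕ → ℝ, ∑ i ∈ Finset.Ico t n, (if i < ξ then ψ i else 0) =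
        ∑ i ∈ Finset.Ico t ξ, ψ i := by
      intro ψ
      rw [← Finset.sum_filter]
      congr 1; ext i; simp; omega
    have hrev₁ : ∀ g, ∀ φ : ℕ → ℝ, ∀ r ≤ n - t,
        psum (fun i => φ (ρ g (t + reflect (n - t) i))) (n - t - r) =
          psum (fun i => φ (ρ g (t + i))) (n - t) - psum (fun i => φ (ρ g (t + i))) r :=
      fun g φ r hr => psum_reflect (fun i => φ (ρ g (t + i))) hr
    have hrev₂ : ∀ g, ∀ φ : ℕ → ℝ, ∀ r ≤ t,
        psum (fun i => φ (ρ g (reflect t i))) (t - r) =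
          psum (fun i => φ (ρ g i)) t - psum (fun i => φ (ρ g i)) r :=
      fun g φ r hr => psum_reflect (fun i => φ (ρ g i)) hr
    have hrev₁' : ∀ g ∈ G, ∀ φ : ℕ → ℝ,
        psum (fun i => φ (ρ g (t + reflect (n - t) i))) (n - t) = ∑ i ∈ Finset.Ico t n, φ i := by
      intro g hg φ
      have := hrev₁ g φ 0 (Nat.zero_le _)
      rw [Nat.sub_zero, psum_zero, sub_zero, hsum₂ g hg φ] at this
      exact this
    have hrev₂' : ∀ g ∈ G, ∀ φ : ℕ → ℝ,
        psum (fun i => φ (ρ g (reflect t i))) t = ∑ i ∈ Finset.range t, φ i := by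
      intro g hg φ
      have := hrev₂ g φ 0 (Nat.zero_le _)
      rw [Nat.sub_zero, psum_zero, sub_zero, hsum₁ g hg φ] at this
      exact this
    -- For `t < ξ` time is reversed: the last `n - t` times form the mixed block, and `a` and `b`
    -- exchange roles.
    have main := sum_tpos_excess_le (N₁ := n - t) (N₂ := t) (m := ξ - t) (M := n - ξ) hex₂.rev
      hex₁.rev b a d
      (Ha := psum (fun i => y (ξ - 1 - i)) (ξ - t)) (Hb := psum (fun i => y (ξ + i)) (n - ξ))
      (Hd := psum (fun i => y i) t)
      (Qa := 2 * ∑ i ∈ Finset.range (ξ - t), y (ξ - 1 - i) ^ 2 + 2 * ((ξ - t : ℕ) : ℝ))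
      (Qb := 2 * V + 2 * n) (Qd := 2 * V + 2 * n) hc hc1 hτ hτ1 (by omega)
      (by rw [Nat.cast_sub ht, Nat.cast_sub hξn]; simpa using hξ') (by omega)
      (by
        intro g hg
        rw [hrev₁' g hg b, sb, hdsub, psum_reverse y htξ.le, Nat.card_Ico])
      (by
        intro g hg
        rw [hrev₁' g hg a, sa, hdsub, sum_Ico_eq_psum, Nat.card_Ico])
      (by
        intro g hg
        rw [hrev₂' g hg d, hdsub, Finset.card_range, psum])
      (by
        intro g hg
        have e := hrev₁' g hg fun j => b j ^ 2
        rw [psum] at e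
        rw [e]
        have e2 := sb fun j => (y j - c) ^ 2
        have e3 : ∑ i ∈ Finset.Ico t n, b i ^ 2 =
            ∑ i ∈ Finset.Ico t n, (if i < ξ then (y i - c) ^ 2 else 0) := by
          refine Finset.sum_congr rfl fun i _ => ?_
          simp only [hb]; split_ifs <;> simp
        rw [e3, e2]
        refine (hsqpart _).trans (le_of_eq ?_)
        rw [← psum_reverse (fun j => y j ^ 2) htξ.le, Nat.card_Ico, psum])
      (by
        intro g hg
        have e := hrev₁' g hg fun j => a j ^ 2
        rw [psum] at e
        rw [e]
        exact hsqall _ hIt a ha2)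
      (by
        intro g hg
        have e := hrev₂' g hg fun j => d j ^ 2
        rw [psum] at e
        rw [e]
        exact hsqall _ hrt d fun j => le_rfl)
      (by intro h; simp [h]) p F
      (by
        intro g hg
        obtain ⟨s, hs, hle⟩ := hF g hg
        have hle' : F g ≤ ∑ i ∈ Finset.range s, a (ρ g i) + ∑ i ∈ Finset.Ico s n, b (ρ g i) := hle
        rcases le_or_gt t s with hst | hst
        · refine Or.inl ⟨n - s, by omega, hle'.trans (le_of_eq ?_)⟩
          have e0 : ∑ i ∈ Finset.range t, a (ρ g i) = 0 := by
            refine Finset.sum_eq_zero fun i hi => ?_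
            have := hlow g hg i (Finset.mem_range.1 hi)
            simp only [ha]
            rw [if_neg (by omega)]
          have e1 := Finset.sum_range_add_sum_Ico (fun i => a (ρ g i)) hst
          have e2 := Finset.sum_Ico_consecutive (fun i => b (ρ g i)) hst hs
          have r1 := hrev₁ g a (s - t) (by omega)
          have r2 := hrev₁ g b (s - t) (by omega)
          have r3 := hrev₁ g a 0 (by omega)
          rw [show n - t - (s - t) = n - s by omega,
            ← sum_Ico_eq_psum (fun i => a (ρ g i)), ← sum_Ico_eq_psum (fun i => a (ρ g i))] at r1
          rw [show n - t - (s - t) = n - s by omega,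
            ← sum_Ico_eq_psum (fun i => b (ρ g i)), ← sum_Ico_eq_psum (fun i => b (ρ g i))] at r2
          rw [Nat.sub_zero, psum_zero, ← sum_Ico_eq_psum (fun i => a (ρ g i))] at r3
          linarith
        · refine Or.inr ⟨t - s, by omega, hle'.trans (le_of_eq ?_)⟩
          have e0 : ∑ i ∈ Finset.range s, a (ρ g i) = 0 := by
            refine Finset.sum_eq_zero fun i hi => ?_
            have := hlow g hg i ((Finset.mem_range.1 hi).trans hst)
            simp only [ha]
            rw [if_neg (by omega)]
          have e1 := Finset.sum_Ico_consecutive (fun i => b (ρ g i)) hst.le ht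
          have e2 : ∑ i ∈ Finset.Ico s t, b (ρ g i) = ∑ i ∈ Finset.Ico s t, d (ρ g i) := by
            refine Finset.sum_congr rfl fun i hi => ?_
            have := hlow g hg i (Finset.mem_Ico.1 hi).2
            simp only [hb, hd]
            rw [if_pos (by omega)]
          have e3 := hsum₂ g hg b
          rw [sb, hdsub, ← psum_reverse y htξ.le, Nat.card_Ico,
            ← sum_Ico_eq_psum fun i => b (ρ g i)] at e3
          have r := hrev₂ g d s hst.le
          have e4 := Finset.sum_range_add_sum_Ico (fun i => d (ρ g i)) hst.le
          rw [r]
          simp only [psum] at e3 ⊢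
          linarith)
    rw [eabs]
    refine main.trans (mul_le_mul_of_nonneg_left ?_ (Nat.cast_nonneg _))
    have q1 := tpos_walk_le hc hc1 p (fun i => y (ξ - 1 - i)) (show ξ - t ≤ ξ by omega)
    have q2 := tpos_walk_le hc hc1 p (fun i => y (ξ + i)) (le_refl (n - ξ))
    have q3 := tpos_walk_le hc hc1 p (fun i => y i) htξ.le
    have q4 := partial_sq_term_le hκ p (show ξ - t ≤ ξ by omega) (fun i => y (ξ - 1 - i))
    have q5 := full_sq_term_le hκ hτ hV0 hn p (N := ((n - t : ℕ) : ℝ))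
      (hξ'.trans (by
        rw [Nat.cast_sub ht]
        have : (t : ℝ) ≤ ξ := by exact_mod_cast htξ.le
        linarith))
    have q6 := full_sq_term_le hκ hτ hV0 hn p (N := (t : ℝ) + ((ξ - t : ℕ) : ℝ))
      (by rw [Nat.cast_sub htξ.le]; linarith)
    have q7 : 64 / (c * τ / 8) ^ 2 * (sqSum p ξ (fun i => y (ξ - 1 - i)) + 1) ≤
        64 / (c * τ / 8) ^ 2 * (sqSum p (n - ξ) (fun i => y (ξ + i)) +
          sqSum p ξ (fun i => y (ξ - 1 - i)) + 1) := by
      gcongr; linarith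
    have q8 : 256 / ((c * τ / 8) ^ 2 * τ) * (V / n + 1) * (p + 2) =
        128 / ((c * τ / 8) ^ 2 * τ) * (V / n + 1) * (p + 2) +
        128 / ((c * τ / 8) ^ 2 * τ) * (V / n + 1) * (p + 2) := by ring
    unfold streamBound
    rw [q8]
    linarith

end StreamExcess

/-! ### Expectations of the bounds for independent noise. -/

section RandomWalk

theorem measurable_psum (r : ℕ) : Measurable fun u : ℕ → ℝ => psum u r := by
  unfold psum
  exact Finset.measurable_sum _ fun i _ => measurable_pi_apply i

theorem measurable_runMax_psum (r : ℕ) : Measurable fun u : ℕ → ℝ => runMax (psum u) r := by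
  induction r with
  | zero => simp [runMax]
  | succ r ih => exact ih.max (measurable_psum (r + 1))

/-- A sequence indexed by `Fin n`, extended by `0`. -/
def zeroExt {n : ℕ} (x : Fin n → ℝ) (j : ℕ) : ℝ := if h : j < n then x ⟨j, h⟩ else 0

theorem zeroExt_of_lt {n : ℕ} (x : Fin n → ℝ) {j : ℕ} (h : j < n) : zeroExt x j = x ⟨j, h⟩ :=
  dif_pos h

variable {Ω : Type*} [MeasurableSpace Ω] {P : Measure Ω} {n : ℕ}
  {Y : Fin n → Ω → ℝ} {v : ℝ}

/-- Independent, centred random variables with second moments at most `v`. -/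
structure IsNoise (P : Measure Ω) (Y : Fin n → Ω → ℝ) (v : ℝ) : Prop where
  measurable : ∀ i, Measurable (Y i)
  indep : iIndepFun Y P
  memLp : ∀ i, MemLp (Y i) 2 P
  mean : ∀ i, ∫ ω, Y i ω ∂P = 0
  sq_le : ∀ i, ∫ ω, Y i ω ^ 2 ∂P ≤ v

theorem IsNoise.memLp_zeroExt (h : IsNoise P Y v) (j : ℕ) :
    MemLp (fun ω => zeroExt (fun i => Y i ω) j) 2 P := by
  by_cases hj : j < n
  · simp only [zeroExt_of_lt _ hj]; exact h.memLp _
  · simp only [zeroExt, dif_neg hj]; exact MemLp.zero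

theorem IsNoise.sq_zeroExt_le (h : IsNoise P Y v) (hv : 0 ≤ v) (j : ℕ) :
    ∫ ω, zeroExt (fun i => Y i ω) j ^ 2 ∂P ≤ v := by
  by_cases hj : j < n
  · simp only [zeroExt_of_lt _ hj]; exact h.sq_le _
  · simpa only [zeroExt, dif_neg hj, ne_eq, OfNat.ofNat_ne_zero, not_false_eq_true, zero_pow,
      integral_zero] using hv

/-- A functional of the first `r` terms of a rearrangement of the noise is orthogonal to the next
term. -/
theorem IsNoise.integral_mul_next (h : IsNoise P Y v) {L : ℕ} {e : ℕ → ℕ}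
    (he : ∀ i < L, e i < n) (hinj : ∀ i < L, ∀ j < L, e i = e j → i = j) {r : ℕ} (hr : r < L)
    {Φ : (ℕ → ℝ) → ℝ} (hΦ : Measurable Φ)
    (hdep : ∀ u u' : ℕ → ℝ, (∀ i < r, u i = u' i) → Φ u = Φ u') :
    ∫ ω, Φ (fun i => zeroExt (fun k => Y k ω) (e i)) * zeroExt (fun k => Y k ω) (e r) ∂P = 0 := by
  classical
  set k₀ : Fin n := ⟨e r, he r hr⟩ with hk₀
  set S : Finset (Fin n) := {k₀}ᶜ with hS
  have hind := h.indep.indepFun_finset S {k₀} (by simp [hS, disjoint_compl_left]) h.measurable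
  -- `A` rebuilds the rearranged sequence from the coordinates other than `k₀`, with `0` elsewhere.
  -- It agrees with the true sequence on the first `r` terms by injectivity of `e`, which is all
  -- that `Φ` sees.
  set A : (S → ℝ) → ℕ → ℝ := fun x i =>
    if hi : ∃ hn : e i < n, (⟨e i, hn⟩ : Fin n) ∈ S then x ⟨⟨e i, hi.1⟩, hi.2⟩ else 0 with hA
  have hAm : Measurable A := by
    refine measurable_pi_lambda _ fun i => ?_
    by_cases hi : ∃ hn : e i < n, (⟨e i, hn⟩ : Fin n) ∈ S
    · simp only [hA, dif_pos hi]; exact measurable_pi_apply _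
    · simp only [hA, dif_neg hi]; exact measurable_const
  have hev : Measurable fun x : (({k₀} : Finset (Fin n)) → ℝ) =>
      x ⟨k₀, Finset.mem_singleton_self _⟩ := measurable_pi_apply _
  have hind2 : IndepFun (fun ω => Φ (A fun k : S => Y k ω)) (fun ω => Y k₀ ω) P :=
    hind.comp (hΦ.comp hAm) hev
  have e1 : ∀ ω, Φ (fun i => zeroExt (fun k => Y k ω) (e i)) = Φ (A fun k : S => Y k ω) := by
    intro ω
    refine hdep _ _ fun i hi => ?_
    have hiL := hi.trans hr
    have hmem : ∃ hn : e i < n, (⟨e i, hn⟩ : Fin n) ∈ S := by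
      refine ⟨he i hiL, ?_⟩
      simp only [hS, Finset.mem_compl, Finset.mem_singleton, hk₀, Fin.mk.injEq]
      intro hc
      have := hinj i hiL r hr hc
      omega
    simp only [hA, dif_pos hmem, zeroExt_of_lt _ (he i hiL)]
  have e2 : ∀ ω, zeroExt (fun k => Y k ω) (e r) = Y k₀ ω := fun ω => zeroExt_of_lt _ (he r hr)
  simp only [e1, e2]
  have hm1 : Measurable fun ω => Φ (A fun k : S => Y k ω) :=
    (hΦ.comp hAm).comp (measurable_pi_lambda _ fun k => h.measurable _)
  have := hind2.integral_fun_mul_eq_mul_integral hm1.aestronglyMeasurable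
    (h.measurable k₀).aestronglyMeasurable
  have hm := h.mean k₀
  rw [this, hm, mul_zero]

theorem memLp_psum {u : Ω → ℕ → ℝ} (hu : ∀ i, MemLp (fun ω => u ω i) 2 P) (r : ℕ) :
    MemLp (fun ω => psum (u ω) r) 2 P :=
  memLp_finsetSum _ fun i _ => hu i

theorem memLp_runMax_psum {u : Ω → ℕ → ℝ} (hu : ∀ i, MemLp (fun ω => u ω i) 2 P) (r : ℕ) :
    MemLp (fun ω => runMax (psum (u ω)) r) 2 P := by
  induction r with
  | zero => simp [runMax]
  | succ r ih => exact ih.sup (memLp_psum hu (r + 1))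

theorem IsNoise.integral_psum_sq_le (h : IsNoise P Y v) (hv : 0 ≤ v) {L : ℕ} {e : ℕ → ℕ}
    (he : ∀ i < L, e i < n) (hinj : ∀ i < L, ∀ j < L, e i = e j → i = j) {r : ℕ} (hr : r ≤ L) :
    ∫ ω, psum (fun i => zeroExt (fun k => Y k ω) (e i)) r ^ 2 ∂P ≤ r * v := by
  induction r with
  | zero => simp
  | succ r ih =>
    have ih := ih (by omega)
    have hm : ∀ i, MemLp (fun ω => zeroExt (fun k => Y k ω) (e i)) 2 P :=
      fun i => h.memLp_zeroExt _
    have horth := h.integral_mul_next he hinj (r := r) (by omega) (measurable_psum r)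
      fun u u' huu => psum_congr huu
    have hp := memLp_psum hm r
    have hsq := h.sq_zeroExt_le hv (e r)
    have e1 : ∀ ω, psum (fun i => zeroExt (fun k => Y k ω) (e i)) (r + 1) ^ 2 =
        psum (fun i => zeroExt (fun k => Y k ω) (e i)) r ^ 2 +
        2 * (psum (fun i => zeroExt (fun k => Y k ω) (e i)) r * zeroExt (fun k => Y k ω) (e r)) +
        zeroExt (fun k => Y k ω) (e r) ^ 2 := fun ω => by rw [psum_succ]; ring
    have i2 : Integrable (fun ω => 2 * (psum (fun i => zeroExt (fun k => Y k ω) (e i)) r *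
        zeroExt (fun k => Y k ω) (e r))) P := (hp.integrable_mul (hm r)).const_mul 2
    simp only [e1]
    rw [integral_add (hp.integrable_sq.fun_add i2) (hm r).integrable_sq,
      integral_add hp.integrable_sq i2, integral_const_mul, horth]
    push_cast
    linarith

/-- Kolmogorov's maximal inequality in `L²`. -/
theorem IsNoise.integral_runMax_sq_le (h : IsNoise P Y v) (hv : 0 ≤ v) {L : ℕ} {e : ℕ → ℕ}
    (he : ∀ i < L, e i < n) (hinj : ∀ i < L, ∀ j < L, e i = e j → i = j) {r : ℕ} (hr : r ≤ L) :
    ∫ ω, runMax (psum fun i => zeroExt (fun k => Y k ω) (e i)) r ^ 2 ∂P ≤ 4 * (r * v) := by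
  have hm : ∀ i, MemLp (fun ω => zeroExt (fun k => Y k ω) (e i)) 2 P :=
    fun i => h.memLp_zeroExt _
  have hint : ∀ i, Integrable (fun ω => runMax (psum fun i => zeroExt (fun k => Y k ω) (e i)) i *
      zeroExt (fun k => Y k ω) (e i)) P :=
    fun i => (memLp_runMax_psum hm i).integrable_mul (hm i)
  have i1 : Integrable (fun ω => 4 * psum (fun i => zeroExt (fun k => Y k ω) (e i)) r ^ 2) P :=
    (memLp_psum hm r).integrable_sq.const_mul 4
  have i2 : Integrable (fun ω => 4 * ∑ i ∈ Finset.range r,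
      runMax (psum fun i => zeroExt (fun k => Y k ω) (e i)) i *
        zeroExt (fun k => Y k ω) (e i)) P :=
    (integrable_finsetSum _ fun i _ => hint i).const_mul 4
  calc ∫ ω, runMax (psum fun i => zeroExt (fun k => Y k ω) (e i)) r ^ 2 ∂P
      ≤ ∫ ω, (4 * psum (fun i => zeroExt (fun k => Y k ω) (e i)) r ^ 2 - 4 * ∑ i ∈ Finset.range r,
          runMax (psum fun i => zeroExt (fun k => Y k ω) (e i)) i *
            zeroExt (fun k => Y k ω) (e i)) ∂P := by
        refine integral_mono (memLp_runMax_psum hm r).integrable_sq (i1.sub i2) fun ω => ?_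
        refine (runMax_sq_le (psum_zero _) r).trans (le_of_eq ?_)
        simp only [psum_succ, add_sub_cancel_left]
    _ = 4 * ∫ ω, psum (fun i => zeroExt (fun k => Y k ω) (e i)) r ^ 2 ∂P := by
        rw [integral_sub i1 i2, integral_const_mul, integral_const_mul,
          integral_finsetSum _ fun i _ => hint i, Finset.sum_eq_zero fun i hi => ?_]
        · ring
        · exact h.integral_mul_next he hinj ((Finset.mem_range.1 hi).trans_le hr)
            (measurable_runMax_psum i)
            fun u u' huu => runMax_congr fun l hl => psum_congr fun q hq => huu q (by omega)
    _ ≤ _ := mul_le_mul_of_nonneg_left (h.integral_psum_sq_le hv he hinj hr) (by norm_num)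

theorem cast_min_le (j L : ℕ) : ((min (2 ^ (j + 1)) L : ℕ) : ℝ) ≤ 2 * 2 ^ j := by
  calc ((min (2 ^ (j + 1)) L : ℕ) : ℝ) ≤ ((2 ^ (j + 1) : ℕ) : ℝ) := by
        exact_mod_cast min_le_left _ _
    _ = 2 * 2 ^ j := by push_cast; ring

theorem IsNoise.integrable_levelSum (h : IsNoise P Y v) (p : ℕ) (κ m : ℝ) (L : ℕ) (e : ℕ → ℕ) :
    Integrable (fun ω => levelSum p κ m L (psum fun i => zeroExt (fun k => Y k ω) (e i))) P :=
  integrable_finsetSum _ fun _ _ =>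
    (memLp_runMax_psum (fun i => h.memLp_zeroExt (e i)) _).integrable_sq.mul_const _

/-- By Kolmogorov's inequality the squared maximum at level `j` has mean of order `2 ^ j v`, which
cancels the drift `2 ^ j` in the weight; each level contributes `O(lvl p j)`. -/
theorem IsNoise.integral_levelSum_le (h : IsNoise P Y v) (hv : 0 ≤ v) {L : ℕ} {e : ℕ → ℕ}
    (he : ∀ i < L, e i < n) (hinj : ∀ i < L, ∀ j < L, e i = e j → i = j) (p : ℕ) {κ : ℝ}
    (hκ : 0 < κ) :
    ∫ ω, levelSum p κ 0 L (psum fun i => zeroExt (fun k => Y k ω) (e i)) ∂P ≤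
      8 * v / κ ^ 2 * (p + 2) := by
  have hm : ∀ i, MemLp (fun ω => zeroExt (fun k => Y k ω) (e i)) 2 P :=
    fun i => h.memLp_zeroExt _
  simp only [levelSum]
  rw [integral_finsetSum _ fun j _ => (memLp_runMax_psum hm _).integrable_sq.mul_const _]
  calc ∑ j ∈ Finset.range L, ∫ ω, runMax (psum fun i => zeroExt (fun k => Y k ω) (e i))
        (min (2 ^ (j + 1)) L) ^ 2 * (lvl p j / (κ * (κ * (2 ^ j + 0)))) ∂P
      ≤ ∑ j ∈ Finset.range L, 8 * v / κ ^ 2 * lvl p j := by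
        refine Finset.sum_le_sum fun j _ => ?_
        rw [integral_mul_const]
        have hl := lvl_nonneg p j
        calc _ ≤ 4 * ((min (2 ^ (j + 1)) L : ℕ) * v) * (lvl p j / (κ * (κ * (2 ^ j + 0)))) := by
              refine mul_le_mul_of_nonneg_right ?_ (by positivity)
              exact h.integral_runMax_sq_le hv he hinj (min_le_right _ _)
          _ ≤ 4 * (2 * 2 ^ j * v) * (lvl p j / (κ * (κ * (2 ^ j + 0)))) := by
              gcongr
              exact cast_min_le j L
          _ = 8 * v / κ ^ 2 * lvl p j := by rw [add_zero]; field_simp; ring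
    _ ≤ _ := by
        rw [← Finset.mul_sum]
        gcongr
        exact sum_lvl_le p L

theorem IsNoise.integrable_sqSum (h : IsNoise P Y v) (p L : ℕ) (e : ℕ → ℕ) :
    Integrable (fun ω => sqSum p L fun i => zeroExt (fun k => Y k ω) (e i)) P :=
  integrable_finsetSum _ fun _ _ =>
    (integrable_finsetSum _ fun i _ => (h.memLp_zeroExt (e i)).integrable_sq).const_mul _

theorem IsNoise.integral_sqSum_le (h : IsNoise P Y v) (hv : 0 ≤ v) (L : ℕ) (e : ℕ → ℕ) (p : ℕ) :
    ∫ ω, sqSum p L (fun i => zeroExt (fun k => Y k ω) (e i)) ∂P ≤ 2 * v * (p + 2) := by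
  have hm : ∀ i, Integrable (fun ω => zeroExt (fun k => Y k ω) (e i) ^ 2) P :=
    fun i => (h.memLp_zeroExt _).integrable_sq
  simp only [sqSum]
  rw [integral_finsetSum _ fun j _ => (integrable_finsetSum _ fun i _ => hm i).const_mul _]
  calc ∑ j ∈ Finset.range L, ∫ ω, lvl p j / 2 ^ j * ∑ i ∈ Finset.range (min (2 ^ (j + 1)) L),
        zeroExt (fun k => Y k ω) (e i) ^ 2 ∂P
      ≤ ∑ j ∈ Finset.range L, 2 * v * lvl p j := by
        refine Finset.sum_le_sum fun j _ => ?_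
        rw [integral_const_mul, integral_finsetSum _ fun i _ => hm i]
        have hl := lvl_nonneg p j
        calc _ ≤ lvl p j / 2 ^ j * ∑ i ∈ Finset.range (min (2 ^ (j + 1)) L), v := by
              gcongr with i _
              exact h.sq_zeroExt_le hv _
          _ = lvl p j / 2 ^ j * ((min (2 ^ (j + 1)) L : ℕ) * v) := by simp
          _ ≤ lvl p j / 2 ^ j * (2 * 2 ^ j * v) := by
              gcongr
              exact cast_min_le j L
          _ = 2 * v * lvl p j := by field_simp
    _ ≤ _ := by
        rw [← Finset.mul_sum]
        gcongr
        exact sum_lvl_le p L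

theorem IsNoise.integrable_streamBound [IsProbabilityMeasure P] (h : IsNoise P Y v) (c τ : ℝ) (ξ p : ℕ) :
    Integrable (fun ω => streamBound c τ n ξ p (zeroExt fun k => Y k ω)) P := by
  unfold streamBound
  refine Integrable.add (Integrable.add (Integrable.add (Integrable.add (Integrable.add ?_ ?_) ?_)
    ?_) ?_) ?_
  · exact h.integrable_levelSum p _ _ _ fun i => ξ + i
  · exact h.integrable_levelSum p _ _ _ fun i => ξ - 1 - i
  · exact h.integrable_levelSum p _ _ _ fun i => i
  · exact h.integrable_levelSum p _ _ _ fun i => n - 1 - i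
  · exact (((h.integrable_sqSum p _ fun i => ξ + i).add
      (h.integrable_sqSum p _ fun i => ξ - 1 - i)).add (integrable_const _)).const_mul _
  · exact (((((integrable_finsetSum _ fun i _ => (h.memLp_zeroExt i).integrable_sq).div_const
      _).add (integrable_const _))).const_mul _).mul_const _

/-- The constant in the bound for the expectation of `streamBound`. -/
noncomputable def streamConst (c τ v : ℝ) : ℝ :=
  4 * (8 * v / (c / 2) ^ 2) + 64 / (c * τ / 8) ^ 2 * (4 * v + 1) +
    256 / ((c * τ / 8) ^ 2 * τ) * (v + 1)

/-- Growth linear in `p`, that is logarithmic in the truncation point, is what makes a separation of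
order beyond `K log K` sufficient. -/
theorem IsNoise.integral_streamBound_le [IsProbabilityMeasure P] (h : IsNoise P Y v) (hv : 0 ≤ v) {c τ : ℝ} (hc : 0 < c)
    (hτ : 0 < τ) {ξ : ℕ} (hξ : ξ ≤ n) (hn : 0 < n) (p : ℕ) :
    ∫ ω, streamBound c τ n ξ p (zeroExt fun k => Y k ω) ∂P ≤ streamConst c τ v * (p + 2) := by
  have hn' : (0 : ℝ) < n := by exact_mod_cast hn
  have i1 := h.integrable_levelSum p (c / 2) 0 (n - ξ) fun i => ξ + i
  have i2 := h.integrable_levelSum p (c / 2) 0 ξ fun i => ξ - 1 - i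
  have i3 := h.integrable_levelSum p (c / 2) 0 ξ fun i => i
  have i4 := h.integrable_levelSum p (c / 2) 0 (n - ξ) fun i => n - 1 - i
  have i5 := h.integrable_sqSum p (n - ξ) fun i => ξ + i
  have i6 := h.integrable_sqSum p ξ fun i => ξ - 1 - i
  have i7 : ∀ i, Integrable (fun ω => zeroExt (fun k => Y k ω) i ^ 2) P :=
    fun i => (h.memLp_zeroExt i).integrable_sq
  have i8 := integrable_finsetSum (Finset.range n) fun i _ => i7 i
  have j5 := ((i5.fun_add i6).fun_add (integrable_const (1 : ℝ))).const_mul (64 / (c * τ / 8) ^ 2)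
  have j6 := ((((i8.div_const (n : ℝ)).fun_add (integrable_const (1 : ℝ))).const_mul
    (256 / ((c * τ / 8) ^ 2 * τ))).mul_const ((p : ℝ) + 2))
  have b1 := h.integral_levelSum_le hv (L := n - ξ) (e := fun i => ξ + i)
    (by intro i hi; omega) (by intro i hi j hj hij; omega) p (κ := c / 2) (by positivity)
  have b2 := h.integral_levelSum_le hv (L := ξ) (e := fun i => ξ - 1 - i)
    (by intro i hi; omega) (by intro i hi j hj hij; omega) p (κ := c / 2) (by positivity)
  have b3 := h.integral_levelSum_le hv (L := ξ) (e := fun i => i)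
    (by intro i hi; omega) (by intro i hi j hj hij; omega) p (κ := c / 2) (by positivity)
  have b4 := h.integral_levelSum_le hv (L := n - ξ) (e := fun i => n - 1 - i)
    (by intro i hi; omega) (by intro i hi j hj hij; omega) p (κ := c / 2) (by positivity)
  have b5 := h.integral_sqSum_le hv (n - ξ) (fun i => ξ + i) p
  have b6 := h.integral_sqSum_le hv ξ (fun i => ξ - 1 - i) p
  have b7 : ∑ i ∈ Finset.range n, ∫ ω, zeroExt (fun k => Y k ω) i ^ 2 ∂P ≤ n * v := by
    refine (Finset.sum_le_sum fun i _ => h.sq_zeroExt_le hv i).trans ?_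
    simp
  have split : ∫ ω, streamBound c τ n ξ p (zeroExt fun k => Y k ω) ∂P =
      ∫ ω, levelSum p (c / 2) 0 (n - ξ) (psum fun i => zeroExt (fun k => Y k ω) (ξ + i)) ∂P +
      ∫ ω, levelSum p (c / 2) 0 ξ (psum fun i => zeroExt (fun k => Y k ω) (ξ - 1 - i)) ∂P +
      ∫ ω, levelSum p (c / 2) 0 ξ (psum fun i => zeroExt (fun k => Y k ω) i) ∂P +
      ∫ ω, levelSum p (c / 2) 0 (n - ξ) (psum fun i => zeroExt (fun k => Y k ω) (n - 1 - i)) ∂P +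
      64 / (c * τ / 8) ^ 2 *
        (∫ ω, sqSum p (n - ξ) (fun i => zeroExt (fun k => Y k ω) (ξ + i)) ∂P +
          ∫ ω, sqSum p ξ (fun i => zeroExt (fun k => Y k ω) (ξ - 1 - i)) ∂P + 1) +
      256 / ((c * τ / 8) ^ 2 * τ) *
        ((∑ i ∈ Finset.range n, ∫ ω, zeroExt (fun k => Y k ω) i ^ 2 ∂P) / n + 1) * (p + 2) := by
    unfold streamBound
    rw [integral_add ((((i1.fun_add i2).fun_add i3).fun_add i4).fun_add j5) j6,
      integral_add (((i1.fun_add i2).fun_add i3).fun_add i4) j5,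
      integral_add ((i1.fun_add i2).fun_add i3) i4, integral_add (i1.fun_add i2) i3,
      integral_add i1 i2]
    rw [integral_const_mul, integral_mul_const, integral_const_mul,
      integral_add (i5.fun_add i6) (integrable_const _), integral_add i5 i6,
      integral_add (i8.div_const _) (integrable_const _), integral_div,
      integral_finsetSum _ fun i _ => i7 i]
    simp
  rw [split]
  have hp : (1 : ℝ) ≤ p + 2 := by
    have : (0 : ℝ) ≤ p := Nat.cast_nonneg p
    linarith
  have c5 : 64 / (c * τ / 8) ^ 2 *
        (∫ ω, sqSum p (n - ξ) (fun i => zeroExt (fun k => Y k ω) (ξ + i)) ∂P +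
          ∫ ω, sqSum p ξ (fun i => zeroExt (fun k => Y k ω) (ξ - 1 - i)) ∂P + 1) ≤
      64 / (c * τ / 8) ^ 2 * ((4 * v + 1) * (p + 2)) := by
    gcongr
    linarith
  have c6 : 256 / ((c * τ / 8) ^ 2 * τ) *
        ((∑ i ∈ Finset.range n, ∫ ω, zeroExt (fun k => Y k ω) i ^ 2 ∂P) / n + 1) * (p + 2) ≤
      256 / ((c * τ / 8) ^ 2 * τ) * (v + 1) * (p + 2) := by
    gcongr
    rw [div_le_iff₀ hn']
    linarith
  refine (add_le_add (add_le_add (add_le_add (add_le_add (add_le_add b1 b2) b3) b4) c5) c6).trans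
    (le_of_eq ?_)
  unfold streamConst
  ring

end RandomWalk

/-! ### Lower bounds for the individual divergences. -/

section Divergence

theorem logLR_swap {A : Type*} (f₀ f₁ : A → ℝ) (x : A) : logLR f₁ f₀ x = - logLR f₀ f₁ x := by
  rw [logLR, logLR, ← Real.log_inv, inv_div]

variable {A : Type*} [MeasurableSpace A]

theorem integrable_fun_sub {P : Measure A} {f g : A → ℝ} (hf : Integrable f P)
    (hg : Integrable g P) : Integrable (fun x => f x - g x) P := hf.sub hg

/-- Two laws with log-likelihood ratio `ℓ`, variances at most `v`, and means of `ℓ` that differ by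
`J`, have divergence at least `J² / (4 v + J²)` (through the Hellinger distance). -/
theorem jeffreys_le_integral {P Q : Measure A} [IsProbabilityMeasure P] [IsProbabilityMeasure Q]
    {l : A → ℝ} (hl : Measurable l)
    (hQ : Q = P.withDensity fun x => ENNReal.ofReal (Real.exp (-l x)))
    (h2P : MemLp l 2 P) (h2Q : MemLp l 2 Q) {v : ℝ} (hvP : variance l P ≤ v)
    (hvQ : variance l Q ≤ v) {J : ℝ} (hJ : J = ∫ x, l x ∂P - ∫ x, l x ∂Q) (hJ0 : 0 < J) :
    J ^ 2 / (4 * v + J ^ 2) ≤ ∫ x, l x ∂P := by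
  have hv : 0 ≤ v := (variance_nonneg _ _).trans hvP
  have hem : Measurable fun x => ENNReal.ofReal (Real.exp (-l x)) :=
    (Real.measurable_exp.comp hl.neg).ennreal_ofReal
  have hlt : ∀ᵐ x ∂P, ENNReal.ofReal (Real.exp (-l x)) < ∞ :=
    Eventually.of_forall fun x => ENNReal.ofReal_lt_top
  have chI : ∀ φ : A → ℝ, Integrable φ Q → Integrable (fun x => Real.exp (-l x) * φ x) P := by
    intro φ hφ
    rw [hQ, integrable_withDensity_iff_integrable_smul' hem hlt] at hφ
    simpa [ENNReal.toReal_ofReal (Real.exp_pos _).le] using hφ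
  have ch : ∀ φ : A → ℝ, ∫ x, φ x ∂Q = ∫ x, Real.exp (-l x) * φ x ∂P := by
    intro φ
    rw [hQ, integral_withDensity_eq_integral_toReal_smul hem hlt]
    simp [ENNReal.toReal_ofReal (Real.exp_pos _).le]
  -- `h` is the square root of `dQ/dP`, and `∫ (1 - h)² dP` is the squared Hellinger distance.
  set h : A → ℝ := fun x => Real.exp (-l x / 2) with hh
  have hsq : ∀ x, Real.exp (-l x) = h x ^ 2 := by
    intro x
    rw [hh, ← Real.exp_nat_mul]
    congr 1; push_cast; ring
  have hpos : ∀ x, 0 < h x := fun x => Real.exp_pos _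
  have hhm : Measurable h := Real.measurable_exp.comp (hl.neg.div_const 2)
  simp only [hsq] at chI ch
  have i2 : Integrable (fun x => h x ^ 2) P := by
    simpa using chI (fun _ => 1) (integrable_const _)
  have e2 : ∫ x, h x ^ 2 ∂P = 1 := by
    have := ch fun _ => 1
    simpa using this.symm
  have i1 : Integrable h P := by
    refine Integrable.mono' ((integrable_const (1 : ℝ)).add i2) hhm.aestronglyMeasurable ?_
    refine Eventually.of_forall fun x => ?_
    rw [Real.norm_eq_abs, abs_of_pos (hpos x)]
    simp only [Pi.add_apply]
    nlinarith [sq_nonneg (h x - 1)]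
  have il : Integrable l P := h2P.integrable (by norm_num)
  have ilQ : Integrable l Q := h2Q.integrable (by norm_num)
  set m₀ := ∫ x, l x ∂P with hm₀
  set m₁ := ∫ x, l x ∂Q with hm₁
  -- Centring at the midpoint gives `l - a` the same squared mean `J² / 4` under both laws.
  set a := (m₀ + m₁) / 2 with ha
  have iH : Integrable (fun x => (1 - h x) ^ 2) P := by
    have := (integrable_fun_sub (integrable_const (1 : ℝ)) (i1.const_mul 2)).fun_add i2
    refine this.congr (Eventually.of_forall fun x => ?_)
    simp only; ring
  have eH : ∫ x, (1 - h x) ^ 2 ∂P = 2 - 2 * ∫ x, h x ∂P := by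
    have : ∀ x, (1 - h x) ^ 2 = (1 - 2 * h x) + h x ^ 2 := fun x => by ring
    simp only [this]
    rw [integral_add (integrable_fun_sub (integrable_const (1 : ℝ)) (i1.const_mul 2)) i2,
      integral_sub (integrable_const _) (i1.const_mul 2), integral_const_mul, e2]
    simp; ring
  -- Squared Hellinger distance is at most the divergence, by `exp u ≥ 1 + u`.
  have hHle : ∫ x, (1 - h x) ^ 2 ∂P ≤ m₀ := by
    have : ∫ x, (2 - 2 * h x) ∂P ≤ m₀ := by
      refine integral_mono (integrable_fun_sub (integrable_const _) (i1.const_mul 2)) il fun x => ?_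
      have := Real.add_one_le_exp (-l x / 2)
      simp only [hh]; linarith
    rw [integral_sub (integrable_const _) (i1.const_mul 2), integral_const_mul] at this
    rw [eH]
    simpa using this
  have second : ∀ (M : Measure A) [IsProbabilityMeasure M], MemLp l 2 M → variance l M ≤ v →
      (∫ x, l x ∂M - a) ^ 2 = J ^ 2 / 4 →
      Integrable (fun x => (l x - a) ^ 2) M ∧ ∫ x, (l x - a) ^ 2 ∂M ≤ v + J ^ 2 / 4 := by
    intro M _ hR hvR haR
    have hR' : MemLp (fun x => l x - a) 2 M := hR.sub (memLp_const a)
    refine ⟨hR'.integrable_sq, ?_⟩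
    have e := variance_eq_sub hR'
    have e' : variance (fun x => l x - a) M = variance l M :=
      variance_sub_const hl.aestronglyMeasurable a
    rw [e', integral_sub (hR.integrable (by norm_num)) (integrable_const _)] at e
    simp only [Pi.pow_apply, integral_const, probReal_univ, smul_eq_mul, one_mul] at e
    rw [haR] at e
    linarith
  obtain ⟨iP, bP⟩ := second P h2P hvP (by rw [← hm₀, ha, hJ]; ring)
  obtain ⟨iQ, bQ⟩ := second Q h2Q hvQ (by rw [← hm₁, ha, hJ]; ring)
  have iQ' := chI _ iQ
  rw [ch] at bQ
  have ilQ' := chI _ ilQ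
  have eJ : ∫ x, (l x - a) * (1 - h x ^ 2) ∂P = J := by
    have : ∀ x, (l x - a) * (1 - h x ^ 2) = (l x - h x ^ 2 * l x) - (a - a * h x ^ 2) :=
      fun x => by ring
    simp only [this]
    rw [integral_sub (integrable_fun_sub il ilQ') (integrable_fun_sub (integrable_const a) (i2.const_mul a)),
      integral_sub il ilQ', integral_sub (integrable_const a) (i2.const_mul a),
      integral_const_mul, e2, ← ch, hJ]
    simp [hm₀, hm₁]
  have iJ : Integrable (fun x => (l x - a) * (1 - h x ^ 2)) P := by
    refine (integrable_fun_sub (integrable_fun_sub il ilQ') (integrable_fun_sub (integrable_const a) (i2.const_mul a))).congr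
      (Eventually.of_forall fun x => ?_)
    simp only; ring
  have hden : 0 < 4 * v + J ^ 2 := by positivity
  -- `J` is the integral of `(l - a)(1 + h)(1 - h)`. Cauchy–Schwarz with `(1 + h)² ≤ 2(1 + h²)`
  -- would give `J² ≤ (4 v + J²) ∫ (1 - h)²`; it is used as a weighted square inequality, and this
  -- `t` is the optimal weight.
  set t := J / (4 * v + J ^ 2) with ht
  have main : 2 * t * J ≤ 2 * t ^ 2 * ((v + J ^ 2 / 4) + (v + J ^ 2 / 4)) + m₀ := by
    calc 2 * t * J = ∫ x, 2 * t * ((l x - a) * (1 - h x ^ 2)) ∂P := by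
          rw [integral_const_mul, eJ]
      _ ≤ ∫ x, (2 * t ^ 2 * ((l x - a) ^ 2 + h x ^ 2 * (l x - a) ^ 2) + (1 - h x) ^ 2) ∂P := by
          refine integral_mono (iJ.const_mul _) (((iP.fun_add iQ').const_mul _).fun_add iH)
            fun x => ?_
          simp only
          nlinarith [sq_nonneg (t * (l x - a) * (1 + h x) - (1 - h x)),
            sq_nonneg (t * (l x - a) * (1 - h x))]
      _ = 2 * t ^ 2 * (∫ x, (l x - a) ^ 2 ∂P + ∫ x, h x ^ 2 * (l x - a) ^ 2 ∂P) +
            ∫ x, (1 - h x) ^ 2 ∂P := by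
          rw [integral_add ((iP.fun_add iQ').const_mul _) iH, integral_const_mul,
            integral_add iP iQ']
      _ ≤ _ := by gcongr
  have e3 : 2 * t ^ 2 * ((v + J ^ 2 / 4) + (v + J ^ 2 / 4)) = t * J := by
    rw [ht]; field_simp; ring
  have e4 : J ^ 2 / (4 * v + J ^ 2) = t * J := by rw [ht]; ring
  rw [e4]
  linarith

theorem IsDensity.ae_ne_zero {P μ : Measure A} {f : A → ℝ} (h : IsDensity P μ f) :
    ∀ᵐ x ∂P, 0 < f x := by
  have hm : MeasurableSet {x | f x ≤ 0} := measurableSet_le h.measurable measurable_const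
  rw [ae_iff]
  have : {x | ¬ 0 < f x} = {x | f x ≤ 0} := by ext x; simp
  rw [this, h.eq_withDensity, withDensity_apply _ hm]
  rw [setLIntegral_congr_fun (g := fun _ => 0) hm]
  · simp
  · intro x hx
    exact ENNReal.ofReal_of_nonpos hx

theorem IsDensity.measurable_logLR {P Q μ : Measure A} {f₀ f₁ : A → ℝ} (h₀ : IsDensity P μ f₀)
    (h₁ : IsDensity Q μ f₁) : Measurable (logLR f₀ f₁) :=
  Real.measurable_log.comp (h₀.measurable.div h₁.measurable)

theorem IsDensity.eq_withDensity_div {P Q μ : Measure A} {f₀ f₁ : A → ℝ} (h₀ : IsDensity P μ f₀)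
    (h₁ : IsDensity Q μ f₁) (hac : P ≪ Q) :
    P = Q.withDensity fun x => ENNReal.ofReal (f₀ x / f₁ x) := by
  have hm : MeasurableSet {x | f₁ x = 0} := measurableSet_eq_fun h₁.measurable measurable_const
  have hz : Q {x | f₁ x = 0} = 0 := by
    refine measure_mono_null (fun x hx => ?_) (ae_iff.1 h₁.ae_ne_zero)
    have hx' : f₁ x = 0 := hx
    simp [hx']
  have hz' := hac hz
  rw [h₀.eq_withDensity, withDensity_apply _ hm,
    lintegral_eq_zero_iff h₀.measurable.ennreal_ofReal] at hz'
  -- Absolute continuity forces `f₀ = 0` almost everywhere on `{f₁ = 0}`, so the convention `f₀ / 0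
  -- = 0` gives the right density there.
  have hae := (ae_restrict_iff' hm).1 hz'
  have hdiv : Measurable fun x => ENNReal.ofReal (f₀ x / f₁ x) :=
    (h₀.measurable.div h₁.measurable).ennreal_ofReal
  rw [h₁.eq_withDensity, ← withDensity_mul _ h₁.measurable.ennreal_ofReal hdiv]
  rw [h₀.eq_withDensity]
  refine withDensity_congr_ae ?_
  filter_upwards [hae] with x hx
  rw [Pi.mul_apply, ← ENNReal.ofReal_mul (h₁.nonneg x)]
  by_cases h0 : f₁ x = 0
  · simpa [h0] using hx h0
  · rw [mul_div_cancel₀ _ h0]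

theorem IsDensity.llr_ae_eq {P Q μ : Measure A} [IsProbabilityMeasure P] [IsProbabilityMeasure Q]
    {f₀ f₁ : A → ℝ} (h₀ : IsDensity P μ f₀) (h₁ : IsDensity Q μ f₁) (hac : P ≪ Q) :
    llr P Q =ᵐ[P] logLR f₀ f₁ := by
  have e := Measure.rnDeriv_withDensity Q (h₀.measurable.div h₁.measurable).ennreal_ofReal
  have e' : P.rnDeriv Q =ᵐ[Q] fun x => ENNReal.ofReal (f₀ x / f₁ x) := by
    conv_lhs => rw [h₀.eq_withDensity_div h₁ hac]
    exact e
  filter_upwards [hac.ae_le e'] with x hx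
  rw [llr_def, logLR]
  simp only [hx]
  rw [ENNReal.toReal_ofReal (div_nonneg (h₀.nonneg x) (h₁.nonneg x))]

theorem IsDensity.toReal_klDiv {P Q μ : Measure A} [IsProbabilityMeasure P]
    [IsProbabilityMeasure Q] {f₀ f₁ : A → ℝ} (h₀ : IsDensity P μ f₀) (h₁ : IsDensity Q μ f₁)
    (hac : P ≪ Q) : (klDiv P Q).toReal = ∫ x, logLR f₀ f₁ x ∂P := by
  rw [toReal_klDiv_of_measure_eq hac (by simp)]
  exact integral_congr_ae (h₀.llr_ae_eq h₁ hac)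

theorem IsDensity.eq_withDensity_exp {P Q μ : Measure A} {f₀ f₁ : A → ℝ} (h₀ : IsDensity P μ f₀)
    (h₁ : IsDensity Q μ f₁) (hPQ : P ≪ Q) (hQP : Q ≪ P) :
    Q = P.withDensity fun x => ENNReal.ofReal (Real.exp (- logLR f₀ f₁ x)) := by
  conv_lhs => rw [h₁.eq_withDensity_div h₀ hQP]
  refine withDensity_congr_ae ?_
  filter_upwards [h₀.ae_ne_zero, hPQ.ae_le h₁.ae_ne_zero] with x hx0 hx1
  rw [← logLR_swap, logLR, Real.exp_log (div_pos hx1 hx0)]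

/-- A lower bound for the divergence `KL(P‖Q)` in terms of a lower bound `J` for the Jeffreys
divergence. -/
theorem IsDensity.le_integral_logLR {P Q μ : Measure A} [IsProbabilityMeasure P]
    [IsProbabilityMeasure Q] {f₀ f₁ : A → ℝ} (h₀ : IsDensity P μ f₀) (h₁ : IsDensity Q μ f₁)
    (hPQ : klDiv P Q ≠ ∞) (hQP : klDiv Q P ≠ ∞) {v J : ℝ} (hJ0 : 0 < J)
    (hJ : ENNReal.ofReal J ≤ klDiv P Q + klDiv Q P)
    (hm₀ : MemLp (logLR f₀ f₁) 2 P) (hv₀ : variance (logLR f₀ f₁) P ≤ v)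
    (hm₁ : MemLp (logLR f₀ f₁) 2 Q) (hv₁ : variance (logLR f₀ f₁) Q ≤ v) :
    J ^ 2 / (4 * v + J ^ 2) ≤ ∫ x, logLR f₀ f₁ x ∂P := by
  have hac := (klDiv_ne_top_iff.1 hPQ).1
  have hac' := (klDiv_ne_top_iff.1 hQP).1
  have e₀ := h₀.toReal_klDiv h₁ hac
  have e₁ := h₁.toReal_klDiv h₀ hac'
  simp only [logLR_swap f₀ f₁, integral_neg] at e₁
  have hv : 0 ≤ v := (variance_nonneg _ _).trans hv₀
  have hJ' : J ≤ ∫ x, logLR f₀ f₁ x ∂P - ∫ x, logLR f₀ f₁ x ∂Q := by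
    have := ENNReal.toReal_mono (ENNReal.add_ne_top.2 ⟨hPQ, hQP⟩) hJ
    rw [ENNReal.toReal_ofReal hJ0.le, ENNReal.toReal_add hPQ hQP, e₀, e₁] at this
    linarith
  set J' := ∫ x, logLR f₀ f₁ x ∂P - ∫ x, logLR f₀ f₁ x ∂Q with hJ'def
  have hJ'0 : 0 < J' := hJ0.trans_le hJ'
  refine le_trans ?_ (jeffreys_le_integral (h₀.measurable_logLR h₁)
    (h₀.eq_withDensity_exp h₁ hac hac') hm₀ hm₁ hv₀ hv₁ hJ'def hJ'0)
  rw [div_le_div_iff₀ (by positivity) (by positivity)]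
  have : J ^ 2 ≤ J' ^ 2 := pow_le_pow_left₀ hJ0.le hJ' 2
  nlinarith

end Divergence

/-! ### Log-likelihoods of permuted streams. -/

section Likelihood

variable {n : ℕ} {A : Type*} {f₀ f₁ : A → ℝ} {x : Fin n → A}

theorem mle_spec (hn : 0 < n) (f₀ f₁ : A → ℝ) (x : Fin n → A) :
    mle f₀ f₁ x ∈ Set.Icc 1 n ∧
      ∀ s ∈ Set.Icc 1 n, likelihood f₀ f₁ x s ≤ likelihood f₀ f₁ x (mle f₀ f₁ x) := by
  have hne : {t ∈ Set.Icc 1 n | ∀ s ∈ Set.Icc 1 n,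
      likelihood f₀ f₁ x s ≤ likelihood f₀ f₁ x t}.Nonempty := by
    obtain ⟨t, ht, hmax⟩ := (Finset.Icc 1 n).exists_max_image (likelihood f₀ f₁ x)
      ⟨1, Finset.mem_Icc.2 ⟨le_rfl, hn⟩⟩
    exact ⟨t, Finset.mem_Icc.1 ht, fun s hs => hmax s (Finset.mem_Icc.2 hs)⟩
  exact Nat.sInf_mem hne

theorem likelihood_pos (h₀ : ∀ i, 0 < f₀ (x i)) (h₁ : ∀ i, 0 < f₁ (x i)) (t : ℕ) :
    0 < likelihood f₀ f₁ x t := by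
  refine Finset.prod_pos fun i _ => ?_
  split_ifs
  exacts [h₀ i, h₁ i]

theorem log_likelihood (h₀ : ∀ i, 0 < f₀ (x i)) (h₁ : ∀ i, 0 < f₁ (x i)) (t : ℕ) :
    Real.log (likelihood f₀ f₁ x t) =
      ∑ i : Fin n, if (i : ℕ) < t then Real.log (f₀ (x i)) else Real.log (f₁ (x i)) := by
  rw [likelihood, Real.log_prod]
  · refine Finset.sum_congr rfl fun i _ => ?_
    split_ifs <;> rfl
  · intro i _
    split_ifs
    exacts [(h₀ i).ne', (h₁ i).ne']

theorem likelihood_comp_perm (σ : Equiv.Perm (Fin n)) {t : ℕ}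
    (hσ : ∀ i, (σ i : ℕ) < t ↔ (i : ℕ) < t) :
    likelihood f₀ f₁ (fun i => x (σ i)) t = likelihood f₀ f₁ x t := by
  rw [likelihood, likelihood,
    ← Equiv.prod_comp σ fun i : Fin n => if (i : ℕ) < t then f₀ (x i) else f₁ (x i)]
  refine Finset.prod_congr rfl fun i _ => ?_
  simp only [hσ i]

/-- A permutation of `Fin n`, as a self-map of `ℕ`. -/
def natPerm (σ : Equiv.Perm (Fin n)) (i : ℕ) : ℕ := if h : i < n then (σ ⟨i, h⟩ : ℕ) else i

theorem natPerm_of_lt (σ : Equiv.Perm (Fin n)) {i : ℕ} (h : i < n) :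
    natPerm σ i = (σ ⟨i, h⟩ : ℕ) := dif_pos h

theorem natPerm_injective (σ : Equiv.Perm (Fin n)) : Function.Injective (natPerm σ) := by
  intro i j hij
  by_cases hi : i < n <;> by_cases hj : j < n
  · rw [natPerm_of_lt σ hi, natPerm_of_lt σ hj] at hij
    simpa using σ.injective (Fin.ext hij)
  · rw [natPerm_of_lt σ hi, natPerm, dif_neg hj] at hij
    have := (σ ⟨i, hi⟩).2
    omega
  · rw [natPerm_of_lt σ hj, natPerm, dif_neg hi] at hij
    have := (σ ⟨j, hj⟩).2
    omega
  · simpa [natPerm, hi, hj] using hij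

theorem natPerm_mul_swap (σ : Equiv.Perm (Fin n)) (a b : Fin n) (l : ℕ) :
    natPerm (σ * Equiv.swap a b) l = natPerm σ (Equiv.swap (a : ℕ) (b : ℕ) l) := by
  by_cases hl : l < n
  · have e : Equiv.swap (a : ℕ) (b : ℕ) l = (Equiv.swap a b ⟨l, hl⟩ : Fin n) := by
      simp only [Equiv.swap_apply_def, Fin.ext_iff]
      split_ifs <;> rfl
    rw [natPerm_of_lt _ hl, e, natPerm_of_lt _ (Fin.is_lt _)]
    rfl
  · rw [Equiv.swap_apply_of_ne_of_ne (by have := a.2; omega) (by have := b.2; omega)]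
    simp [natPerm, hl]

/-- The log-likelihood of a permuted stream at `s`, compared with that of the stream at `ξ`. -/
theorem log_likelihood_perm_sub_le (h₀ : ∀ i, 0 < f₀ (x i)) (h₁ : ∀ i, 0 < f₁ (x i))
    (σ : Equiv.Perm (Fin n)) {s ξ : ℕ} (hs : s ≤ n) {y : ℕ → ℝ} {c : ℝ}
    (hy : ∀ i : Fin n, (if (i : ℕ) < ξ then - logLR f₀ f₁ (x i) else logLR f₀ f₁ (x i)) ≤
      y i - c) :
    Real.log (likelihood f₀ f₁ (fun i => x (σ i)) s) - Real.log (likelihood f₀ f₁ x ξ) ≤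
      ∑ i ∈ Finset.range s, (if ξ ≤ natPerm σ i then y (natPerm σ i) - c else 0) +
        ∑ i ∈ Finset.Ico s n, (if natPerm σ i < ξ then y (natPerm σ i) - c else 0) := by
  set B : ℕ → ℝ := fun i => if i < s then (if ξ ≤ natPerm σ i then y (natPerm σ i) - c else 0)
    else (if natPerm σ i < ξ then y (natPerm σ i) - c else 0) with hB
  have eB : ∑ i ∈ Finset.range s, (if ξ ≤ natPerm σ i then y (natPerm σ i) - c else 0) +
        ∑ i ∈ Finset.Ico s n, (if natPerm σ i < ξ then y (natPerm σ i) - c else 0) =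
      ∑ i : Fin n, B i := by
    rw [Fin.sum_univ_eq_sum_range, ← Finset.sum_range_add_sum_Ico _ hs]
    congr 1
    · refine Finset.sum_congr rfl fun i hi => ?_
      simp only [hB, if_pos (Finset.mem_range.1 hi)]
    · refine Finset.sum_congr rfl fun i hi => ?_
      have := (Finset.mem_Ico.1 hi).1
      simp only [hB, if_neg (show ¬ i < s by omega)]
  -- The original likelihood is reindexed by `σ`, so both sums visit the same observation at each
  -- index. Correctly placed observations cancel, and each misplaced one costs its sign-corrected
  -- log-likelihood ratio, at most `y - c`.
  rw [eB, log_likelihood (fun i => h₀ (σ i)) (fun i => h₁ (σ i)), log_likelihood h₀ h₁,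
    ← Equiv.sum_comp σ fun i : Fin n =>
      if (i : ℕ) < ξ then Real.log (f₀ (x i)) else Real.log (f₁ (x i)), ← Finset.sum_sub_distrib]
  refine Finset.sum_le_sum fun i _ => ?_
  have hl : logLR f₀ f₁ (x (σ i)) = Real.log (f₀ (x (σ i))) - Real.log (f₁ (x (σ i))) :=
    Real.log_div (h₀ _).ne' (h₁ _).ne'
  have := hy (σ i)
  rw [hl] at this
  simp only [hB, natPerm_of_lt σ i.2, Fin.eta]
  split_ifs at this ⊢ <;> first | omega | linarith

end Likelihood

/-! ### The split-permutation group and the conformal p-value. -/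

section Permutations

variable {K n : ℕ} {𝒳 : Fin K → Type*}

theorem splitPerms_lt_iff {t : Fin K → ℕ} {π : Fin K → Equiv.Perm (Fin n)}
    (hπ : π ∈ splitPerms n t) (k : Fin K) (i : Fin n) : (π k i : ℕ) < t k ↔ (i : ℕ) < t k := by
  have := hπ k i
  constructor
  · intro h
    by_contra hc
    have := this.2 (not_lt.1 hc)
    omega
  · exact this.1

theorem mem_splitPerms_iff {t : Fin K → ℕ} {π : Fin K → Equiv.Perm (Fin n)} :
    π ∈ splitPerms n t ↔ ∀ k i, (π k i : ℕ) < t k ↔ (i : ℕ) < t k := by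
  refine ⟨fun h k i => splitPerms_lt_iff h k i, fun h k i => ⟨(h k i).2, fun hi => ?_⟩⟩
  by_contra hc
  have := (h k i).1 (not_le.1 hc)
  omega

theorem one_mem_splitPerms (t : Fin K → ℕ) : (1 : Fin K → Equiv.Perm (Fin n)) ∈ splitPerms n t :=
  mem_splitPerms_iff.2 fun _ _ => Iff.rfl

theorem mul_mem_splitPerms {t : Fin K → ℕ} {π σ : Fin K → Equiv.Perm (Fin n)}
    (hπ : π ∈ splitPerms n t) (hσ : σ ∈ splitPerms n t) : π * σ ∈ splitPerms n t :=
  mem_splitPerms_iff.2 fun k i =>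
    (splitPerms_lt_iff hπ k (σ k i)).trans (splitPerms_lt_iff hσ k i)

theorem inv_mem_splitPerms {t : Fin K → ℕ} {π : Fin K → Equiv.Perm (Fin n)}
    (hπ : π ∈ splitPerms n t) : π⁻¹ ∈ splitPerms n t :=
  mem_splitPerms_iff.2 fun k i => by
    have := splitPerms_lt_iff hπ k ((π k)⁻¹ i)
    have e : π k ((π k)⁻¹ i) = i := (π k).apply_symm_apply i
    rw [e] at this
    exact this.symm

/-- The split-permutation group, as a finite set. -/
noncomputable def splitFinset (n : ℕ) (t : Fin K → ℕ) : Finset (Fin K → Equiv.Perm (Fin n)) :=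
  (Set.toFinite (splitPerms n t)).toFinset

@[simp] theorem mem_splitFinset {t : Fin K → ℕ} {π : Fin K → Equiv.Perm (Fin n)} :
    π ∈ splitFinset n t ↔ π ∈ splitPerms n t := by simp [splitFinset]

theorem splitFinset_card_pos (t : Fin K → ℕ) : 0 < (splitFinset n t).card :=
  Finset.card_pos.2 ⟨1, mem_splitFinset.2 (one_mem_splitPerms t)⟩

open Classical in
theorem configPValue_eq (S : ((k : Fin K) → Fin n → 𝒳 k) → (Fin K → ℕ) → ℝ)
    (x : (k : Fin K) → Fin n → 𝒳 k) (t : Fin K → ℕ) :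
    configPValue S x t = (((splitFinset n t).filter fun π => S (permute π x) t ≤ S x t).card : ℝ) /
      (splitFinset n t).card := by
  unfold configPValue
  rw [Set.ncard_eq_toFinset_card _ (Set.toFinite (splitPerms n t)),
    ← Set.ncard_coe_finset ((splitFinset n t).filter _)]
  congr 3
  ext π
  simp

/-- Right multiplication by a transposition inside one block is an involution of the group, so the
uniform law on it is invariant. -/
theorem sum_splitFinset_swap {t : Fin K → ℕ} (k : Fin K) {a b : ℕ} (ha : a < n) (hb : b < n)
    (hab : a < t k ↔ b < t k) (F : (ℕ → ℕ) → ℝ) :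
    ∑ π ∈ splitFinset n t, F (natPerm (π k)) =
      ∑ π ∈ splitFinset n t, F (fun l => natPerm (π k) (Equiv.swap a b l)) := by
  set σ : Fin K → Equiv.Perm (Fin n) := Function.update 1 k (Equiv.swap ⟨a, ha⟩ ⟨b, hb⟩) with hσ
  have hσk : σ k = Equiv.swap ⟨a, ha⟩ ⟨b, hb⟩ := Function.update_self ..
  have hσmem : σ ∈ splitPerms n t := by
    rw [mem_splitPerms_iff]
    intro j i
    by_cases hj : j = k
    · subst hj
      rw [hσk, Equiv.swap_apply_def]
      split_ifs with h1 h2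
      · rw [h1]; exact hab.symm
      · rw [h2]; exact hab
      · rfl
    · rw [hσ, Function.update_of_ne hj]; rfl
  have hσσ : σ * σ = 1 := by
    ext j i
    by_cases hj : j = k
    · subst hj
      simp only [Pi.mul_apply, hσk, Equiv.swap_mul_self, Pi.one_apply]
    · simp only [Pi.mul_apply, hσ, Function.update_of_ne hj, Pi.one_apply, mul_one]
  symm
  refine Finset.sum_nbij' (fun π => π * σ) (fun π => π * σ) ?_ ?_ ?_ ?_ ?_
  · intro π hπ
    exact mem_splitFinset.2 (mul_mem_splitPerms (mem_splitFinset.1 hπ) hσmem)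
  · intro π hπ
    exact mem_splitFinset.2 (mul_mem_splitPerms (mem_splitFinset.1 hπ) hσmem)
  · intro π _; rw [mul_assoc, hσσ, mul_one]
  · intro π _; rw [mul_assoc, hσσ, mul_one]
  · intro π _
    congr 1
    funext l
    rw [Pi.mul_apply, hσk, natPerm_mul_swap]

theorem exch_low {t : Fin K → ℕ} (k : Fin K) (ht : t k ≤ n) :
    Exch (splitFinset n t) (t k) (fun π => natPerm (π k)) :=
  fun i j hi hj F => sum_splitFinset_swap k (by omega) (by omega) (by omega) F

theorem exch_high {t : Fin K → ℕ} (k : Fin K) :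
    Exch (splitFinset n t) (n - t k) (fun π i => natPerm (π k) (t k + i)) := by
  intro i j hi hj F
  rw [sum_splitFinset_swap k (a := t k + i) (b := t k + j) (by omega) (by omega) (by omega)
    fun z => F fun l => z (t k + l)]
  refine Finset.sum_congr rfl fun π _ => ?_
  congr 1
  funext l
  simp only [Equiv.swap_apply_def]
  split_ifs <;> omega

/-- Bound for the conformal `p`-value of a configuration `t` away from `ξ`. -/
theorem configPValue_le {f₀ f₁ : (k : Fin K) → 𝒳 k → ℝ} {x : (k : Fin K) → Fin n → 𝒳 k}
    (hn : 0 < n) (h₀ : ∀ k i, 0 < f₀ k (x k i)) (h₁ : ∀ k i, 0 < f₁ k (x k i))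
    {t ξ : Fin K → ℕ} (ht : ∀ k, t k ∈ Set.Icc 1 n) (hξ1 : ∀ k, ξ k ∈ Set.Icc 1 n) {c τ : ℝ}
    (hc : 0 < c) (hc1 : c ≤ 1) (hτ : 0 < τ) (hτ1 : τ ≤ 1) (hξ : ∀ k, τ * n ≤ ξ k)
    (hξ' : ∀ k, τ * n ≤ (n : ℝ) - ξ k) {y : Fin K → ℕ → ℝ}
    (hy : ∀ k, ∀ i : Fin n, (if (i : ℕ) < ξ k then - logLR (f₀ k) (f₁ k) (x k i)
      else logLR (f₀ k) (f₁ k) (x k i)) ≤ y k i - c)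
    {p : ℕ} (hp : (2 : ℝ) ^ p ≤ c * τ / 8 * ∑ k, |(t k : ℝ) - ξ k|) :
    configPValue (oracleScore f₀ f₁) x t ≤ (∑ k, streamBound c τ n (ξ k) p (y k)) / 2 ^ p := by
  classical
  set G := splitFinset n t with hG
  set T : ℝ := 2 ^ p with hT
  have hT0 : 0 < T := by positivity
  set Mx : (k : Fin K) → (Fin n → 𝒳 k) → ℝ := fun k z =>
    Real.log (likelihood (f₀ k) (f₁ k) z (mle (f₀ k) (f₁ k) z)) with hMx
  set F : Fin K → (Fin K → Equiv.Perm (Fin n)) → ℝ := fun k π =>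
    Mx k (fun i => x k (π k i)) - Real.log (likelihood (f₀ k) (f₁ k) (x k) (ξ k)) with hF
  have hstream : ∀ k, ∑ π ∈ G, tpos T (F k π + c * τ / 8 * |(t k : ℝ) - ξ k|) ≤
      G.card * streamBound c τ n (ξ k) p (y k) := by
    intro k
    refine sum_tpos_stream_le hn (ht k).2 hc hc1 hτ hτ1 (hξ k) (hξ1 k).2 (hξ' k)
      (fun π => natPerm (π k)) (fun π _ => natPerm_injective _) ?_ ?_ (exch_low k (ht k).2)
      (exch_high k) p (y k) (F k) ?_
    · intro π hπ i hi
      have hin : i < n := hi.trans_le (ht k).2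
      rw [natPerm_of_lt _ hin]
      exact (splitPerms_lt_iff (mem_splitFinset.1 hπ) k ⟨i, hin⟩).2 hi
    · intro π hπ i hi hin
      rw [natPerm_of_lt _ hin]
      refine ⟨?_, Fin.is_lt _⟩
      by_contra hcon
      have := (splitPerms_lt_iff (mem_splitFinset.1 hπ) k ⟨i, hin⟩).1 (not_le.1 hcon)
      simp only at this
      omega
    · intro π _
      have hm := (mle_spec hn (f₀ k) (f₁ k) (fun i => x k (π k i))).1
      exact ⟨_, hm.2, log_likelihood_perm_sub_le (h₀ k) (h₁ k) (π k) hm.2 (hy k)⟩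
  -- Permutations counted by the p-value have total truncated excess at least `T`, so Markov's
  -- inequality applies.
  have hbad : ∀ π ∈ G.filter fun π => oracleScore f₀ f₁ (permute π x) t ≤ oracleScore f₀ f₁ x t,
      T ≤ ∑ k, tpos T (F k π + c * τ / 8 * |(t k : ℝ) - ξ k|) := by
    intro π hπ
    rw [Finset.mem_filter] at hπ
    have hmem := mem_splitFinset.1 hπ.1
    have hsum : 0 ≤ ∑ k, F k π := by
      have e : ∀ z : (k : Fin K) → Fin n → 𝒳 k, (∀ k i, 0 < f₀ k (z k i)) →
          (∀ k i, 0 < f₁ k (z k i)) → oracleScore f₀ f₁ z t =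
            ∑ k, (Real.log (likelihood (f₀ k) (f₁ k) (z k) (t k)) - Mx k (z k)) := by
        intro z hz₀ hz₁
        refine Finset.sum_congr rfl fun k _ => ?_
        exact Real.log_div (likelihood_pos (hz₀ k) (hz₁ k) _).ne'
          (likelihood_pos (hz₀ k) (hz₁ k) _).ne'
      have hle := hπ.2
      rw [e x h₀ h₁, e (permute π x) (fun k i => h₀ k _) (fun k i => h₁ k _)] at hle
      have e3 : ∀ k, likelihood (f₀ k) (f₁ k) (permute π x k) (t k) =
          likelihood (f₀ k) (f₁ k) (x k) (t k) :=
        fun k => likelihood_comp_perm (π k) fun i => splitPerms_lt_iff hmem k i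
      simp only [e3, Finset.sum_sub_distrib] at hle
      -- The terms at `t` cancel in the score comparison; what remains compares maximised
      -- likelihoods, and the original maximum is at least the value at the true `ξ`.
      have hml : ∑ k, Real.log (likelihood (f₀ k) (f₁ k) (x k) (ξ k)) ≤ ∑ k, Mx k (x k) := by
        refine Finset.sum_le_sum fun k _ => ?_
        exact Real.log_le_log (likelihood_pos (h₀ k) (h₁ k) _)
          ((mle_spec hn (f₀ k) (f₁ k) (x k)).2 _ (hξ1 k))
      have e4 : ∑ k, F k π = ∑ k, Mx k (permute π x k) -
          ∑ k, Real.log (likelihood (f₀ k) (f₁ k) (x k) (ξ k)) := by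
        rw [← Finset.sum_sub_distrib]; rfl
      rw [e4]
      linarith
    have hbig : T ≤ ∑ k, max (F k π + c * τ / 8 * |(t k : ℝ) - ξ k|) 0 := by
      calc T ≤ ∑ k, (F k π + c * τ / 8 * |(t k : ℝ) - ξ k|) := by
            rw [Finset.sum_add_distrib, ← Finset.mul_sum]; linarith
        _ ≤ _ := Finset.sum_le_sum fun k _ => le_max_left _ _
    -- Either one summand alone reaches `T`, or truncation is inactive in every stream.
    by_cases hex : ∃ k, T ≤ max (F k π + c * τ / 8 * |(t k : ℝ) - ξ k|) 0
    · obtain ⟨k, hk⟩ := hex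
      calc T = tpos T (F k π + c * τ / 8 * |(t k : ℝ) - ξ k|) := (min_eq_left hk).symm
        _ ≤ _ := Finset.single_le_sum (f := fun k => tpos T (F k π + c * τ / 8 * |(t k : ℝ) - ξ k|))
            (fun k _ => tpos_nonneg hT0.le _) (Finset.mem_univ k)
    · push Not at hex
      refine hbig.trans (le_of_eq (Finset.sum_congr rfl fun k _ => ?_))
      exact (min_eq_right (hex k).le).symm
  have hGpos : (0 : ℝ) < G.card := by exact_mod_cast splitFinset_card_pos t
  rw [configPValue_eq, div_le_div_iff₀ hGpos hT0]
  calc ((G.filter fun π => oracleScore f₀ f₁ (permute π x) t ≤ oracleScore f₀ f₁ x t).card : ℝ) * T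
      = ∑ π ∈ G.filter (fun π => oracleScore f₀ f₁ (permute π x) t ≤ oracleScore f₀ f₁ x t), T := by
        simp
    _ ≤ ∑ π ∈ G.filter (fun π => oracleScore f₀ f₁ (permute π x) t ≤ oracleScore f₀ f₁ x t),
          ∑ k, tpos T (F k π + c * τ / 8 * |(t k : ℝ) - ξ k|) := Finset.sum_le_sum hbad
    _ ≤ ∑ π ∈ G, ∑ k, tpos T (F k π + c * τ / 8 * |(t k : ℝ) - ξ k|) :=
        Finset.sum_le_sum_of_subset_of_nonneg (Finset.filter_subset _ _)
          fun π _ _ => Finset.sum_nonneg fun k _ => tpos_nonneg hT0.le _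
    _ = ∑ k, ∑ π ∈ G, tpos T (F k π + c * τ / 8 * |(t k : ℝ) - ξ k|) := Finset.sum_comm
    _ ≤ ∑ k, G.card * streamBound c τ n (ξ k) p (y k) := Finset.sum_le_sum fun k _ => hstream k
    _ = (∑ k, streamBound c τ n (ξ k) p (y k)) * G.card := by
        rw [← Finset.mul_sum, mul_comm]

theorem configPValue_le_one (S : ((k : Fin K) → Fin n → 𝒳 k) → (Fin K → ℕ) → ℝ)
    (x : (k : Fin K) → Fin n → 𝒳 k) (t : Fin K → ℕ) : configPValue S x t ≤ 1 := by
  classical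
  rw [configPValue_eq]
  exact div_le_one_of_le₀ (by exact_mod_cast Finset.card_filter_le _ _) (Nat.cast_nonneg _)

theorem configPValue_le_rootPValue {R : Set (Fin K → ℕ)}
    (S : ((k : Fin K) → Fin n → 𝒳 k) → (Fin K → ℕ) → ℝ) (x : (k : Fin K) → Fin n → 𝒳 k)
    {t : Fin K → ℕ} (ht : t ∈ R) {k : Fin K} (hk : IsRoot t k) :
    configPValue S x t ≤ rootPValue R S x k := by
  refine le_ciSup (f := fun t : rootConfigs R k => configPValue S x t) ⟨1, ?_⟩ ⟨t, ht, hk⟩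
  rintro _ ⟨s, rfl⟩
  exact configPValue_le_one S x s

theorem permute_permute (σ π : Fin K → Equiv.Perm (Fin n)) (x : (k : Fin K) → Fin n → 𝒳 k) :
    permute σ (permute π x) = permute (π * σ) x := rfl

open Classical in
/-- Among the split permutations of an array, a proportion of at most `α` have a conformal
`p`-value of at most `α`. -/
theorem card_configPValue_le (S : ((k : Fin K) → Fin n → 𝒳 k) → (Fin K → ℕ) → ℝ)
    (x : (k : Fin K) → Fin n → 𝒳 k) (t : Fin K → ℕ) {α : ℝ} (hα : 0 ≤ α) :
    (((splitFinset n t).filter fun π => configPValue S (permute π x) t ≤ α).card : ℝ) ≤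
      α * (splitFinset n t).card := by
  set G := splitFinset n t with hG
  have hGpos : (0 : ℝ) < G.card := by exact_mod_cast splitFinset_card_pos t
  -- By the group property all permuted arrays have the same orbit, so each p-value is a normalised
  -- rank within one fixed list of scores.
  have hrank : ∀ π ∈ G, configPValue S (permute π x) t =
      ((G.filter fun ρ => S (permute ρ x) t ≤ S (permute π x) t).card : ℝ) / G.card := by
    intro π hπ
    have hπ' := mem_splitFinset.1 hπ
    rw [configPValue_eq]
    congr 2
    refine Finset.card_nbij' (fun σ => π * σ) (fun ρ => π⁻¹ * ρ) ?_ ?_ ?_ ?_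
    · intro σ hσ
      simp only [Finset.coe_filter, Set.mem_ofPred_eq, mem_splitFinset, hG] at hσ ⊢
      exact ⟨mul_mem_splitPerms hπ' hσ.1, hσ.2⟩
    · intro ρ hρ
      simp only [Finset.coe_filter, Set.mem_ofPred_eq, mem_splitFinset, hG] at hρ ⊢
      refine ⟨mul_mem_splitPerms (inv_mem_splitPerms hπ') hρ.1, ?_⟩
      rw [permute_permute, mul_inv_cancel_left]
      exact hρ.2
    · intro σ _; simp
    · intro ρ _; simp
  rcases (G.filter fun π => configPValue S (permute π x) t ≤ α).eq_empty_or_nonempty with he | hne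
  · rw [he]; simp; positivity
  -- Among the arrays with p-value at most `α`, take one of highest score: all the others score no
  -- more, so their number is bounded by its rank.
  · obtain ⟨π₀, h0, hmax⟩ := Finset.exists_max_image _ (fun π => S (permute π x) t) hne
    rw [Finset.mem_filter] at h0
    have h1 := h0.2
    rw [hrank π₀ h0.1, div_le_iff₀ hGpos] at h1
    refine le_trans ?_ h1
    norm_cast
    refine Finset.card_le_card fun π hπ => ?_
    exact Finset.mem_filter.2 ⟨(Finset.mem_filter.1 hπ).1, hmax π hπ⟩

end Permutations

/-! ### Measurability of scores and p-values. -/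

section Measurability

variable {K n : ℕ}

theorem measurable_likelihood {A : Type*} [MeasurableSpace A] {f₀ f₁ : A → ℝ}
    (h₀ : Measurable f₀) (h₁ : Measurable f₁) (t : ℕ) :
    Measurable fun x : Fin n → A => likelihood f₀ f₁ x t := by
  refine Finset.measurable_prod _ fun i _ => ?_
  split_ifs
  · exact h₀.comp (measurable_pi_apply i)
  · exact h₁.comp (measurable_pi_apply i)

/-- Only the maximal value enters the score, and it is a finite supremum of measurable functions;
the measurability of the maximiser is not needed. -/
theorem measurable_likelihood_mle {A : Type*} [MeasurableSpace A] {f₀ f₁ : A → ℝ}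
    (h₀ : Measurable f₀) (h₁ : Measurable f₁) (hn : 0 < n) :
    Measurable fun x : Fin n → A => likelihood f₀ f₁ x (mle f₀ f₁ x) := by
  have hne : (Finset.Icc 1 n).Nonempty := ⟨1, Finset.mem_Icc.2 ⟨le_rfl, hn⟩⟩
  have e : (fun x : Fin n → A => likelihood f₀ f₁ x (mle f₀ f₁ x)) =
      fun x => (Finset.Icc 1 n).sup' hne fun s => likelihood f₀ f₁ x s := by
    funext x
    obtain ⟨h1, h2⟩ := mle_spec hn f₀ f₁ x
    refine le_antisymm ?_ (Finset.sup'_le _ _ fun s hs => h2 s (Finset.mem_Icc.1 hs))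
    exact Finset.le_sup' (fun s => likelihood f₀ f₁ x s) (Finset.mem_Icc.2 h1)
  rw [e]
  have := Finset.measurable_sup' hne (f := fun s (x : Fin n → A) => likelihood f₀ f₁ x s)
    fun s _ => measurable_likelihood h₀ h₁ s
  convert this using 1
  funext x
  rw [Finset.sup'_apply]

variable {𝒳 : Fin K → Type*} [∀ k, MeasurableSpace (𝒳 k)]

theorem measurable_oracleScore {f₀ f₁ : (k : Fin K) → 𝒳 k → ℝ} (h₀ : ∀ k, Measurable (f₀ k))
    (h₁ : ∀ k, Measurable (f₁ k)) (hn : 0 < n) (t : Fin K → ℕ) :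
    Measurable fun x : (k : Fin K) → Fin n → 𝒳 k => oracleScore f₀ f₁ x t := by
  refine Finset.measurable_sum _ fun k _ => Real.measurable_log.comp (Measurable.div ?_ ?_)
  · exact (measurable_likelihood (h₀ k) (h₁ k) _).comp (measurable_pi_apply k)
  · exact (measurable_likelihood_mle (h₀ k) (h₁ k) hn).comp (measurable_pi_apply k)

theorem measurable_permute (π : Fin K → Equiv.Perm (Fin n)) :
    Measurable fun x : (k : Fin K) → Fin n → 𝒳 k => permute π x :=
  measurable_pi_lambda _ fun k => measurable_pi_lambda _ fun i =>
    (measurable_pi_apply (π k i)).comp (measurable_pi_apply k)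

theorem measurable_configPValue {S : ((k : Fin K) → Fin n → 𝒳 k) → (Fin K → ℕ) → ℝ}
    {t : Fin K → ℕ} (hS : Measurable fun x => S x t) :
    Measurable fun x => configPValue S x t := by
  classical
  have e : (fun x => configPValue S x t) = fun x =>
      (∑ π ∈ splitFinset n t, if S (permute π x) t ≤ S x t then (1 : ℝ) else 0) /
        (splitFinset n t).card := by
    funext x
    rw [configPValue_eq, Finset.sum_boole]
  rw [e]
  refine Measurable.div_const (Finset.measurable_sum _ fun π _ => ?_) _
  exact Measurable.ite (measurableSet_le (hS.comp (measurable_permute π)) hS) measurable_const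
    measurable_const

end Measurability

/-! ### Validity at the truth and small p-values at wrong roots. -/

section Model

variable {K n : ℕ} {𝒳 : Fin K → Type*} [∀ k, MeasurableSpace (𝒳 k)]
  {Ω : Type*} [MeasurableSpace Ω] {Pr : Measure Ω}
  {X : (k : Fin K) → Fin n → Ω → 𝒳 k} {P₀ P₁ : (k : Fin K) → Measure (𝒳 k)} {ξ : Fin K → ℕ}

/-- The law of the data array is invariant under the split permutations of the true changepoint
vector. -/
theorem IsIIDChangepointModel.measure_permute [IsProbabilityMeasure Pr]
    (h : IsIIDChangepointModel Pr X P₀ P₁ ξ)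
    {π : Fin K → Equiv.Perm (Fin n)} (hπ : π ∈ splitPerms n ξ)
    {B : Set ((k : Fin K) → Fin n → 𝒳 k)} (hB : MeasurableSet B) :
    Pr {ω | permute π (fun k i => X k i ω) ∈ B} = Pr {ω | (fun k i => X k i ω) ∈ B} := by
  set E : ((p : Fin K × Fin n) → 𝒳 p.1) → (k : Fin K) → Fin n → 𝒳 k := fun z k i => z (k, i)
    with hE
  have hEm : Measurable E := measurable_pi_lambda _ fun k => measurable_pi_lambda _ fun i =>
    measurable_pi_apply (k, i)
  have hm : ∀ p : Fin K × Fin n, Measurable (X p.1 p.2) := fun p => h.measurable _ _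
  have hm' : ∀ p : Fin K × Fin n, Measurable (X p.1 (π p.1 p.2)) := fun p => h.measurable _ _
  have hinj : Function.Injective fun p : Fin K × Fin n => (p.1, π p.1 p.2) := by
    rintro ⟨k, i⟩ ⟨k', i'⟩ hp
    simp only [Prod.mk.injEq] at hp
    obtain ⟨rfl, h2⟩ := hp
    rw [(π k).injective h2]
  have hind' : iIndepFun (fun p : Fin K × Fin n => X p.1 (π p.1 p.2)) Pr :=
    h.indep.precomp hinj
  have e1 := (iIndepFun_iff_map_fun_eq_pi_map fun p => (hm p).aemeasurable).1 h.indep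
  have e2 := (iIndepFun_iff_map_fun_eq_pi_map fun p => (hm' p).aemeasurable).1 hind'
  have e3 : ∀ p : Fin K × Fin n, Pr.map (X p.1 (π p.1 p.2)) = Pr.map (X p.1 p.2) := by
    intro p
    rw [h.law, h.law]
    simp only [splitPerms_lt_iff hπ p.1 p.2]
  simp only [e3] at e2
  have e4 := e2.trans e1.symm
  have hEB := hEm hB
  have a1 : Pr.map (fun ω (p : Fin K × Fin n) => X p.1 (π p.1 p.2) ω) (E ⁻¹' B) =
      Pr {ω | permute π (fun k i => X k i ω) ∈ B} :=
    Measure.map_apply (measurable_pi_lambda _ hm') hEB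
  have a2 : Pr.map (fun ω (p : Fin K × Fin n) => X p.1 p.2 ω) (E ⁻¹' B) =
      Pr {ω | (fun k i => X k i ω) ∈ B} :=
    Measure.map_apply (measurable_pi_lambda _ hm) hEB
  rw [← a1, ← a2, e4]

/-- Validity of the conformal `p`-value at the true changepoint vector. -/
theorem IsIIDChangepointModel.measure_configPValue_le [IsProbabilityMeasure Pr]
    (h : IsIIDChangepointModel Pr X P₀ P₁ ξ)
    {S : ((k : Fin K) → Fin n → 𝒳 k) → (Fin K → ℕ) → ℝ} (hS : Measurable fun x => S x ξ)
    {α : ℝ} (hα : 0 ≤ α) :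
    Pr {ω | configPValue S (fun k i => X k i ω) ξ ≤ α} ≤ ENNReal.ofReal α := by
  classical
  set G := splitFinset n ξ with hG
  set B : Set ((k : Fin K) → Fin n → 𝒳 k) := {x | configPValue S x ξ ≤ α} with hBdef
  have hB : MeasurableSet B := measurableSet_le (measurable_configPValue hS) measurable_const
  have hXm : Measurable fun ω k i => X k i ω :=
    measurable_pi_lambda _ fun k => measurable_pi_lambda _ fun i => h.measurable k i
  have hA : ∀ π : Fin K → Equiv.Perm (Fin n),
      MeasurableSet {ω | permute π (fun k i => X k i ω) ∈ B} := fun π =>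
    ((measurable_permute π).comp hXm) hB
  -- The counting bound holds for every outcome; integrating it and using that all summands have the
  -- same probability gives the claim.
  have hsum : ∑ π ∈ G, Pr {ω | permute π (fun k i => X k i ω) ∈ B} ≤
      ENNReal.ofReal (α * G.card) := by
    calc ∑ π ∈ G, Pr {ω | permute π (fun k i => X k i ω) ∈ B}
        = ∑ π ∈ G, ∫⁻ ω, Set.indicator {ω | permute π (fun k i => X k i ω) ∈ B} 1 ω ∂Pr :=
          Finset.sum_congr rfl fun π _ => (lintegral_indicator_one (hA π)).symm
      _ = ∫⁻ ω, ∑ π ∈ G, Set.indicator {ω | permute π (fun k i => X k i ω) ∈ B} 1 ω ∂Pr :=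
          (lintegral_finsetSum _ fun π _ => measurable_one.indicator (hA π)).symm
      _ ≤ ∫⁻ _, ENNReal.ofReal (α * G.card) ∂Pr := by
          refine lintegral_mono fun ω => ?_
          have hc := card_configPValue_le S (fun k i => X k i ω) ξ hα
          simp only [Set.indicator_apply, Set.mem_ofPred_eq, Pi.one_apply]
          rw [Finset.sum_boole, ← ENNReal.ofReal_natCast]
          exact ENNReal.ofReal_le_ofReal hc
      _ = _ := by simp
  rw [Finset.sum_congr rfl fun π hπ => h.measure_permute (mem_splitFinset.1 hπ) hB,
    Finset.sum_const, nsmul_eq_mul, ENNReal.ofReal_mul hα, ENNReal.ofReal_natCast,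
    mul_comm] at hsum
  have hG0 : (G.card : ℝ≥0∞) ≠ 0 := by
    exact_mod_cast (splitFinset_card_pos ξ).ne'
  exact (ENNReal.mul_le_mul_iff_left hG0 (ENNReal.natCast_ne_top _)).1 hsum

/-- The sign-corrected and centred log-likelihood ratios of stream `k`. -/
noncomputable def noise (X : (k : Fin K) → Fin n → Ω → 𝒳 k) (P₀ P₁ : (k : Fin K) → Measure (𝒳 k))
    (ξ : Fin K → ℕ) (f₀ f₁ : (k : Fin K) → 𝒳 k → ℝ) (k : Fin K) (i : Fin n) (ω : Ω) : ℝ :=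
  if (i : ℕ) < ξ k then ∫ x, logLR (f₀ k) (f₁ k) x ∂(P₀ k) - logLR (f₀ k) (f₁ k) (X k i ω)
  else logLR (f₀ k) (f₁ k) (X k i ω) - ∫ x, logLR (f₀ k) (f₁ k) x ∂(P₁ k)

theorem IsIIDChangepointModel.isNoise [∀ k, IsProbabilityMeasure (P₀ k)]
    [∀ k, IsProbabilityMeasure (P₁ k)] (h : IsIIDChangepointModel Pr X P₀ P₁ ξ)
    {f₀ f₁ : (k : Fin K) → 𝒳 k → ℝ} {k : Fin K} (hl : Measurable (logLR (f₀ k) (f₁ k))) {v : ℝ}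
    (hm₀ : MemLp (logLR (f₀ k) (f₁ k)) 2 (P₀ k)) (hv₀ : variance (logLR (f₀ k) (f₁ k)) (P₀ k) ≤ v)
    (hm₁ : MemLp (logLR (f₀ k) (f₁ k)) 2 (P₁ k)) (hv₁ : variance (logLR (f₀ k) (f₁ k)) (P₁ k) ≤ v) :
    IsNoise Pr (noise X P₀ P₁ ξ f₀ f₁ k) v := by
  set l := logLR (f₀ k) (f₁ k) with hldef
  set φ : Fin n → 𝒳 k → ℝ := fun i x =>
    if (i : ℕ) < ξ k then ∫ x, l x ∂(P₀ k) - l x else l x - ∫ x, l x ∂(P₁ k) with hφ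
  have hφm : ∀ i, Measurable (φ i) := by
    intro i
    by_cases hi : (i : ℕ) < ξ k
    · simp only [hφ, if_pos hi]; exact measurable_const.sub hl
    · simp only [hφ, if_neg hi]; exact hl.sub_const _
  have hnoise : ∀ i, noise X P₀ P₁ ξ f₀ f₁ k i = φ i ∘ X k i := fun i => rfl
  have hlaw := h.law k
  have key : ∀ i, MemLp (φ i) 2 (Pr.map (X k i)) ∧ ∫ x, φ i x ∂(Pr.map (X k i)) = 0 ∧
      ∫ x, φ i x ^ 2 ∂(Pr.map (X k i)) ≤ v := by
    intro i
    rw [hlaw i]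
    by_cases hi : (i : ℕ) < ξ k
    · simp only [hφ, if_pos hi]
      refine ⟨(memLp_const _).sub hm₀, ?_, ?_⟩
      · rw [integral_sub (integrable_const _) (hm₀.integrable (by norm_num))]; simp
      · rw [variance_eq_integral hl.aemeasurable] at hv₀
        refine le_trans (le_of_eq ?_) hv₀
        congr 1; funext x; ring
    · simp only [hφ, if_neg hi]
      refine ⟨hm₁.sub (memLp_const _), ?_, ?_⟩
      · rw [integral_sub (hm₁.integrable (by norm_num)) (integrable_const _)]; simp
      · rwa [variance_eq_integral hl.aemeasurable] at hv₁
  have hXm := h.measurable k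
  refine ⟨fun i => (hφm i).comp (hXm i), ?_, fun i => ?_, fun i => ?_, fun i => ?_⟩
  · have h1 : iIndepFun (fun i : Fin n => X k i) Pr :=
      h.indep.precomp (g := fun i : Fin n => (k, i)) fun i j hij => (Prod.mk.inj hij).2
    exact h1.comp φ hφm
  · exact (key i).1.comp_of_map (hXm i).aemeasurable
  · rw [← (key i).2.1, integral_map (hXm i).aemeasurable (hφm i).aestronglyMeasurable]
    rfl
  · refine le_trans (le_of_eq ?_) (key i).2.2
    rw [integral_map (hXm i).aemeasurable ((hφm i).pow_const 2).aestronglyMeasurable]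
    rfl

theorem IsIIDChangepointModel.ae_pos (h : IsIIDChangepointModel Pr X P₀ P₁ ξ)
    {f : (k : Fin K) → 𝒳 k → ℝ} (hf₀ : ∀ k, ∀ᵐ x ∂(P₀ k), 0 < f k x)
    (hf₁ : ∀ k, ∀ᵐ x ∂(P₁ k), 0 < f k x) : ∀ᵐ ω ∂Pr, ∀ k i, 0 < f k (X k i ω) := by
  rw [ae_all_iff]; intro k
  rw [ae_all_iff]; intro i
  have : ∀ᵐ x ∂(Pr.map (X k i)), 0 < f k x := by
    rw [h.law k i]
    split_ifs
    exacts [hf₀ k, hf₁ k]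
  exact ae_of_ae_map (h.measurable k i).aemeasurable this

/-- The `p`-values of the streams other than the root cause are small in probability. -/
theorem IsIIDChangepointModel.measure_iSup_rootPValue_le [IsProbabilityMeasure Pr]
    [∀ k, IsProbabilityMeasure (P₀ k)]
    [∀ k, IsProbabilityMeasure (P₁ k)] (h : IsIIDChangepointModel Pr X P₀ P₁ ξ) (hn : 0 < n)
    {μ : (k : Fin K) → Measure (𝒳 k)} {f₀ f₁ : (k : Fin K) → 𝒳 k → ℝ}
    (hf₀ : ∀ k, IsDensity (P₀ k) (μ k) (f₀ k)) (hf₁ : ∀ k, IsDensity (P₁ k) (μ k) (f₁ k))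
    (hac : ∀ k, P₀ k ≪ P₁ k ∧ P₁ k ≪ P₀ k) {v : ℝ} (hv : 0 ≤ v)
    (hm₀ : ∀ k, MemLp (logLR (f₀ k) (f₁ k)) 2 (P₀ k) ∧ variance (logLR (f₀ k) (f₁ k)) (P₀ k) ≤ v)
    (hm₁ : ∀ k, MemLp (logLR (f₀ k) (f₁ k)) 2 (P₁ k) ∧ variance (logLR (f₀ k) (f₁ k)) (P₁ k) ≤ v)
    {c τ : ℝ} (hc : 0 < c) (hc1 : c ≤ 1) (hτ : 0 < τ) (hτ1 : τ ≤ 1)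
    (hc₀ : ∀ k, c ≤ ∫ x, logLR (f₀ k) (f₁ k) x ∂(P₀ k))
    (hc₁ : ∀ k, c ≤ - ∫ x, logLR (f₀ k) (f₁ k) x ∂(P₁ k))
    {R : Set (Fin K → ℕ)} (hR : ∀ t ∈ R, ∀ k, t k ∈ Set.Icc 1 n)
    (hξ1 : ∀ k, ξ k ∈ Set.Icc 1 n) (hξ : ∀ k, τ * n ≤ ξ k) (hξ' : ∀ k, τ * n ≤ (n : ℝ) - ξ k)
    (ks : Fin K) {p : ℕ}
    (hp : (2 : ℝ) ^ p ≤ c * τ / 8 * ⨅ j : {j : Fin K // j ≠ ks}, ((ξ j : ℝ) - ξ ks))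
    {ε : ℝ} (hε : 0 < ε) :
    Pr {ω | ε ≤ ⨆ k : {k : Fin K // k ≠ ks},
      rootPValue R (oracleScore f₀ f₁) (fun j i => X j i ω) k} ≤
      ENNReal.ofReal (streamConst c τ v / ε * (K * (p + 2) / 2 ^ p)) := by
  set T : ℝ := 2 ^ p with hT
  have hT0 : 0 < T := by positivity
  have hκ : 0 < c * τ / 8 := by positivity
  set Ψ : Ω → ℝ := fun ω =>
    ∑ k, streamBound c τ n (ξ k) p (zeroExt fun i => noise X P₀ P₁ ξ f₀ f₁ k i ω) with hΨ
  have hΨ0 : ∀ ω, 0 ≤ Ψ ω := fun ω => Finset.sum_nonneg fun k _ => streamBound_nonneg hc hτ _ _ _ _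
  have hN : ∀ k, IsNoise Pr (noise X P₀ P₁ ξ f₀ f₁ k) v := fun k =>
    h.isNoise ((hf₀ k).measurable_logLR (hf₁ k)) (hm₀ k).1 (hm₀ k).2 (hm₁ k).1 (hm₁ k).2
  have hint : Integrable Ψ Pr :=
    integrable_finsetSum _ fun k _ => (hN k).integrable_streamBound c τ (ξ k) p
  have hΨle : ∫ ω, Ψ ω ∂Pr ≤ K * (streamConst c τ v * (p + 2)) := by
    rw [hΨ, integral_finsetSum _ fun k _ => (hN k).integrable_streamBound c τ (ξ k) p]
    refine (Finset.sum_le_sum fun k _ =>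
      (hN k).integral_streamBound_le hv hc hτ (hξ1 k).2 hn p).trans ?_
    simp
  have hpos₀ := h.ae_pos (f := f₀) (fun k => (hf₀ k).ae_ne_zero)
    fun k => (hac k).2.ae_le (hf₀ k).ae_ne_zero
  have hpos₁ := h.ae_pos (f := f₁) (fun k => (hac k).1.ae_le (hf₁ k).ae_ne_zero)
    fun k => (hf₁ k).ae_ne_zero
  -- The bound `Ψ ω / T` involves neither `k` nor `t`, so it passes to both suprema. Its
  -- nonnegativity covers empty index sets, where the real supremum is `0`.
  have hsub : ∀ᵐ ω ∂Pr, (⨆ k : {k : Fin K // k ≠ ks},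
      rootPValue R (oracleScore f₀ f₁) (fun j i => X j i ω) k) ≤ Ψ ω / T := by
    filter_upwards [hpos₀, hpos₁] with ω h0 h1
    have hq : 0 ≤ Ψ ω / T := div_nonneg (hΨ0 ω) hT0.le
    refine Real.iSup_le (fun k => ?_) hq
    refine Real.iSup_le (fun t => ?_) hq
    obtain ⟨t, htR, htroot⟩ := t
    refine configPValue_le hn h0 h1 (hR t htR) hξ1 hc hc1 hτ hτ1 hξ hξ' ?_ ?_
    · intro j i
      rw [zeroExt_of_lt _ i.2]
      simp only [noise]
      have := hc₀ j
      have := hc₁ j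
      split_ifs <;> linarith
    · refine hp.trans (mul_le_mul_of_nonneg_left ?_ hκ.le)
      have hk : (k : Fin K) ≠ ks := k.2
      have h1 : (⨅ j : {j : Fin K // j ≠ ks}, ((ξ j : ℝ) - ξ ks)) ≤ (ξ k : ℝ) - ξ ks :=
        ciInf_le (Set.finite_range _).bddBelow k
      have h2 : (t k : ℝ) ≤ t ks := by exact_mod_cast (htroot ks hk.symm).le
      -- Reversing the order of the changepoints `k` and `ks` takes a displacement of at least their
      -- separation in these two streams together.
      have h3 : |(t k : ℝ) - ξ k| + |(t ks : ℝ) - ξ ks| ≤ ∑ j, |(t j : ℝ) - ξ j| := by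
        rw [← Finset.sum_pair (f := fun j => |(t j : ℝ) - ξ j|) hk]
        exact Finset.sum_le_sum_of_subset_of_nonneg (Finset.subset_univ _)
          fun _ _ _ => abs_nonneg _
      have h4 := neg_abs_le ((t k : ℝ) - ξ k)
      have h5 := le_abs_self ((t ks : ℝ) - ξ ks)
      linarith
  have hmk := mul_meas_ge_le_integral_of_nonneg (Eventually.of_forall hΨ0) hint (ε * T)
  have hle : Pr {ω | ε ≤ ⨆ k : {k : Fin K // k ≠ ks},
      rootPValue R (oracleScore f₀ f₁) (fun j i => X j i ω) k} ≤ Pr {ω | ε * T ≤ Ψ ω} := by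
    refine measure_mono_ae ?_
    filter_upwards [hsub] with ω hω hmem
    have hmem' : ε ≤ ⨆ k : {k : Fin K // k ≠ ks},
      rootPValue R (oracleScore f₀ f₁) (fun j i => X j i ω) k := hmem
    exact (le_div_iff₀ hT0).1 (hmem'.trans hω)
  refine hle.trans ?_
  rw [← ofReal_measureReal]
  refine ENNReal.ofReal_le_ofReal ?_
  have := hmk.trans hΨle
  rw [← le_div_iff₀' (by positivity)] at this
  refine this.trans (le_of_eq ?_)
  field_simp

end Model

/-! ### Choice of the truncation level. -/

section Asymptotics

/-- Dyadic truncation levels `2 ^ p ≤ κ D` that dominate `K (p + 2)` when `D ≫ K log K`. -/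
theorem exists_truncation_levels {K : ℕ → ℕ} (hK : Tendsto K atTop atTop) {D : ℕ → ℝ} {κ : ℝ}
    (hκ : 0 < κ)
    (hD : Tendsto (fun n => D n / ((K n : ℝ) * Real.log (K n : ℝ))) atTop atTop) :
    ∃ p : ℕ → ℕ, (∀ᶠ n in atTop, (2 : ℝ) ^ p n ≤ κ * D n) ∧
      Tendsto (fun n => (K n : ℝ) * (p n + 2) / 2 ^ p n) atTop (𝓝 0) := by
  set r : ℕ → ℝ := fun n => κ * (D n / ((K n : ℝ) * Real.log (K n : ℝ))) with hr
  have hr' : Tendsto r atTop atTop := hD.const_mul_atTop hκ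
  have hlogK : Tendsto (fun n => Real.log (K n : ℝ)) atTop atTop :=
    Real.tendsto_log_atTop.comp (tendsto_natCast_atTop_atTop.comp hK)
  -- The largest power of two not exceeding `κ D`, so that `κ D / 2 ≤ 2 ^ p ≤ κ D` eventually.
  refine ⟨fun n => Nat.log 2 ⌊κ * D n⌋₊, ?_, ?_⟩
  all_goals
    have hev : ∀ᶠ n in atTop, 1 ≤ r n ∧ 1 ≤ Real.log (K n : ℝ) ∧ 1 ≤ K n :=
      (hr'.eventually_ge_atTop 1).and
        ((hlogK.eventually_ge_atTop 1).and (hK.eventually_ge_atTop 1))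
    have hx : ∀ n, 1 ≤ r n ∧ 1 ≤ Real.log (K n : ℝ) ∧ 1 ≤ K n →
        κ * D n = r n * (K n * Real.log (K n)) ∧ 1 ≤ κ * D n := by
      rintro n ⟨h1, h2, h3⟩
      have h3' : (1 : ℝ) ≤ K n := by exact_mod_cast h3
      have e : κ * D n = r n * (K n * Real.log (K n)) := by
        rw [hr]
        have : (K n : ℝ) * Real.log (K n) ≠ 0 := by positivity
        field_simp
      refine ⟨e, ?_⟩
      rw [e]
      exact one_le_mul_of_one_le_of_one_le h1 (one_le_mul_of_one_le_of_one_le h3' h2)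
  · filter_upwards [hev] with n hn
    have hx1 := (hx n hn).2
    have hfl : 1 ≤ ⌊κ * D n⌋₊ := Nat.one_le_floor_iff _ |>.2 hx1
    calc (2 : ℝ) ^ Nat.log 2 ⌊κ * D n⌋₊ ≤ (⌊κ * D n⌋₊ : ℝ) := by
          exact_mod_cast Nat.pow_log_le_self 2 (by omega)
      _ ≤ κ * D n := Nat.floor_le (by linarith)
  · have hlim : Tendsto (fun n => 4 * (Real.log (r n) / r n) + 12 * (r n)⁻¹) atTop (𝓝 0) := by
      have h1 : Tendsto (fun x : ℝ => Real.log x / x) atTop (𝓝 0) := by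
        simpa using Real.isLittleO_log_id_atTop.tendsto_div_nhds_zero
      have := ((h1.comp hr').const_mul 4).add ((tendsto_inv_atTop_zero.comp hr').const_mul 12)
      simpa using this
    refine squeeze_zero' (Eventually.of_forall fun n => by positivity) ?_ hlim
    clear_value r
    filter_upwards [hev] with n hn
    obtain ⟨e, hx1⟩ := hx n hn
    obtain ⟨h1, h2, h3⟩ := hn
    have h3' : (1 : ℝ) ≤ K n := by exact_mod_cast h3
    set x := κ * D n with hxdef
    set p := Nat.log 2 ⌊x⌋₊ with hp
    have hfl : 1 ≤ ⌊x⌋₊ := Nat.one_le_floor_iff _ |>.2 hx1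
    have hlow : x / 2 ≤ 2 ^ p := by
      have a1 : ⌊x⌋₊ + 1 ≤ 2 ^ (p + 1) := Nat.lt_pow_succ_log_self (by norm_num) _
      have a2 : x < ⌊x⌋₊ + 1 := Nat.lt_floor_add_one x
      have a3 : ((⌊x⌋₊ + 1 : ℕ) : ℝ) ≤ ((2 ^ (p + 1) : ℕ) : ℝ) := by exact_mod_cast a1
      push_cast at a3
      rw [pow_succ] at a3
      linarith
    have hup : (2 : ℝ) ^ p ≤ x := by
      calc (2 : ℝ) ^ p ≤ (⌊x⌋₊ : ℝ) := by exact_mod_cast Nat.pow_log_le_self 2 (by omega)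
        _ ≤ x := Nat.floor_le (by linarith)
    have hplog : (p : ℝ) ≤ 2 * Real.log x := by
      have a1 := Real.log_le_log (by positivity) hup
      rw [Real.log_pow] at a1
      have a2 := Real.log_two_gt_d9
      have a3 : (0 : ℝ) ≤ p := Nat.cast_nonneg p
      nlinarith
    set lK := Real.log (K n : ℝ) with hlK
    have hr0 : 0 < r n := by linarith
    -- With `x = r K log K`, the logarithm of `log K` is absorbed into a second `log K`. Dividing `K
    -- log x` by `x` then leaves terms of order `(log r) / r` and `1 / r`.
    have hlogx : Real.log x ≤ Real.log (r n) + 2 * lK := by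
      have hK0 : (K n : ℝ) ≠ 0 := by positivity
      have hl0 : lK ≠ 0 := by positivity
      rw [e, Real.log_mul hr0.ne' (mul_ne_zero hK0 hl0), Real.log_mul hK0 hl0]
      have := Real.log_le_self (show 0 ≤ lK by linarith)
      linarith
    have hlr : 0 ≤ Real.log (r n) := Real.log_nonneg h1
    calc (K n : ℝ) * (p + 2) / 2 ^ p ≤ K n * (2 * (Real.log (r n) + 2 * lK) + 2) / (x / 2) := by
          gcongr
          linarith
      _ = (4 * (Real.log (r n) / lK) + 8 + 4 / lK) / r n := by
          rw [e]; field_simp; ring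
      _ ≤ (4 * Real.log (r n) + 8 + 4) / r n := by
          gcongr
          · exact div_le_self hlr h2
          · exact div_le_self (by norm_num) h2
      _ = 4 * (Real.log (r n) / r n) + 12 * (r n)⁻¹ := by field_simp; ring

end Asymptotics

/-- A uniform lower bound for both divergences, from a uniform lower bound for the Jeffreys
divergences and uniformly bounded variances. -/
theorem exists_pos_le_integral_logLR {𝒳 : ℕ → Type*} [∀ j, MeasurableSpace (𝒳 j)]
    {P₀ P₁ : (j : ℕ) → Measure (𝒳 j)}
    [∀ j, IsProbabilityMeasure (P₀ j)] [∀ j, IsProbabilityMeasure (P₁ j)]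
    {μ : (j : ℕ) → Measure (𝒳 j)} {f₀ f₁ : (j : ℕ) → 𝒳 j → ℝ}
    (hf₀ : ∀ j, IsDensity (P₀ j) (μ j) (f₀ j)) (hf₁ : ∀ j, IsDensity (P₁ j) (μ j) (f₁ j))
    (hKL : ∀ j, klDiv (P₀ j) (P₁ j) < ∞ ∧ klDiv (P₁ j) (P₀ j) < ∞)
    (hJ : 0 < ⨅ j, (klDiv (P₀ j) (P₁ j) + klDiv (P₁ j) (P₀ j))) {v : ℝ} (hv : 0 ≤ v)
    (hvar₀ : ∀ j, MemLp (logLR (f₀ j) (f₁ j)) 2 (P₀ j) ∧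
      variance (logLR (f₀ j) (f₁ j)) (P₀ j) ≤ v)
    (hvar₁ : ∀ j, MemLp (logLR (f₀ j) (f₁ j)) 2 (P₁ j) ∧
      variance (logLR (f₀ j) (f₁ j)) (P₁ j) ≤ v) :
    ∃ c : ℝ, 0 < c ∧ c ≤ 1 ∧ (∀ j, c ≤ ∫ x, logLR (f₀ j) (f₁ j) x ∂(P₀ j)) ∧
      ∀ j, c ≤ - ∫ x, logLR (f₀ j) (f₁ j) x ∂(P₁ j) := by
  set I := ⨅ j, (klDiv (P₀ j) (P₁ j) + klDiv (P₁ j) (P₀ j)) with hI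
  -- Capping at `1` guarantees a finite value before passing to the reals.
  set J : ℝ := (min I 1).toReal with hJdef
  have hne : min I 1 ≠ ∞ := ne_top_of_le_ne_top ENNReal.one_ne_top (min_le_right _ _)
  have hJ0 : 0 < J := ENNReal.toReal_pos (lt_min hJ one_pos).ne' hne
  have hle : ∀ j, ENNReal.ofReal J ≤ klDiv (P₀ j) (P₁ j) + klDiv (P₁ j) (P₀ j) := by
    intro j
    rw [hJdef, ENNReal.ofReal_toReal hne]
    exact (min_le_left _ _).trans (iInf_le _ j)
  have hswap : ∀ j, logLR (f₁ j) (f₀ j) = - logLR (f₀ j) (f₁ j) := fun j =>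
    funext fun x => logLR_swap _ _ x
  refine ⟨J ^ 2 / (4 * v + J ^ 2), by positivity, ?_, fun j => ?_, fun j => ?_⟩
  · exact div_le_one_of_le₀ (by linarith) (by positivity)
  · exact (hf₀ j).le_integral_logLR (hf₁ j) (hKL j).1.ne (hKL j).2.ne hJ0 (hle j)
      (hvar₀ j).1 (hvar₀ j).2 (hvar₁ j).1 (hvar₁ j).2
  · have h := (hf₁ j).le_integral_logLR (hf₀ j) (hKL j).2.ne (hKL j).1.ne (v := v) hJ0
      (by rw [add_comm]; exact hle j)
      (by rw [hswap]; exact (hvar₁ j).1.neg) (by rw [hswap, variance_neg]; exact (hvar₁ j).2)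
      (by rw [hswap]; exact (hvar₀ j).1.neg) (by rw [hswap, variance_neg]; exact (hvar₀ j).2)
    rw [← integral_neg]
    rw [hswap] at h
    exact h

/-- The confidence set is the root cause alone if the other streams are rejected and the true
changepoint vector is accepted. -/
theorem confidenceSet_eq_singleton {K n : ℕ} {𝒳 : Fin K → Type*} {R : Set (Fin K → ℕ)}
    {S : ((k : Fin K) → Fin n → 𝒳 k) → (Fin K → ℕ) → ℝ} {α : ℝ} {x : (k : Fin K) → Fin n → 𝒳 k}
    {ξ : Fin K → ℕ} (hξ : ξ ∈ R) {ks : Fin K} (hks : IsRoot ξ ks)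
    (h₁ : ⨆ k : {k : Fin K // k ≠ ks}, rootPValue R S x k < α) (h₂ : α < configPValue S x ξ) :
    confidenceSet R S α x = {ks} := by
  ext k
  simp only [confidenceSet, Set.mem_ofPred_eq, Set.mem_singleton_iff]
  constructor
  · intro hk
    by_contra hne
    have := le_ciSup (f := fun k : {k : Fin K // k ≠ ks} => rootPValue R S x k)
      (Set.finite_range _).bddAbove ⟨k, hne⟩
    exact absurd (hk.trans_le this) (not_lt.2 h₁.le)
  · rintro rfl
    exact h₂.trans_le (configPValue_le_rootPValue S x hξ hks)

end CROC

/-! ### The main theorem. -/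

theorem theorem5
    -- the streams: sample spaces, pre- and post-change laws, and their densities
    {𝒳 : ℕ → Type*} [∀ j, MeasurableSpace (𝒳 j)]
    (P₀ P₁ : (j : ℕ) → Measure (𝒳 j))
    [∀ j, IsProbabilityMeasure (P₀ j)] [∀ j, IsProbabilityMeasure (P₁ j)]
    (μ : (j : ℕ) → Measure (𝒳 j)) (f₀ f₁ : (j : ℕ) → 𝒳 j → ℝ)
    (hf₀ : ∀ j, CROC.IsDensity (P₀ j) (μ j) (f₀ j))
    (hf₁ : ∀ j, CROC.IsDensity (P₁ j) (μ j) (f₁ j))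
    -- distinguishability: finite KL divergences, Jeffreys divergences bounded away from zero
    (hKL : ∀ j, klDiv (P₀ j) (P₁ j) < ∞ ∧ klDiv (P₁ j) (P₀ j) < ∞)
    (hJ : 0 < ⨅ j, (klDiv (P₀ j) (P₁ j) + klDiv (P₁ j) (P₀ j)))
    -- uniformly bounded variances of the log-likelihood ratios
    (v : ℝ)
    (hvar₀ : ∀ j, MemLp (CROC.logLR (f₀ j) (f₁ j)) 2 (P₀ j) ∧
      variance (CROC.logLR (f₀ j) (f₁ j)) (P₀ j) ≤ v)
    (hvar₁ : ∀ j, MemLp (CROC.logLR (f₀ j) (f₁ j)) 2 (P₁ j) ∧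
      variance (CROC.logLR (f₀ j) (f₁ j)) (P₁ j) ≤ v)
    -- the number of streams
    (K : ℕ → ℕ) (hK : Tendsto K atTop atTop)
    (hKn : Tendsto (fun n => (K n : ℝ) / (n : ℝ)) atTop (𝓝 0))
    -- the true changepoints, the constraint sets and the root-cause indices
    (ξ : (n : ℕ) → Fin (K n) → ℕ)
    (R : (n : ℕ) → Set (Fin (K n) → ℕ))
    (hR : ∀ n, ∀ t ∈ R n, ∀ k, t k ∈ Set.Icc 1 n)
    (hξR : ∀ᶠ n in atTop, ξ n ∈ R n)
    (kstar : (n : ℕ) → Fin (K n))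
    (hroot : ∀ᶠ n in atTop, CROC.IsRoot (ξ n) (kstar n))
    -- interior changepoints
    (τ : ℝ) (hτ : τ ∈ Set.Ioo (0 : ℝ) (1 / 2))
    (hint : ∀ᶠ n : ℕ in atTop, ∀ j, τ ≤ min (ξ n j : ℝ) ((n : ℝ) - (ξ n j : ℝ)) / (n : ℝ))
    -- separation of the root
    (hsep : Tendsto
      (fun n => (⨅ j : {j : Fin (K n) // j ≠ kstar n}, ((ξ n j : ℝ) - (ξ n (kstar n) : ℝ))) /
        ((K n : ℝ) * Real.log (K n : ℝ))) atTop atTop)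
    -- the data
    {Ω : ℕ → Type*} [∀ n, MeasurableSpace (Ω n)] (Pr : (n : ℕ) → Measure (Ω n))
    [∀ n, IsProbabilityMeasure (Pr n)]
    (X : (n : ℕ) → (k : Fin (K n)) → Fin n → Ω n → 𝒳 k)
    (hX : ∀ n, CROC.IsIIDChangepointModel (𝒳 := fun k : Fin (K n) => 𝒳 k) (Pr n) (X n)
      (fun k => P₀ k) (fun k => P₁ k) (ξ n)) :
    (∀ ε : ℝ, 0 < ε →
      Tendsto (fun n => Pr n {ω | ε ≤ ⨆ k : {k : Fin (K n) // k ≠ kstar n},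
        CROC.rootPValue (𝒳 := fun k : Fin (K n) => 𝒳 k) (R n)
          (CROC.oracleScore (fun k => f₀ k) (fun k => f₁ k))
          (fun j i => X n j i ω) k}) atTop (𝓝 0)) ∧
    (∀ α ∈ Set.Ioo (0 : ℝ) 1, ∀ δ : ℝ, 0 < δ → ∀ᶠ n in atTop,
      1 - α - δ ≤ (Pr n).real {ω |
        CROC.confidenceSet (𝒳 := fun k : Fin (K n) => 𝒳 k) (R n)
          (CROC.oracleScore (fun k => f₀ k) (fun k => f₁ k)) α
          (fun j i => X n j i ω) = {kstar n}}) := by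
  have hv : 0 ≤ v := (variance_nonneg _ _).trans (hvar₀ 0).2
  obtain ⟨c, hc, hc1, hc₀, hc₁⟩ :=
    CROC.exists_pos_le_integral_logLR hf₀ hf₁ hKL hJ hv hvar₀ hvar₁
  have hac : ∀ j, P₀ j ≪ P₁ j ∧ P₁ j ≪ P₀ j := fun j =>
    ⟨(klDiv_ne_top_iff.1 (hKL j).1.ne).1, (klDiv_ne_top_iff.1 (hKL j).2.ne).1⟩
  have hτ0 : 0 < τ := hτ.1
  obtain ⟨p, hp, hlim⟩ := CROC.exists_truncation_levels hK
    (show 0 < c * τ / 8 by positivity) hsep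
  have first : ∀ ε : ℝ, 0 < ε →
      Tendsto (fun n => Pr n {ω | ε ≤ ⨆ k : {k : Fin (K n) // k ≠ kstar n},
        CROC.rootPValue (𝒳 := fun k : Fin (K n) => 𝒳 k) (R n)
          (CROC.oracleScore (fun k => f₀ k) (fun k => f₁ k))
          (fun j i => X n j i ω) k}) atTop (𝓝 0) := by
    intro ε hε
    have hb : Tendsto (fun n => ENNReal.ofReal
        (CROC.streamConst c τ v / ε * ((K n : ℝ) * (p n + 2) / 2 ^ p n))) atTop (𝓝 0) := by
      simpa using ENNReal.tendsto_ofReal (hlim.const_mul (CROC.streamConst c τ v / ε))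
    refine tendsto_of_tendsto_of_tendsto_of_le_of_le' tendsto_const_nhds hb
      (Eventually.of_forall fun _ => zero_le) ?_
    filter_upwards [eventually_ge_atTop 1, hξR, hint, hp] with n hn hξn hin hpn
    have hn0 : (0 : ℝ) < n := by exact_mod_cast hn
    have hin' : ∀ j, τ * n ≤ min (ξ n j : ℝ) ((n : ℝ) - (ξ n j : ℝ)) := fun j =>
      (le_div_iff₀ hn0).1 (hin j)
    exact (hX n).measure_iSup_rootPValue_le hn (fun k => hf₀ k) (fun k => hf₁ k)
      (fun k => hac k) hv (fun k => hvar₀ k) (fun k => hvar₁ k) hc hc1 hτ0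
      (by linarith [hτ.2]) (fun k => hc₀ k) (fun k => hc₁ k) (hR n) (hR n _ hξn)
      (fun k => (hin' k).trans (min_le_left _ _)) (fun k => (hin' k).trans (min_le_right _ _))
      (kstar n) hpn hε
  refine ⟨first, fun α hα δ hδ => ?_⟩
  -- Consistency is applied at the threshold `ε = α`: below it no wrong stream enters the confidence
  -- set.
  have hsmall := (first α hα.1).eventually_le_const (ENNReal.ofReal_pos.2 hδ)
  filter_upwards [eventually_ge_atTop 1, hξR, hroot, hsmall] with n hn hξn hrn hδn
  have hcov := (hX n).measure_configPValue_le (CROC.measurable_oracleScore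
    (fun k => (hf₀ k).measurable) (fun k => (hf₁ k).measurable) hn (ξ n)) hα.1.le
  set A := {ω | CROC.confidenceSet (𝒳 := fun k : Fin (K n) => 𝒳 k) (R n)
    (CROC.oracleScore (fun k => f₀ k) (fun k => f₁ k)) α (fun j i => X n j i ω) = {kstar n}}
    with hA
  set B₁ := {ω | α ≤ ⨆ k : {k : Fin (K n) // k ≠ kstar n},
    CROC.rootPValue (𝒳 := fun k : Fin (K n) => 𝒳 k) (R n)
      (CROC.oracleScore (fun k => f₀ k) (fun k => f₁ k)) (fun j i => X n j i ω) k} with hB₁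
  set B₂ := {ω | CROC.configPValue (𝒳 := fun k : Fin (K n) => 𝒳 k)
    (CROC.oracleScore (fun k => f₀ k) (fun k => f₁ k)) (fun j i => X n j i ω) (ξ n) ≤ α} with hB₂
  -- Subadditivity of the outer measure on this cover gives the lower bound for `A` without any
  -- measurability of the three events.
  have hcover : Set.univ ⊆ A ∪ B₁ ∪ B₂ := by
    intro ω _
    by_cases h1 : ω ∈ B₁
    · exact Or.inl (Or.inr h1)
    by_cases h2 : ω ∈ B₂
    · exact Or.inr h2
    exact Or.inl (Or.inl (CROC.confidenceSet_eq_singleton hξn hrn (not_le.1 h1) (not_le.1 h2)))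
  have h1 : (1 : ℝ) ≤ (Pr n).real A + (Pr n).real B₁ + (Pr n).real B₂ := by
    rw [← probReal_univ (μ := Pr n)]
    exact (measureReal_mono hcover).trans ((measureReal_union_le _ _).trans
      (by gcongr; exact measureReal_union_le _ _))
  have h2 : (Pr n).real B₁ ≤ δ := ENNReal.toReal_le_of_le_ofReal hδ.le hδn
  have h3 : (Pr n).real B₂ ≤ α := ENNReal.toReal_le_of_le_ofReal hα.1.le hcov
  linarith
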